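/- An $n$-configuration is a set of $n$ distinct points of $\mathbb{RP}^2$; the space of $n$-configurations is the quotient of the space of injective $n$-tuples of points of $\mathbb{RP}^2$ by the action of the symmetric group $S_n$. A configuration is simple if no three of its points are collinear, and typical if moreover no six of its points lie on a conic. The adjacency graph of a simple $n$-configuration $\mathcal P$ has vertex set $\mathcal P$; two points $p,q$ are joined by an edge if one of the two segments of the line $pq$ with endpoints $p,q$ is not crossed by any line through two of the remaining $n-2$ points. For $i\in\{1,2,3,6\}$ let $LC^6_i$ be the set of simple $6$-configurations whose adjacency graph has $i$ connected components; those in $LC^6_1$ are called cyclic (or hexagonal). A cyclic numeration of a $6$-configuration $\mathcal P$ is a numeration $p_1,\dots,p_6$ of its points as the consecutive vertices of a convex hexagon in the affine plane $\mathbb{RP}^2\smallsetminus\ell$ for some line $\ell$ disjoint from $\mathcal P$; the principal diagonals are then the lines $p_1p_4$, $p_2p_5$, $p_3p_6$, and if they are not concurrent, the central triangle $E$ of $\mathcal P$ is the open triangle in this affine plane whose vertices are their three pairwise intersection points. The derivative code of a $7$-configuration $\mathcal P$ is $(\sigma_1,\sigma_2,\sigma_3,\sigma_6)$, where $\sigma_k$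 is the number of points $p\in\mathcal P$ with $\mathcal P\smallsetminus\{p\}\in LC^6_k$. Let $QC^7_{(1,0,6,0)}$ be the set of typical $7$-configurations with derivative code $(1,0,6,0)$. **Proposition.** (1) The space $\widetilde{LC^6_1}$ of typical cyclic $6$-configurations whose three principal diagonals are not concurrent is path-connected, hence connected. (2) $QC^7_{(1,0,6,0)}$ is exactly the set of $7$-configurations of the form $\mathcal P_0\cup\{p_0\}$ with $\mathcal P_0\in\widetilde{LC^6_1}$ and $p_0$ in the central triangle $E$ of $\mathcal P_0$, and this space is path-connected, hence connected. -/

import Mathlib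

open scoped LinearAlgebra.Projectivization

noncomputable section

/-- The real projective plane. -/
abbrev RP2 : Type := ℙ ℝ (Fin 3 → ℝ)

/-- The usual topology of the real projective plane: the quotient topology from `ℝ³ ∖ {0}`. -/
instance RP2.instTopologicalSpace : TopologicalSpace RP2 :=
  inferInstanceAs (TopologicalSpace (Quotient (projectivizationSetoid ℝ (Fin 3 → ℝ))))

/-- The (projective) line through two distinct points. -/
def projLine (p q : RP2) : Set RP2 := {x | x.submodule ≤ p.submodule ⊔ q.submodule}

/-- The points lie on a conic, the zero locus of a nonzero quadratic form. -/
def Coconic (t : Finset RP2) : Prop :=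
  ∃ Q : QuadraticForm ℝ (Fin 3 → ℝ), Q ≠ 0 ∧ ∀ p ∈ t, Q p.rep = 0

/-! ### Configuration spaces -/

/-- An `n`-configuration: an (unordered) set of `n` distinct points of the projective plane. -/
def Configuration (n : ℕ) : Type := {s : Finset RP2 // s.card = n}

namespace Configuration

/-- The underlying set of points. -/
def points {n : ℕ} (P : Configuration n) : Finset RP2 := P.1

/-- The configuration of the members of an injective `n`-tuple of points. -/
def ofTuple {n : ℕ} (f : {f : Fin n → RP2 // Function.Injective f}) : Configuration n :=
  ⟨Finset.univ.map ⟨f.1, f.2⟩, by simp⟩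

/-- The space of `n`-configurations is the quotient of the space of injective `n`-tuples
(with the topology induced from the product) by the permutations of the entries. -/
instance instTopologicalSpace (n : ℕ) : TopologicalSpace (Configuration n) :=
  TopologicalSpace.coinduced ofTuple inferInstance

open Classical in
/-- The configuration with one of its points removed. -/
def erase {n : ℕ} (P : Configuration (n + 1)) (p : {x // x ∈ P.points}) : Configuration n :=
  ⟨P.points.erase p.1, by
    rw [Finset.card_erase_of_mem p.2, show P.points.card = n + 1 from P.2, Nat.add_sub_cancel]⟩

/-- No three points are collinear. -/
def IsSimple {n : ℕ} (P : Configuration n) : Prop :=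
  ∀ t ⊆ P.points, t.card = 3 → ¬ Projectivization.IsCollinear (t : Set RP2)

/-- No three points are collinear and no six points are coconic. -/
def IsTypical {n : ℕ} (P : Configuration n) : Prop :=
  P.IsSimple ∧ ∀ t ⊆ P.points, t.card = 6 → ¬ Coconic t

end Configuration

/-! ### Adjacency graphs and derivative codes -/

/-- The open segment of points `[a v + b w]` with `a, b > 0`. For linearly independent `v` and `w`
it is one of the two segments into which the points `[v]` and `[w]` divide the line through them;
the other one is the segment given by `v` and `-w`. -/
def projSegment (v w : Fin 3 → ℝ) : Set RP2 :=
  {x | ∃ a b : ℝ, 0 < a ∧ 0 < b ∧ ∃ h : a • v + b • w ≠ 0, x = Projectivization.mk ℝ (a • v + b • w) h}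

namespace Configuration

/-- The adjacency graph: two points `p ≠ q` of `P` are joined by an edge if one of the two segments
between them is crossed by none of the lines through two of the remaining points of `P`. -/
def adjacencyGraph {n : ℕ} (P : Configuration n) : SimpleGraph {x // x ∈ P.points} where
  Adj p q := p ≠ q ∧ ∃ (v w : Fin 3 → ℝ) (hv : v ≠ 0) (hw : w ≠ 0),
    Projectivization.mk ℝ v hv = p.1 ∧ Projectivization.mk ℝ w hw = q.1 ∧
      ∀ r s : {x // x ∈ P.points}, r ≠ s → r ≠ p → r ≠ q → s ≠ p → s ≠ q →
        Disjoint (projSegment v w) (projLine r.1 s.1)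
  symm := ⟨by
    rintro p q ⟨hpq, v, w, hv, hw, hp, hq, h⟩
    refine ⟨hpq.symm, w, v, hw, hv, hq, hp, fun r s hrs h1 h2 h3 h4 => ?_⟩
    have hsub : projSegment w v ⊆ projSegment v w := by
      rintro x ⟨a, b, ha, hb, hne, rfl⟩
      exact ⟨b, a, hb, ha, by rwa [add_comm], by simp only [add_comm]⟩
    exact (h r s hrs h2 h1 h4 h3).mono_left hsub⟩
  loopless := ⟨fun p h => h.1 rfl⟩

/-- The simple 6-configurations whose adjacency graph has `i` connected components: cyclic for
`i = 1`, bicomponent for `i = 2`, tricomponent for `i = 3`, icosahedral for `i = 6`. -/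
def LC6 (i : ℕ) : Set (Configuration 6) :=
  {P | P.IsSimple ∧ Nat.card P.adjacencyGraph.ConnectedComponent = i}

/-- The number of points `p` of a 7-configuration `P` such that `P ∖ {p}` lies in `LC6 k`. -/
def codeEntry (P : Configuration 7) (k : ℕ) : ℕ :=
  Nat.card {p : {x // x ∈ P.points} // P.erase p ∈ LC6 k}

/-- The derivative code `(σ₁, σ₂, σ₃, σ₆)` of a 7-configuration. -/
def derivativeCode (P : Configuration 7) : ℕ × ℕ × ℕ × ℕ :=
  (P.codeEntry 1, P.codeEntry 2, P.codeEntry 3, P.codeEntry 6)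

/-- The typical 7-configurations with derivative code `σ`. -/
def QC7 (σ : ℕ × ℕ × ℕ × ℕ) : Set (Configuration 7) :=
  {P | P.IsTypical ∧ P.derivativeCode = σ}

end Configuration

/-! ### Hexagons, principal diagonals and the central triangle -/

/-- `u 0, …, u 5` are the consecutive vertices, in counterclockwise order, of a convex hexagon in the
affine plane `{v | φ v = 1}`, which is the affine chart of the projective plane that is complementary
to the line `φ = 0`. (Reversing the numeration interchanges the two orientations.) -/
structure IsConvexHexagon (φ : (Fin 3 → ℝ) →ₗ[ℝ] ℝ) (u : Fin 6 → (Fin 3 → ℝ)) : Prop where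
  chart : ∀ i, φ (u i) = 1
  convex : ∀ i j k, i < j → j < k → 0 < (Matrix.of ![u i, u j, u k]).det

/-- The open triangle in the chart `φ = 1` whose vertices `X`, `Y`, `Z` are the three pairwise
intersection points of the principal diagonals of the hexagon `u`. -/
def diagonalTriangle (φ : (Fin 3 → ℝ) →ₗ[ℝ] ℝ) (u : Fin 6 → (Fin 3 → ℝ)) : Set RP2 :=
  {x | ∃ X Y Z : Fin 3 → ℝ, φ X = 1 ∧ φ Y = 1 ∧ φ Z = 1 ∧
    X ∈ Submodule.span ℝ {u 0, u 3} ⊓ Submodule.span ℝ {u 1, u 4} ∧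
    Y ∈ Submodule.span ℝ {u 1, u 4} ⊓ Submodule.span ℝ {u 2, u 5} ∧
    Z ∈ Submodule.span ℝ {u 2, u 5} ⊓ Submodule.span ℝ {u 0, u 3} ∧
    ∃ a b c : ℝ, 0 < a ∧ 0 < b ∧ 0 < c ∧ ∃ h : a • X + b • Y + c • Z ≠ 0,
      x = Projectivization.mk ℝ (a • X + b • Y + c • Z) h}

namespace Configuration

/-- The points of `P` are the vertices of the hexagon `u`, convex in the affine chart `φ = 1`. -/
def FormsHexagon (P : Configuration 6) (φ : (Fin 3 → ℝ) →ₗ[ℝ] ℝ) (u : Fin 6 → (Fin 3 → ℝ)) : Prop :=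
  IsConvexHexagon φ u ∧
    ∀ x : RP2, x ∈ P.points ↔ ∃ (i : Fin 6) (h : u i ≠ 0), x = Projectivization.mk ℝ (u i) h

/-- `p 0, …, p 5` is a cyclic numeration of the points of `P`, i.e. they are the consecutive vertices
of a convex hexagon in some affine chart. -/
def IsCyclicNumeration (P : Configuration 6) (p : Fin 6 → RP2) : Prop :=
  ∃ φ u, P.FormsHexagon φ u ∧ ∀ i, ∃ h : u i ≠ 0, p i = Projectivization.mk ℝ (u i) h

/-- The typical cyclic (hexagonal) 6-configurations whose three principal diagonals are not
concurrent. -/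
def nonconcurrentLC61 : Set (Configuration 6) :=
  {P | P ∈ LC6 1 ∧ P.IsTypical ∧ ∃ p : Fin 6 → RP2, P.IsCyclicNumeration p ∧
    ¬ ∃ x, x ∈ projLine (p 0) (p 3) ∧ x ∈ projLine (p 1) (p 4) ∧ x ∈ projLine (p 2) (p 5)}

/-- The central triangle `E` of a cyclic 6-configuration with non-concurrent principal diagonals: the
polygon inside the hexagon that is bounded by the three principal diagonals. -/
def centralTriangle (P : Configuration 6) : Set RP2 :=
  {x | ∃ φ u, P.FormsHexagon φ u ∧ x ∈ diagonalTriangle φ u}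

end Configuration

end

/-!
A configuration is described by vectors `u i` of homogeneous coordinates of its points, and
everything is expressed by the brackets `[i j k] = det (u i, u j, u k)`. The vertices of a convex
hexagon are characterized by the positivity of all brackets `[i j k]` with `i < j < k` (`Positive`).
The polynomials `concurrency` and `conicity` in the brackets vanish iff the principal diagonals are
concurrent and iff the vertices lie on a conic, respectively. A point `v` lies in the central
triangle iff the signs of `[0 3 v]`, `[1 4 v]`, `[2 5 v]` alternate in the way prescribed by the sign
of `concurrency` (`Central`).

*Combinatorics.* The adjacency graph only depends on the signs of the brackets (`signGraph`). Any
five points, no three of them collinear, are the vertices of a convex pentagon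
(`Generic.exists_positive`), so for a simple 6-configuration these signs are determined by those of
the ten brackets `[i j v]` of a positive pentagon with the sixth point `v`. Going through the 1024
sign patterns one finds those for which the graph has one or three components
(`patternCheck_eq_true`). One component occurs only for convex hexagons
(`exists_positive_of_mem_LC6_one`). If `P` has the derivative code `(1, 0, 6, 0)`, then removing one
of its points leaves a hexagon, and replacing any vertex of this hexagon by the removed point gives a
configuration with three components; comparing the patterns of the six resulting pentagons forces
the signs on the principal diagonals to alternate, so that the point is in the central triangle
(`central_of_card_eq_three`). Conversely, the signs of a point of the central triangle with respect
to all lines through two vertices are known, up to the sign of the three diagonals, and give three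
components each time (`Central.card_eq_three`), and no conic through five vertices
(`Central.conicity_ne_zero`). This is the description of `QC7 (1, 0, 6, 0)`.

*Topology.* Rotating a numeration changes the signs of `concurrency` and `conicity`, reversing it
only that of `conicity`; so both may be assumed to be positive. Taking the vertices `0, 2, 4` as a
basis puts such a hexagon into a normal form with six parameters that range over `normalRegion`.
This region is path-connected: it can be deformed into a part that is convex in logarithmic
coordinates. Both spaces are therefore images under continuous maps of products of path-connected
sets: the matrices of positive determinant (`isPathConnected_det_pos`), the region `normalRegion`
and, for the second space, the barycentric coordinates of the point in the central triangle
(`IsPathConnected.of_represents`).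
-/

/-! ### Brackets -/

/-- The bracket `[a b c]`: the determinant of three vectors of `ℝ³`. -/
def br (a b c : Fin 3 → ℝ) : ℝ := (Matrix.of ![a, b, c]).det

theorem br_eq (a b c : Fin 3 → ℝ) : br a b c =
    a 0 * b 1 * c 2 - a 0 * b 2 * c 1 - a 1 * b 0 * c 2 + a 1 * b 2 * c 0 + a 2 * b 0 * c 1
      - a 2 * b 1 * c 0 := by
  simp [br, Matrix.det_fin_three]

theorem br_cycle (a b c : Fin 3 → ℝ) : br a b c = br b c a := by simp only [br_eq]; ring

theorem br_swap₁₂ (a b c : Fin 3 → ℝ) : br b a c = -br a b c := by simp only [br_eq]; ring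

theorem br_swap₂₃ (a b c : Fin 3 → ℝ) : br a c b = -br a b c := by simp only [br_eq]; ring

theorem br_swap₁₃ (a b c : Fin 3 → ℝ) : br c b a = -br a b c := by simp only [br_eq]; ring

theorem br_self₁₂ (a c : Fin 3 → ℝ) : br a a c = 0 := by simp only [br_eq]; ring

theorem br_self₁₃ (a b : Fin 3 → ℝ) : br a b a = 0 := by simp only [br_eq]; ring

theorem br_self₂₃ (a b : Fin 3 → ℝ) : br a b b = 0 := by simp only [br_eq]; ring

theorem br_smul (x y z : ℝ) (a b c : Fin 3 → ℝ) :
    br (x • a) (y • b) (z • c) = x * y * z * br a b c := by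
  simp only [br_eq, Pi.smul_apply, smul_eq_mul]; ring

theorem br_smul₁ (x : ℝ) (a b c : Fin 3 → ℝ) : br (x • a) b c = x * br a b c := by
  simp only [br_eq, Pi.smul_apply, smul_eq_mul]; ring

theorem br_smul₂ (x : ℝ) (a b c : Fin 3 → ℝ) : br a (x • b) c = x * br a b c := by
  simp only [br_eq, Pi.smul_apply, smul_eq_mul]; ring

theorem br_smul₃ (x : ℝ) (a b c : Fin 3 → ℝ) : br a b (x • c) = x * br a b c := by
  simp only [br_eq, Pi.smul_apply, smul_eq_mul]; ring

theorem br_add₃ (a b c d : Fin 3 → ℝ) : br a b (c + d) = br a b c + br a b d := by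
  simp only [br_eq, Pi.add_apply]; ring

theorem br_neg (a b c : Fin 3 → ℝ) : br (-a) (-b) (-c) = -br a b c := by
  simp only [br_eq, Pi.neg_apply]; ring

theorem br_neg₃ (a b c : Fin 3 → ℝ) : br a b (-c) = -br a b c := by
  simp only [br_eq, Pi.neg_apply]; ring

theorem br_mulVec (A : Matrix (Fin 3) (Fin 3) ℝ) (a b c : Fin 3 → ℝ) :
    br (A.mulVec a) (A.mulVec b) (A.mulVec c) = A.det * br a b c := by
  have h : Matrix.of ![A.mulVec a, A.mulVec b, A.mulVec c]
      = Matrix.of ![a, b, c] * A.transpose := by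
    ext i j
    fin_cases i <;> simp [Matrix.mul_apply, Matrix.mulVec, dotProduct, mul_comm]
  rw [br, h, Matrix.det_mul, Matrix.det_transpose, br, mul_comm]

/-- The three-term Grassmann–Plücker relation. -/
theorem br_plucker (a b c d e : Fin 3 → ℝ) :
    br a b c * br a d e - br a b d * br a c e + br a b e * br a c d = 0 := by
  simp only [br_eq]; ring

/-- Cramer's rule. -/
theorem br_cramer (a b c x : Fin 3 → ℝ) :
    br a b c • x = br x b c • a + br a x c • b + br a b x • c := by
  ext i
  fin_cases i <;> simp [br_eq] <;> ring

theorem ne_zero_of_br_ne_zero {a b c : Fin 3 → ℝ} (h : br a b c ≠ 0) : a ≠ 0 ∧ b ≠ 0 ∧ c ≠ 0 := by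
  refine ⟨?_, ?_, ?_⟩ <;> rintro rfl <;> exact h (by simp [br_eq])

theorem linearIndependent_of_br_ne_zero {a b c : Fin 3 → ℝ} (h : br a b c ≠ 0) :
    LinearIndependent ℝ ![a, b, c] := by
  have := Matrix.linearIndependent_rows_of_det_ne_zero (A := Matrix.of ![a, b, c]) h
  exact this

theorem br_ne_zero_of_linearIndependent {a b c : Fin 3 → ℝ} (h : LinearIndependent ℝ ![a, b, c]) :
    br a b c ≠ 0 := by
  have h1 : IsUnit (Matrix.of ![a, b, c]) := Matrix.linearIndependent_rows_iff_isUnit.1 h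
  exact ((Matrix.isUnit_iff_isUnit_det _).1 h1).ne_zero

theorem mem_span_pair_iff_br {a b c v : Fin 3 → ℝ} (h : br a b c ≠ 0) :
    v ∈ Submodule.span ℝ {a, b} ↔ br a b v = 0 := by
  rw [Submodule.mem_span_pair]
  constructor
  · rintro ⟨x, y, rfl⟩
    simp only [br_eq, Pi.add_apply, Pi.smul_apply, smul_eq_mul]; ring
  · intro hv
    have h2 := br_cramer a b c v
    rw [hv, zero_smul, add_zero] at h2
    refine ⟨(br a b c)⁻¹ * br v b c, (br a b c)⁻¹ * br a v c, ?_⟩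
    rw [mul_smul, mul_smul, ← smul_add, ← h2, inv_smul_smul₀ h]

theorem mk_mem_projLine_iff {a b c v : Fin 3 → ℝ} (ha : a ≠ 0) (hb : b ≠ 0) (hv : v ≠ 0)
    (h : br a b c ≠ 0) :
    Projectivization.mk ℝ v hv ∈ projLine (Projectivization.mk ℝ a ha) (Projectivization.mk ℝ b hb)
      ↔ br a b v = 0 := by
  rw [← mem_span_pair_iff_br h, projLine, Set.mem_ofPred_eq, Projectivization.submodule_mk,
    Projectivization.submodule_mk, Projectivization.submodule_mk, ← Submodule.span_union,
    Submodule.span_singleton_le_iff_mem, Set.singleton_union]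

theorem isCollinear_iff_br {a b c : Fin 3 → ℝ} (ha : a ≠ 0) (hb : b ≠ 0) (hc : c ≠ 0) :
    Projectivization.IsCollinear ({Projectivization.mk ℝ a ha, Projectivization.mk ℝ b hb,
      Projectivization.mk ℝ c hc} : Set RP2) ↔ br a b c = 0 := by
  constructor
  · rintro ⟨M, -, hM, hS⟩
    by_contra h
    have hli := linearIndependent_of_br_ne_zero h
    have hle : Submodule.span ℝ (Set.range ![a, b, c]) ≤ M.submodule := by
      rw [Submodule.span_le]
      rintro x ⟨i, rfl⟩
      fin_cases i
      · exact fun _ => hS (by simp)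
      · exact fun _ => hS (by simp)
      · exact fun _ => hS (by simp)
    have h3 := finrank_span_eq_card hli
    have h4 := Submodule.finrank_mono hle
    simp only [Fintype.card_fin] at h3
    omega
  · intro h
    refine ⟨(Submodule.span ℝ (Set.range ![a, b, c])).projectivization, ?_, ?_, ?_⟩
    · infer_instance
    · rw [Projectivization.Subspace.submodule.apply_symm_apply]
      by_contra hlt
      exact br_ne_zero_of_linearIndependent (linearIndependent_iff_card_le_finrank_span.2 (by
        rw [Fintype.card_fin]; exact not_le.1 hlt)) h
    · rintro x (rfl | rfl | rfl) <;>
      · rw [SetLike.mem_coe, Submodule.mk_mem_projectivization_iff]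
        exact Submodule.subset_span (by simp)

/-! ### Homogeneous coordinates of configurations -/

/-- The vectors `u i` are homogeneous coordinates of the points of `s`. -/
def Represents {ι : Type*} (u : ι → Fin 3 → ℝ) (s : Finset RP2) : Prop :=
  (∀ i, u i ≠ 0) ∧ ∀ x, x ∈ s ↔ ∃ (i : ι) (h : u i ≠ 0), x = Projectivization.mk ℝ (u i) h

/-- Any three of the vectors `u i` are linearly independent. -/
def Generic {ι : Type*} (u : ι → Fin 3 → ℝ) : Prop :=
  ∀ i j k, i ≠ j → i ≠ k → j ≠ k → br (u i) (u j) (u k) ≠ 0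

theorem mk_smul_eq {a : Fin 3 → ℝ} {c : ℝ} (ha : a ≠ 0) (h : c • a ≠ 0) :
    Projectivization.mk ℝ (c • a) h = Projectivization.mk ℝ a ha :=
  (Projectivization.mk_eq_mk_iff' ℝ _ _ _ _).2 ⟨c, rfl⟩

theorem mk_ne_mk_of_br_ne_zero {a b c : Fin 3 → ℝ} (ha : a ≠ 0) (hb : b ≠ 0) (h : br a b c ≠ 0) :
    Projectivization.mk ℝ a ha ≠ Projectivization.mk ℝ b hb := by
  intro he
  obtain ⟨x, rfl⟩ := (Projectivization.mk_eq_mk_iff' ℝ _ _ _ _).1 he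
  exact h (by rw [br_smul₁, br_self₁₂, mul_zero])

theorem Represents.reindex {ι κ : Type*} {u : ι → Fin 3 → ℝ} {s : Finset RP2} (h : Represents u s)
    {u' : κ → Fin 3 → ℝ} {σ : κ → ι} (hσ : Function.Surjective σ) {c : κ → ℝ} (hc : ∀ k, c k ≠ 0)
    (hu : ∀ k, u' k = c k • u (σ k)) : Represents u' s := by
  have h0 : ∀ k, u' k ≠ 0 := fun k => by rw [hu]; exact smul_ne_zero (hc k) (h.1 _)
  have he : ∀ k, Projectivization.mk ℝ (u' k) (h0 k) = Projectivization.mk ℝ (u (σ k)) (h.1 _) :=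
    fun k => (Projectivization.mk_eq_mk_iff' ℝ _ _ _ _).2 ⟨c k, (hu k).symm⟩
  refine ⟨h0, fun x => ?_⟩
  rw [h.2]
  constructor
  · rintro ⟨i, hi, rfl⟩
    obtain ⟨k, rfl⟩ := hσ i
    exact ⟨k, h0 k, (he k).symm⟩
  · rintro ⟨k, hk, rfl⟩
    exact ⟨σ k, h.1 _, he k⟩

theorem Generic.reindex {ι κ : Type*} {u : ι → Fin 3 → ℝ} (h : Generic u)
    {u' : κ → Fin 3 → ℝ} {σ : κ → ι} (hσ : Function.Injective σ) {c : κ → ℝ} (hc : ∀ k, c k ≠ 0)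
    (hu : ∀ k, u' k = c k • u (σ k)) : Generic u' := by
  intro i j k hij hik hjk
  rw [hu, hu, hu, br_smul]
  exact mul_ne_zero (mul_ne_zero (mul_ne_zero (hc _) (hc _)) (hc _))
    (h _ _ _ (hσ.ne hij) (hσ.ne hik) (hσ.ne hjk))

theorem Configuration.exists_represents {n : ℕ} (P : Configuration n) :
    ∃ u : Fin n → Fin 3 → ℝ, Represents u P.points := by
  let e := P.points.equivFinOfCardEq P.2
  refine ⟨fun i => (e.symm i).1.rep, fun i => Projectivization.rep_nonzero _,
    fun x => ⟨fun hx => ?_, ?_⟩⟩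
  · refine ⟨e ⟨x, hx⟩, Projectivization.rep_nonzero _, ?_⟩
    simp [Projectivization.mk_rep]
  · rintro ⟨i, h, rfl⟩
    rw [Projectivization.mk_rep]
    exact (e.symm i).2

namespace Represents

variable {n : ℕ} {u : Fin n → Fin 3 → ℝ} {P : Configuration n}

theorem mk_mem (h : Represents u P.points) (i : Fin n) :
    Projectivization.mk ℝ (u i) (h.1 i) ∈ P.points := (h.2 _).2 ⟨i, h.1 i, rfl⟩

theorem bijective (h : Represents u P.points) : Function.Bijective
    (fun i => (⟨Projectivization.mk ℝ (u i) (h.1 i), h.mk_mem i⟩ : {x // x ∈ P.points})) := by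
  have hs : Function.Surjective
    (fun i => (⟨Projectivization.mk ℝ (u i) (h.1 i), h.mk_mem i⟩ : {x // x ∈ P.points})) := by
    rintro ⟨x, hx⟩
    obtain ⟨i, hi, rfl⟩ := (h.2 x).1 hx
    exact ⟨i, rfl⟩
  rw [Fintype.bijective_iff_surjective_and_card]
  refine ⟨hs, ?_⟩
  rw [Fintype.card_fin, Fintype.card_coe]
  exact P.2.symm

/-- The points of the configuration, numbered by the vectors that represent them. -/
noncomputable def equiv (h : Represents u P.points) : Fin n ≃ {x // x ∈ P.points} :=
  Equiv.ofBijective _ h.bijective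

theorem coe_equiv (h : Represents u P.points) (i : Fin n) :
    (h.equiv i).1 = Projectivization.mk ℝ (u i) (h.1 i) := rfl

theorem isSimple_iff (h : Represents u P.points) : P.IsSimple ↔ Generic u := by
  constructor
  · intro hP i j k hij hik hjk h0
    have hne : ∀ {i j}, i ≠ j →
        Projectivization.mk ℝ (u i) (h.1 i) ≠ Projectivization.mk ℝ (u j) (h.1 j) :=
      fun {i j} hij he => hij (h.bijective.1 (Subtype.ext he))
    classical
    refine hP {Projectivization.mk ℝ (u i) (h.1 i), Projectivization.mk ℝ (u j) (h.1 j),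
      Projectivization.mk ℝ (u k) (h.1 k)} ?_ ?_ ?_
    · intro x hx
      simp only [Finset.mem_insert, Finset.mem_singleton] at hx
      rcases hx with rfl | rfl | rfl <;> exact h.mk_mem _
    · exact Finset.card_eq_three.2 ⟨_, _, _, hne hij, hne hik, hne hjk, rfl⟩
    · have := (isCollinear_iff_br (h.1 i) (h.1 j) (h.1 k)).2 h0
      simpa using this
  · intro hu t ht hcard
    classical
    obtain ⟨x, y, z, hxy, hxz, hyz, rfl⟩ := Finset.card_eq_three.1 hcard
    obtain ⟨i, hi, rfl⟩ := (h.2 x).1 (ht (by simp))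
    obtain ⟨j, hj, rfl⟩ := (h.2 y).1 (ht (by simp))
    obtain ⟨k, hk, rfl⟩ := (h.2 z).1 (ht (by simp))
    intro hc
    refine hu i j k ?_ ?_ ?_ ((isCollinear_iff_br hi hj hk).1 (by simpa using hc))
    · rintro rfl; exact hxy rfl
    · rintro rfl; exact hxz rfl
    · rintro rfl; exact hyz rfl

end Represents

/-! ### Adjacency in terms of signs of brackets -/

theorem disjoint_projSegment_projLine_iff {v w r s : Fin 3 → ℝ} (hr : r ≠ 0) (hs : s ≠ 0)
    (hv : br r s v ≠ 0) (hw : br r s w ≠ 0) (hvw : br v w r ≠ 0) :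
    Disjoint (projSegment v w) (projLine (Projectivization.mk ℝ r hr) (Projectivization.mk ℝ s hs))
      ↔ 0 < br r s v * br r s w := by
  rw [Set.disjoint_left]
  constructor
  · intro h
    by_contra hneg
    have hlt : br r s v * br r s w < 0 :=
      lt_of_le_of_ne (not_lt.1 hneg) (mul_ne_zero hv hw)
    have hne : |br r s w| • v + |br r s v| • w ≠ 0 := by
      refine (ne_zero_of_br_ne_zero (b := w) (c := r) ?_).1
      have : br (|br r s w| • v + |br r s v| • w) w r = |br r s w| * br v w r := by
        simp only [br_eq, Pi.add_apply, Pi.smul_apply, smul_eq_mul]; ring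
      rw [this]
      exact mul_ne_zero (abs_ne_zero.2 hw) hvw
    refine h ⟨_, _, abs_pos.2 hw, abs_pos.2 hv, hne, rfl⟩
      ((mk_mem_projLine_iff hr hs hne hv).2 ?_)
    rw [br_add₃, br_smul₃, br_smul₃]
    rcases mul_neg_iff.1 hlt with ⟨h1, h2⟩ | ⟨h1, h2⟩
    · rw [abs_of_pos h1, abs_of_neg h2]; ring
    · rw [abs_of_neg h1, abs_of_pos h2]; ring
  · rintro h x ⟨a, b, ha, hb, hne, rfl⟩ hx
    have h0 := (mk_mem_projLine_iff hr hs hne hv).1 hx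
    rw [br_add₃, br_smul₃, br_smul₃] at h0
    rcases mul_pos_iff.1 h with ⟨h1, h2⟩ | ⟨h1, h2⟩
    · nlinarith [mul_pos ha h1, mul_pos hb h2]
    · nlinarith [mul_neg_of_pos_of_neg ha h1, mul_neg_of_pos_of_neg hb h2]

/-- The adjacency graph in terms of homogeneous coordinates `u i`. The two alternatives say that no
line through two of the remaining points crosses the segment given by `u i` and `u j`, or the one
given by `u i` and `-u j`. -/
def signGraph {n : ℕ} (u : Fin n → Fin 3 → ℝ) : SimpleGraph (Fin n) where
  Adj i j := i ≠ j ∧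
    ((∀ r s, r ≠ s → r ≠ i → r ≠ j → s ≠ i → s ≠ j →
        0 < br (u r) (u s) (u i) * br (u r) (u s) (u j)) ∨
      (∀ r s, r ≠ s → r ≠ i → r ≠ j → s ≠ i → s ≠ j →
        br (u r) (u s) (u i) * br (u r) (u s) (u j) < 0))
  symm := ⟨by
    rintro i j ⟨hij, h⟩
    refine ⟨hij.symm, h.imp ?_ ?_⟩ <;>
    · intro h r s h1 h2 h3 h4 h5
      rw [mul_comm]
      exact h r s h1 h3 h2 h5 h4⟩
  loopless := ⟨fun i h => h.1 rfl⟩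

theorem Represents.adj_iff {n : ℕ} {u : Fin n → Fin 3 → ℝ} {P : Configuration n}
    (h : Represents u P.points) (hu : Generic u) (i j : Fin n) :
    P.adjacencyGraph.Adj (h.equiv i) (h.equiv j) ↔ (signGraph u).Adj i j := by
  have hne : ∀ {i j}, h.equiv i ≠ h.equiv j ↔ i ≠ j := h.equiv.injective.ne_iff
  constructor
  · rintro ⟨hij, v, w, hv, hw, hvi, hwj, H⟩
    have hij := hne.1 hij
    obtain ⟨a, rfl⟩ := (Projectivization.mk_eq_mk_iff' ℝ _ _ _ (h.1 i)).1 hvi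
    obtain ⟨b, rfl⟩ := (Projectivization.mk_eq_mk_iff' ℝ _ _ _ (h.1 j)).1 hwj
    have ha : a ≠ 0 := fun h0 => hv (by rw [h0, zero_smul])
    have hb : b ≠ 0 := fun h0 => hw (by rw [h0, zero_smul])
    have key : ∀ r s, r ≠ s → r ≠ i → r ≠ j → s ≠ i → s ≠ j →
        0 < (a * b) * (br (u r) (u s) (u i) * br (u r) (u s) (u j)) := by
      intro r s hrs hri hrj hsi hsj
      have := H (h.equiv r) (h.equiv s) (hne.2 hrs) (hne.2 hri) (hne.2 hrj) (hne.2 hsi) (hne.2 hsj)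
      rw [h.coe_equiv, h.coe_equiv, disjoint_projSegment_projLine_iff, br_smul₃, br_smul₃] at this
      · linarith
      · rw [br_smul₃]; exact mul_ne_zero ha (hu _ _ _ hrs hri hsi)
      · rw [br_smul₃]; exact mul_ne_zero hb (hu _ _ _ hrs hrj hsj)
      · rw [br_smul₁, br_smul₂]
        exact mul_ne_zero ha (mul_ne_zero hb (hu _ _ _ hij hri.symm hrj.symm))
    refine ⟨hij, ?_⟩
    rcases lt_or_gt_of_ne (mul_ne_zero ha hb) with hab | hab
    · right
      intro r s h1 h2 h3 h4 h5
      exact neg_of_mul_pos_right (key r s h1 h2 h3 h4 h5) hab.le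
    · left
      intro r s h1 h2 h3 h4 h5
      exact pos_of_mul_pos_right (key r s h1 h2 h3 h4 h5) hab.le
  · rintro ⟨hij, H⟩
    refine ⟨hne.2 hij, ?_⟩
    have key : ∀ ε : ℝ, ε ≠ 0 → (∀ r s, r ≠ s → r ≠ i → r ≠ j → s ≠ i → s ≠ j →
        0 < ε * (br (u r) (u s) (u i) * br (u r) (u s) (u j))) → ∃ (v w : Fin 3 → ℝ) (hv : v ≠ 0)
        (hw : w ≠ 0), Projectivization.mk ℝ v hv = (h.equiv i).1 ∧
          Projectivization.mk ℝ w hw = (h.equiv j).1 ∧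
      ∀ r s : {x // x ∈ P.points}, r ≠ s → r ≠ h.equiv i → r ≠ h.equiv j → s ≠ h.equiv i →
        s ≠ h.equiv j → Disjoint (projSegment v w) (projLine r.1 s.1) := by
      intro ε hε H
      refine ⟨u i, ε • u j, h.1 i, smul_ne_zero hε (h.1 j), rfl, mk_smul_eq _ _, ?_⟩
      intro r s
      obtain ⟨r, rfl⟩ := h.equiv.surjective r
      obtain ⟨s, rfl⟩ := h.equiv.surjective s
      rw [hne, hne, hne, hne, hne]
      intro hrs hri hrj hsi hsj
      rw [h.coe_equiv, h.coe_equiv, disjoint_projSegment_projLine_iff, br_smul₃]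
      · linarith [H r s hrs hri hrj hsi hsj]
      · exact hu _ _ _ hrs hri hsi
      · rw [br_smul₃]; exact mul_ne_zero hε (hu _ _ _ hrs hrj hsj)
      · rw [br_smul₂]
        exact mul_ne_zero hε (hu _ _ _ hij hri.symm hrj.symm)
    rcases H with H | H
    · exact key 1 one_ne_zero (by simpa using H)
    · exact key (-1) (by norm_num) (by simpa using H)

theorem Represents.card_connectedComponent {n : ℕ} {u : Fin n → Fin 3 → ℝ} {P : Configuration n}
    (h : Represents u P.points) (hu : Generic u) :
    Nat.card P.adjacencyGraph.ConnectedComponent = Nat.card (signGraph u).ConnectedComponent := by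
  let φ : signGraph u ≃g P.adjacencyGraph := ⟨h.equiv, fun {i j} => h.adj_iff hu i j⟩
  exact (Nat.card_congr φ.connectedComponentEquiv).symm

theorem Represents.mem_LC6_iff {u : Fin 6 → Fin 3 → ℝ} {P : Configuration 6}
    (h : Represents u P.points) (i : ℕ) :
    P ∈ Configuration.LC6 i ↔ Generic u ∧ Nat.card (signGraph u).ConnectedComponent = i := by
  rw [Configuration.LC6, Set.mem_ofPred_eq, h.isSimple_iff]
  exact and_congr_right fun hu => by rw [h.card_connectedComponent hu]

/-! ### Counting connected components -/

/-- Each edge, here listed in `l`, reduces the number of components by at most one. -/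
theorem SimpleGraph.card_le_card_connectedComponent_add {V : Type*} [Fintype V]
    (G : SimpleGraph V) (l : List (V × V))
    (hl : ∀ x y, G.Adj x y → (x, y) ∈ l ∨ (y, x) ∈ l) :
    Fintype.card V ≤ Nat.card G.ConnectedComponent + l.length := by
  classical
  have key : ∀ l : List (V × V), ∃ f : V → V, (∀ p ∈ l, f p.1 = f p.2) ∧
      Fintype.card V ≤ (Finset.univ.image f).card + l.length := by
    intro l
    induction l with
    | nil => exact ⟨id, by simp, by simp⟩
    | cons p l ih =>
      obtain ⟨f, hf, hc⟩ := ih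
      refine ⟨fun k => if f k = f p.2 then f p.1 else f k, ?_, ?_⟩
      · intro q hq
        rcases List.mem_cons.1 hq with rfl | hq
        · dsimp only
          split_ifs <;> simp_all
        · simp only [hf q hq]
      · have hsub : (Finset.univ.image f).erase (f p.2) ⊆
            Finset.univ.image (fun k => if f k = f p.2 then f p.1 else f k) := by
          intro y hy
          obtain ⟨hne, hy⟩ := Finset.mem_erase.1 hy
          obtain ⟨x, -, rfl⟩ := Finset.mem_image.1 hy
          exact Finset.mem_image.2 ⟨x, Finset.mem_univ _, by simp [hne]⟩
        have h1 := Finset.card_le_card hsub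
        have h2 := Finset.pred_card_le_card_erase (a := f p.2) (s := Finset.univ.image f)
        rw [List.length_cons]
        omega
  obtain ⟨f, hf, hc⟩ := key l
  have hadj : ∀ x y, G.Adj x y → f x = f y := fun x y h =>
    (hl x y h).elim (fun h => hf _ h) (fun h => (hf _ h).symm)
  have hreach : ∀ x y, G.Reachable x y → f x = f y := by
    rintro x y ⟨w⟩
    induction w with
    | nil => rfl
    | cons h _ ih => exact (hadj _ _ h).trans ih
  let g : G.ConnectedComponent → V := SimpleGraph.ConnectedComponent.lift f
    (fun x y p _ => hreach x y ⟨p⟩)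
  have h3 : (Finset.univ.image f).card ≤ Nat.card G.ConnectedComponent := by
    have : (Finset.univ.image f : Set V) ⊆ Set.range g := by
      intro y hy
      obtain ⟨x, -, rfl⟩ := Finset.mem_image.1 (Finset.mem_coe.1 hy)
      exact ⟨G.connectedComponentMk x, rfl⟩
    have h4 := Set.ncard_le_ncard this (Set.finite_range g)
    rw [Set.ncard_coe_finset] at h4
    exact h4.trans (by rw [← Set.image_univ, ← Set.ncard_univ]; exact Set.ncard_image_le)
  omega

theorem SimpleGraph.card_connectedComponent_le {V : Type*} (G : SimpleGraph V) {m : ℕ}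
    (d : Fin m → V) (h : ∀ v, ∃ k, G.Reachable (d k) v) :
    Nat.card G.ConnectedComponent ≤ m := by
  have hs : Function.Surjective (fun k => G.connectedComponentMk (d k)) := by
    intro c
    induction c using SimpleGraph.ConnectedComponent.ind with
    | h v =>
      obtain ⟨k, hk⟩ := h v
      exact ⟨k, SimpleGraph.ConnectedComponent.sound hk⟩
  simpa using Nat.card_le_card_of_surjective _ hs

/-! ### Sign patterns -/

/-- The position of the pair `i < j` in the list `01, 02, 12, 03, 13, 23, 04, …`. -/
def pairIndex (i j : ℕ) : ℕ := j * (j - 1) / 2 + i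

/-- Extension of a sign from increasing triples to all triples by the alternating rule. -/
def altSign (f : ℕ → ℕ → ℕ → Bool) (i j k : ℕ) : Bool :=
  if i < j then
    if j < k then f i j k else if i < k then !f i k j else f k i j
  else
    if i < k then !f j i k else if j < k then f j k i else !f k j i

/-- The signs of the brackets `[i j k]` of a positive pentagon `0, …, 4` with a further point `5`,
where `b` lists the signs of the brackets `[i j 5]`. -/
def pentSign (b : ℕ → Bool) (i j k : ℕ) : Bool :=
  altSign (fun i j k => if k = 5 then b (pairIndex i j) else true) i j k

/-- The pairs `i < j` of elements of `{0, …, 5}`. -/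
def pairs6 : List (ℕ × ℕ) :=
  [(0, 1), (0, 2), (0, 3), (0, 4), (0, 5), (1, 2), (1, 3), (1, 4), (1, 5), (2, 3), (2, 4), (2, 5),
    (3, 4), (3, 5), (4, 5)]

/-- The pairs of `pairs6` that contain neither `i` nor `j`. -/
def pairsAvoiding (i j : ℕ) : List (ℕ × ℕ) :=
  pairs6.filter fun p => p.1 != i && p.1 != j && p.2 != i && p.2 != j

/-- Adjacency of `i` and `j` for the sign pattern `b`. -/
def pentAdj (b : ℕ → Bool) (i j : ℕ) : Bool :=
  (pairsAvoiding i j).all (fun p => pentSign b p.1 p.2 i == pentSign b p.1 p.2 j) ||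
    (pairsAvoiding i j).all (fun p => pentSign b p.1 p.2 i != pentSign b p.1 p.2 j)

/-- The conditions for adjacency in terms of the sign pattern `b`: two vertices of the pentagon
that are not consecutive are never adjacent. -/
def pentEdgeTable (b : ℕ → Bool) : List ((ℕ × ℕ) × Bool) :=
  [((0, 1), b 1 == b 2 && b 3 == b 4 && b 6 == b 7),
   ((1, 2), b 0 == b 1 && b 4 == b 5 && b 7 == b 8),
   ((2, 3), b 1 == b 3 && b 2 == b 4 && b 8 == b 9),
   ((3, 4), b 3 == b 6 && b 4 == b 7 && b 5 == b 8),
   ((0, 4), b 0 != b 7 && b 1 != b 8 && b 3 != b 9),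
   ((0, 5), b 2 == b 4 && b 2 == b 5 && b 2 == b 7 && b 2 == b 8 && b 2 == b 9),
   ((1, 5), b 1 == b 3 && b 1 == b 6 && b 1 != b 5 && b 1 != b 8 && b 1 != b 9),
   ((2, 5), b 0 == b 9 && b 0 != b 3 && b 0 != b 4 && b 0 != b 6 && b 0 != b 7),
   ((3, 5), b 0 == b 1 && b 0 == b 2 && b 0 != b 6 && b 0 != b 7 && b 0 != b 8),
   ((4, 5), b 0 == b 1 && b 0 == b 2 && b 0 == b 3 && b 0 == b 4 && b 0 == b 5)]

/-- The edges of the adjacency graph of the sign pattern `b`. -/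
def pentEdges (b : ℕ → Bool) : List (ℕ × ℕ) :=
  ((pentEdgeTable b).filter fun p => p.2).map fun p => p.1

theorem pentAdj_iff_mem_pentEdges (b : ℕ → Bool) (p : ℕ × ℕ) (hp : p ∈ pairs6) :
    pentAdj b p.1 p.2 = true ↔ p ∈ pentEdges b := by
  have hmem : p ∈ pentEdges b ↔ (p, true) ∈ pentEdgeTable b := by
    simp [pentEdges]
  rw [hmem]
  clear hmem
  fin_cases hp <;>
    simp [pentEdgeTable, pentAdj, pairsAvoiding, pentSign, pairs6, altSign, pairIndex]
  all_goals first
    | grind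
    | cases b 0 <;> cases b 1 <;> cases b 3 <;> simp [and_assoc]

/-- The sign patterns of the points that together with the pentagon form a hexagon. -/
def hexPatterns : List ℕ := [1023, 75, 63, 519, 801, 222, 504, 960, 948, 0]

/-- The sign patterns of the points that together with the pentagon form a configuration whose
adjacency graph has three components. -/
def triPatterns : List ℕ :=
  [3, 15, 72, 95, 192, 202, 216, 255, 456, 510, 513, 567, 768, 807, 821, 831, 928, 951, 1008, 1020]

/-- Every vertex is one of the vertices in `d` or joined to one of them by an edge in `E`. -/
def dominates (E : List (ℕ × ℕ)) (d : List ℕ) : Bool :=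
  (List.range 6).all fun i => d.any fun c => i == c || E.contains (c, i) || E.contains (i, c)

/-- What the classification of the sign patterns needs to know about the edges `E` of the pattern
with code `N`. The number of components is bounded from below by `6 - E.length` and from above by the
size of a dominating set; so there are at least four components if `E.length < 3`, exactly three if
`E.length = 3`, and at most two otherwise, with two components if `E.length = 4`. -/
def patternCheck (N : ℕ) (E : List (ℕ × ℕ)) : Bool :=
  if E.length < 3 then !triPatterns.contains N
  else if E.length = 3 then triPatterns.contains N &&
      (List.range 6).any fun i => (List.range 6).any fun j => (List.range 6).any fun k =>
        dominates E [i, j, k]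
  else !triPatterns.contains N && (E.length = 4 || hexPatterns.contains N) &&
      (List.range 6).any fun i => (List.range 6).any fun j => dominates E [i, j]

/-- This covers all 1024 patterns, including those that no point realizes. -/
theorem patternCheck_eq_true {N : ℕ} (hN : N < 1024) :
    patternCheck N (pentEdges N.testBit) = true := by
  have : (List.range 1024).all (fun N => patternCheck N (pentEdges N.testBit)) = true := by
    decide +kernel
  exact List.all_eq_true.1 this N (List.mem_range.2 hN)

/-! ### A pentagon and a further point -/

/-- All brackets `[i j k]` with `i < j < k` are positive: up to positive factors, the `u i` are the
consecutive vertices of a convex polygon in an affine chart. -/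
def Positive {n : ℕ} (u : Fin n → Fin 3 → ℝ) : Prop :=
  ∀ i j k, i < j → j < k → 0 < br (u i) (u j) (u k)

/-- `b` lists the signs of the brackets `[x i, x j, v]`. -/
def IsPattern {n : ℕ} (x : Fin n → Fin 3 → ℝ) (v : Fin 3 → ℝ) (b : ℕ → Bool) : Prop :=
  ∀ i j : Fin n, i < j → (b (pairIndex i j) = true ↔ 0 < br (x i) (x j) v)

theorem exists_isPattern {n m : ℕ} (x : Fin n → Fin 3 → ℝ) (v : Fin 3 → ℝ)
    (hm : ∀ i j : Fin n, i < j → pairIndex i j < m)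
    (hinj : ∀ i j i' j' : Fin n, i < j → i' < j' → pairIndex i j = pairIndex i' j' →
      i = i' ∧ j = j') :
    ∃ N < 2 ^ m, IsPattern x v N.testBit := by
  classical
  refine ⟨Nat.ofBits fun k : Fin m => decide (∃ i j : Fin n, i < j ∧ pairIndex i j = k ∧
    0 < br (x i) (x j) v), Nat.ofBits_lt_two_pow _, fun i j hij => ?_⟩
  rw [Nat.testBit_ofBits_lt _ _ (hm i j hij), decide_eq_true_iff]
  constructor
  · rintro ⟨i', j', h1, h2, h3⟩
    obtain ⟨rfl, rfl⟩ := hinj _ _ _ _ h1 hij h2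
    exact h3
  · exact fun h => ⟨i, j, hij, rfl, h⟩

theorem Generic.altSign_iff {n : ℕ} {w : Fin n → Fin 3 → ℝ} (hw : Generic w)
    {f : ℕ → ℕ → ℕ → Bool}
    (hf : ∀ i j k : Fin n, i < j → j < k → (f i j k = true ↔ 0 < br (w i) (w j) (w k)))
    {i j k : Fin n} (hij : i ≠ j) (hik : i ≠ k) (hjk : j ≠ k) :
    altSign f i j k = true ↔ 0 < br (w i) (w j) (w k) := by
  have hneg : ∀ {x : Bool} {a b : ℝ}, (x = true ↔ 0 < a) → a ≠ 0 → b = -a →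
      ((!x) = true ↔ 0 < b) := by
    rintro x a b h ha rfl
    rw [Bool.not_eq_true', ← Bool.not_eq_true, h, neg_pos, not_lt]
    exact ⟨fun h => lt_of_le_of_ne h ha, le_of_lt⟩
  unfold altSign
  simp only [Fin.val_fin_lt]
  split_ifs with h1 h2 h3 h4 h5
  · exact hf _ _ _ h1 h2
  · exact hneg (hf _ _ _ h3 (lt_of_le_of_ne (not_lt.1 h2) hjk.symm)) (hw _ _ _ hik hij hjk.symm)
      (br_swap₂₃ _ _ _)
  · rw [hf _ _ _ (lt_of_le_of_ne (not_lt.1 h3) hik.symm) h1, br_cycle]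
  · exact hneg (hf _ _ _ (lt_of_le_of_ne (not_lt.1 h1) hij.symm) h4) (hw _ _ _ hij.symm hjk hik)
      (br_swap₁₂ _ _ _)
  · rw [hf _ _ _ h5 (lt_of_le_of_ne (not_lt.1 h4) hik.symm), ← br_cycle]
  · exact hneg (hf _ _ _ (lt_of_le_of_ne (not_lt.1 h5) hjk.symm)
      (lt_of_le_of_ne (not_lt.1 h1) hij.symm)) (hw _ _ _ hjk.symm hik.symm hij.symm)
      (br_swap₁₃ _ _ _)

/-- The vectors of a pentagon followed by a further vector. -/
def pentCons (x : Fin 5 → Fin 3 → ℝ) (v : Fin 3 → ℝ) : Fin 6 → Fin 3 → ℝ :=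
  Fin.snoc (α := fun _ => Fin 3 → ℝ) x v

@[simp] theorem pentCons_castSucc (x : Fin 5 → Fin 3 → ℝ) (v : Fin 3 → ℝ) (i : Fin 5) :
    pentCons x v i.castSucc = x i := by simp [pentCons]

@[simp] theorem pentCons_last (x : Fin 5 → Fin 3 → ℝ) (v : Fin 3 → ℝ) :
    pentCons x v 5 = v := Fin.snoc_last (α := fun _ => Fin 3 → ℝ) v x

theorem pentSign_iff {x : Fin 5 → Fin 3 → ℝ} {v : Fin 3 → ℝ} (hx : Positive x)
    (hw : Generic (pentCons x v)) {b : ℕ → Bool} (hb : IsPattern x v b)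
    {i j k : Fin 6} (hij : i ≠ j) (hik : i ≠ k) (hjk : j ≠ k) :
    pentSign b i j k = true ↔ 0 < br (pentCons x v i) (pentCons x v j) (pentCons x v k) := by
  refine hw.altSign_iff (fun i j k h1 h2 => ?_) hij hik hjk
  obtain ⟨j, rfl⟩ := Fin.exists_castSucc_eq.2 (h2.trans_le (Fin.le_last k)).ne
  obtain ⟨i, rfl⟩ := Fin.exists_castSucc_eq.2 ((h1.trans h2).trans_le (Fin.le_last k)).ne
  induction k using Fin.lastCases with
  | last => simpa using hb i j (by simpa using h1)
  | cast k =>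
    have := hx i j k (by simpa using h1) (by simpa using h2)
    have hk : (k : ℕ) ≠ 5 := k.2.ne
    simpa [hk] using this

theorem mul_pos_iff_of_ne_zero {a b : ℝ} (ha : a ≠ 0) (hb : b ≠ 0) :
    0 < a * b ↔ (0 < a ↔ 0 < b) := by
  rcases ha.lt_or_gt with ha | ha <;> rcases hb.lt_or_gt with hb | hb
  · simp [mul_pos_of_neg_of_neg ha hb, ha.not_gt, hb.not_gt]
  · simp [(mul_neg_of_neg_of_pos ha hb).not_gt, ha.not_gt, hb]
  · simp [(mul_neg_of_pos_of_neg ha hb).not_gt, ha, hb.not_gt]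
  · simp [mul_pos ha hb, ha, hb]

theorem mem_pairs6 : ∀ r s : Fin 6, r < s → ((r : ℕ), (s : ℕ)) ∈ pairs6 := by decide

theorem exists_of_mem_pairs6 : ∀ p ∈ pairs6, ∃ r s : Fin 6, r < s ∧ p = ((r : ℕ), (s : ℕ)) := by
  decide

theorem signGraph_adj_iff {x : Fin 5 → Fin 3 → ℝ} {v : Fin 3 → ℝ} (hx : Positive x)
    (hw : Generic (pentCons x v)) {b : ℕ → Bool} (hb : IsPattern x v b) {i j : Fin 6}
    (hij : i < j) :
    (signGraph (pentCons x v)).Adj i j ↔ ((i : ℕ), (j : ℕ)) ∈ pentEdges b := by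
  rw [← pentAdj_iff_mem_pentEdges _ _ (mem_pairs6 i j hij)]
  set w := pentCons x v with hwdef
  have hprod : ∀ r s, r ≠ s → r ≠ i → r ≠ j → s ≠ i → s ≠ j →
      (0 < br (w r) (w s) (w i) * br (w r) (w s) (w j) ↔ pentSign b r s i = pentSign b r s j) := by
    intro r s hrs hri hrj hsi hsj
    rw [mul_pos_iff_of_ne_zero (hw _ _ _ hrs hri hsi) (hw _ _ _ hrs hrj hsj),
      ← pentSign_iff hx hw hb hrs hri hsi, ← pentSign_iff hx hw hb hrs hrj hsj]
    exact Bool.eq_iff_iff.symm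
  have hprod' : ∀ r s, r ≠ s → r ≠ i → r ≠ j → s ≠ i → s ≠ j →
      (br (w r) (w s) (w i) * br (w r) (w s) (w j) < 0 ↔ pentSign b r s i ≠ pentSign b r s j) := by
    intro r s hrs hri hrj hsi hsj
    rw [Ne, ← hprod r s hrs hri hrj hsi hsj, not_lt]
    exact ⟨le_of_lt, fun h => lt_of_le_of_ne h
      (mul_ne_zero (hw _ _ _ hrs hri hsi) (hw _ _ _ hrs hrj hsj))⟩
  have hmem : ∀ r s : Fin 6, r < s → r ≠ i → r ≠ j → s ≠ i → s ≠ j →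
      ((r : ℕ), (s : ℕ)) ∈ pairsAvoiding i j := by
    intro r s hrs hri hrj hsi hsj
    simp only [pairsAvoiding, List.mem_filter, mem_pairs6 r s hrs, true_and, Bool.and_eq_true,
      bne_iff_ne, ne_eq, Fin.val_inj]
    exact ⟨⟨⟨hri, hrj⟩, hsi⟩, hsj⟩
  have hmem' : ∀ p ∈ pairsAvoiding i j, ∃ r s : Fin 6, r < s ∧ r ≠ i ∧ r ≠ j ∧ s ≠ i ∧ s ≠ j ∧
      p = ((r : ℕ), (s : ℕ)) := by
    intro p hp
    obtain ⟨hp1, hp2⟩ := List.mem_filter.1 hp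
    obtain ⟨r, s, hrs, rfl⟩ := exists_of_mem_pairs6 p hp1
    simp only [Bool.and_eq_true, bne_iff_ne, ne_eq, Fin.val_inj] at hp2
    exact ⟨r, s, hrs, hp2.1.1.1, hp2.1.1.2, hp2.1.2, hp2.2, rfl⟩
  simp only [pentAdj, Bool.or_eq_true, List.all_eq_true, beq_iff_eq, bne_iff_ne]
  constructor
  · rintro ⟨-, h⟩
    refine h.imp (fun h p hp => ?_) (fun h p hp => ?_) <;>
    obtain ⟨r, s, hrs, h1, h2, h3, h4, rfl⟩ := hmem' p hp
    · exact (hprod r s hrs.ne h1 h2 h3 h4).1 (h r s hrs.ne h1 h2 h3 h4)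
    · exact (hprod' r s hrs.ne h1 h2 h3 h4).1 (h r s hrs.ne h1 h2 h3 h4)
  · intro h
    have hswap : ∀ r s, br (w r) (w s) (w i) * br (w r) (w s) (w j) =
        br (w s) (w r) (w i) * br (w s) (w r) (w j) := fun r s => by
      rw [br_swap₁₂ (w r) (w s), br_swap₁₂ (w r) (w s)]; ring
    refine ⟨hij.ne, h.imp (fun h r s hrs h1 h2 h3 h4 => ?_) (fun h r s hrs h1 h2 h3 h4 => ?_)⟩ <;>
    rcases hrs.lt_or_gt with hlt | hlt
    · exact (hprod r s hrs h1 h2 h3 h4).2 (h _ (hmem r s hlt h1 h2 h3 h4))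
    · rw [hswap]
      exact (hprod s r hrs.symm h3 h4 h1 h2).2 (h _ (hmem s r hlt h3 h4 h1 h2))
    · exact (hprod' r s hrs h1 h2 h3 h4).2 (h _ (hmem r s hlt h1 h2 h3 h4))
    · rw [hswap]
      exact (hprod' s r hrs.symm h3 h4 h1 h2).2 (h _ (hmem s r hlt h3 h4 h1 h2))

section

variable {x : Fin 5 → Fin 3 → ℝ} {v : Fin 3 → ℝ} {b : ℕ → Bool}

theorem six_le_card_add_length (hx : Positive x) (hw : Generic (pentCons x v))
    (hb : IsPattern x v b) :
    6 ≤ Nat.card (signGraph (pentCons x v)).ConnectedComponent + (pentEdges b).length := by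
  have := (signGraph (pentCons x v)).card_le_card_connectedComponent_add
    ((pentEdges b).map fun p => (Fin.ofNat 6 p.1, Fin.ofNat 6 p.2)) (fun i j h => by
      have hcast : ∀ i j : Fin 6, ((i : ℕ), (j : ℕ)) ∈ pentEdges b → (i, j) ∈
          (pentEdges b).map fun p => (Fin.ofNat 6 p.1, Fin.ofNat 6 p.2) := fun i j h =>
        List.mem_map.2 ⟨_, h, by simp⟩
      rcases h.ne.lt_or_gt with hlt | hlt
      · exact Or.inl (hcast i j ((signGraph_adj_iff hx hw hb hlt).1 h))
      · exact Or.inr (hcast j i ((signGraph_adj_iff hx hw hb hlt).1 h.symm)))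
  simpa using this

theorem card_le_of_dominates (hx : Positive x) (hw : Generic (pentCons x v))
    (hb : IsPattern x v b) {d : List ℕ} (hd : ∀ c ∈ d, c < 6)
    (hdom : dominates (pentEdges b) d = true) :
    Nat.card (signGraph (pentCons x v)).ConnectedComponent ≤ d.length := by
  have hsub : ∀ p ∈ pentEdges b, p.1 < p.2 := by
    intro p hp
    obtain ⟨q, hq, rfl⟩ := List.mem_map.1 hp
    have h1 : ∀ q ∈ pentEdgeTable b, q.1.1 < q.1.2 := by simp [pentEdgeTable]
    exact h1 q (List.mem_of_mem_filter hq)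
  refine SimpleGraph.card_connectedComponent_le _
    (fun k : Fin d.length => (⟨d[k], hd _ (List.getElem_mem _)⟩ : Fin 6)) (fun i => ?_)
  have h2 := List.all_eq_true.1 hdom i (List.mem_range.2 i.2)
  obtain ⟨c, hc, h3⟩ := List.any_eq_true.1 h2
  obtain ⟨k, hk, rfl⟩ := List.getElem_of_mem hc
  refine ⟨⟨k, hk⟩, ?_⟩
  simp only [Bool.or_eq_true, beq_iff_eq, List.contains_iff_mem] at h3
  rcases h3 with (h3 | h3) | h3
  · have : i = ⟨d[k], hd _ (List.getElem_mem _)⟩ := Fin.ext h3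
    rw [this]
    exact SimpleGraph.Reachable.refl _
  · exact ((signGraph_adj_iff hx hw hb (i := ⟨d[k], hd _ (List.getElem_mem _)⟩) (j := i)
      (hsub _ h3)).2 h3).reachable
  · exact ((signGraph_adj_iff hx hw hb (j := ⟨d[k], hd _ (List.getElem_mem _)⟩) (i := i)
      (hsub _ h3)).2 h3).symm.reachable

variable {N : ℕ}

theorem mem_hexPatterns_of_card_eq_one (hx : Positive x) (hw : Generic (pentCons x v))
    (hN : N < 1024) (hb : IsPattern x v N.testBit)
    (h : Nat.card (signGraph (pentCons x v)).ConnectedComponent = 1) : N ∈ hexPatterns := by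
  have h1 := six_le_card_add_length hx hw hb
  have h2 := patternCheck_eq_true hN
  have h3 : ¬ (pentEdges N.testBit).length < 3 := by omega
  have h4 : (pentEdges N.testBit).length ≠ 3 := by omega
  have h5 : (pentEdges N.testBit).length ≠ 4 := by omega
  simp only [patternCheck, h3, h4, h5, if_false, Bool.and_eq_true, Bool.or_eq_true,
    decide_eq_true_eq, false_or, List.contains_iff_mem] at h2
  exact h2.1.2

theorem card_eq_three_iff (hx : Positive x) (hw : Generic (pentCons x v))
    (hN : N < 1024) (hb : IsPattern x v N.testBit) :
    Nat.card (signGraph (pentCons x v)).ConnectedComponent = 3 ↔ N ∈ triPatterns := by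
  have h1 := six_le_card_add_length hx hw hb
  have h2 := patternCheck_eq_true hN
  have h6 : ∀ {i}, i ∈ List.range 6 → i < 6 := List.mem_range.1
  unfold patternCheck at h2
  split_ifs at h2 with h3 h4
  · rw [Bool.not_eq_true', ← Bool.not_eq_true, List.contains_iff_mem] at h2
    exact iff_of_false (by omega) h2
  · simp only [Bool.and_eq_true, List.any_eq_true, List.contains_iff_mem] at h2
    obtain ⟨h2, i, hi, j, hj, k, hk, hd⟩ := h2
    have h5 := card_le_of_dominates hx hw hb (by simp [h6 hi, h6 hj, h6 hk]) hd
    refine iff_of_true ?_ h2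
    simp only [List.length_cons, List.length_nil] at h5
    omega
  · simp only [Bool.and_eq_true, List.any_eq_true] at h2
    obtain ⟨⟨h2, -⟩, i, hi, j, hj, hd⟩ := h2
    rw [Bool.not_eq_true', ← Bool.not_eq_true, List.contains_iff_mem] at h2
    have h5 := card_le_of_dominates hx hw hb (by simp [h6 hi, h6 hj]) hd
    refine iff_of_false ?_ h2
    simp only [List.length_cons, List.length_nil] at h5
    omega

end

/-! ### Convex position of five points -/

/-- The position of the triple `i < j < k` in the list `012, 013, 023, 123, 014, …`. -/
def tripleIndex (i j k : ℕ) : ℕ := k * (k - 1) * (k - 2) / 6 + j * (j - 1) / 2 + i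

/-- The signs of the brackets of five vectors, where the bits of `N` are the signs of the brackets
`[i j k]` with `i < j < k`. -/
def quintSign (N i j k : ℕ) : Bool := altSign (fun i j k => N.testBit (tripleIndex i j k)) i j k

/-- The signs in the three-term Grassmann–Plücker relations do not contradict each other. -/
def quintFeasible (N : ℕ) : Bool :=
  [(0, 1, 2, 3, 4), (1, 0, 2, 3, 4), (2, 0, 1, 3, 4), (3, 0, 1, 2, 4), (4, 0, 1, 2, 3)].all
    fun (a, b, c, d, e) =>
      !((quintSign N a b c == quintSign N a d e) == (quintSign N a b e == quintSign N a c d) &&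
        (quintSign N a b c == quintSign N a d e) != (quintSign N a b d == quintSign N a c e))

/-- The cyclic orders of five elements, up to reversal. -/
def cyclicOrders : List (List ℕ) :=
  [[0, 1, 2, 3, 4], [0, 1, 2, 4, 3], [0, 1, 3, 2, 4], [0, 1, 3, 4, 2], [0, 1, 4, 2, 3],
    [0, 1, 4, 3, 2], [0, 2, 1, 3, 4], [0, 2, 1, 4, 3], [0, 2, 3, 1, 4], [0, 2, 4, 1, 3],
    [0, 3, 1, 2, 4], [0, 3, 2, 1, 4]]

/-- The sign of the bracket of three vectors after renumbering them by `o`. -/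
def orderSign (N : ℕ) (o : List ℕ) (i j k : ℕ) : Bool :=
  quintSign N (o.getD i 0) (o.getD j 0) (o.getD k 0)

/-- The signs, `true` standing for `1` and `==` for the product, by which the vectors have to be
multiplied so that the brackets `012`, `013`, `023`, `123`, `014` become positive. -/
def orderFlip (N : ℕ) (o : List ℕ) (i : ℕ) : Bool :=
  let a := orderSign N o 0 1 2
  let b := orderSign N o 0 1 3
  let c := orderSign N o 0 2 3
  let d := orderSign N o 1 2 3
  match i with
  | 0 => (a == b) == c
  | 1 => (a == b) == d
  | 2 => (a == c) == d
  | 3 => (b == c) == d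
  | _ => (c == d) == orderSign N o 0 1 4

/-- The triples `i < j < k` of elements of `{0, …, 4}`. -/
def triples5 : List (ℕ × ℕ × ℕ) :=
  [(0, 1, 2), (0, 1, 3), (0, 2, 3), (1, 2, 3), (0, 1, 4), (0, 2, 4), (1, 2, 4), (0, 3, 4),
    (1, 3, 4), (2, 3, 4)]

/-- If the signs of the brackets of five vectors respect the Grassmann–Plücker relations and the first
five of them are positive (`N % 32 = 31`), then there are a cyclic order and signs of the vectors for
which all brackets become positive. -/
theorem exists_cyclicOrder {N : ℕ} (hN : N < 1024) (h31 : N % 32 = 31)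
    (h : quintFeasible N = true) :
    ∃ o ∈ cyclicOrders, ∀ t ∈ triples5,
      ((orderFlip N o t.1 == orderFlip N o t.2.1) == orderFlip N o t.2.2) =
        orderSign N o t.1 t.2.1 t.2.2 := by
  have key : (List.range 32).all (fun m => !quintFeasible (31 + 32 * m) ||
      cyclicOrders.any fun o => triples5.all fun t =>
        ((orderFlip (31 + 32 * m) o t.1 == orderFlip (31 + 32 * m) o t.2.1) ==
          orderFlip (31 + 32 * m) o t.2.2) == orderSign (31 + 32 * m) o t.1 t.2.1 t.2.2) = true := by
    decide +kernel
  have := List.all_eq_true.1 key (N / 32) (List.mem_range.2 (by omega))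
  rw [show 31 + 32 * (N / 32) = N by omega] at this
  simpa [h] using this

/-- The real number `1` or `-1` that a truth value stands for. -/
noncomputable def boolSign (e : Bool) : ℝ := if e then 1 else -1

theorem boolSign_ne_zero (e : Bool) : boolSign e ≠ 0 := by cases e <;> simp [boolSign]

theorem boolSign_mul (e f : Bool) : boolSign e * boolSign f = boolSign (e == f) := by
  cases e <;> cases f <;> simp [boolSign]

theorem boolSign_mul_pos {e : Bool} {x : ℝ} (hx : x ≠ 0) (h : e = true ↔ 0 < x) :
    0 < boolSign e * x := by
  cases e
  · have : ¬ 0 < x := fun hx => by simpa using h.2 hx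
    simpa [boolSign] using lt_of_le_of_ne (not_lt.1 this) hx
  · simpa [boolSign] using h

/-- If the outer terms of a relation `a b - c d + e f = 0` have the same sign, then the middle
product has it, too. -/
theorem plucker_signs {a b c d e f : ℝ} (h : a * b - c * d + e * f = 0) {p q r s t w : Bool}
    (ha : a ≠ 0) (hb : b ≠ 0) (hc : c ≠ 0) (hd : d ≠ 0) (he : e ≠ 0) (hf : f ≠ 0)
    (hp : p = true ↔ 0 < a) (hq : q = true ↔ 0 < b) (hr : r = true ↔ 0 < c)
    (hs : s = true ↔ 0 < d) (ht : t = true ↔ 0 < e) (hw : w = true ↔ 0 < f) :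
    (!((p == q) == (t == w) && (p == q) != (r == s))) = true := by
  have h1 : (p == q) = true ↔ 0 < a * b := by
    rw [mul_pos_iff_of_ne_zero ha hb, ← hp, ← hq, beq_iff_eq, Bool.eq_iff_iff]
  have h2 : (r == s) = true ↔ 0 < c * d := by
    rw [mul_pos_iff_of_ne_zero hc hd, ← hr, ← hs, beq_iff_eq, Bool.eq_iff_iff]
  have h3 : (t == w) = true ↔ 0 < e * f := by
    rw [mul_pos_iff_of_ne_zero he hf, ← ht, ← hw, beq_iff_eq, Bool.eq_iff_iff]
  have aux : ∀ {X : ℝ} {x : Bool}, (x = true ↔ 0 < X) → (x = true → 0 < X) ∧ (x = false → X ≤ 0) :=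
    fun h => ⟨h.1, fun hx => not_lt.1 fun hX => by simp [h.2 hX] at hx⟩
  have hab := aux h1
  have hcd := aux h2
  have hef := aux h3
  have hab0 := mul_ne_zero ha hb
  have hcd0 := mul_ne_zero hc hd
  generalize (p == q) = x at hab ⊢
  generalize (r == s) = y at hcd ⊢
  generalize (t == w) = z at hef ⊢
  cases x <;> cases y <;> cases z <;> try rfl
  · linarith [hab.2 rfl, hcd.1 rfl, hef.2 rfl]
  · linarith [hab.1 rfl, hcd.2 rfl, hef.1 rfl]

theorem mem_triples5 : ∀ i j k : Fin 5, i < j → j < k → ((i : ℕ), (j : ℕ), (k : ℕ)) ∈ triples5 := by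
  decide

theorem cyclicOrders_injective : ∀ o ∈ cyclicOrders,
    Function.Injective fun i : Fin 5 => Fin.ofNat 5 (o.getD i 0) := by decide

theorem cyclicOrders_lt : ∀ o ∈ cyclicOrders, ∀ i : Fin 5, o.getD i 0 < 5 := by decide

theorem exists_tripleCode (x : Fin 5 → Fin 3 → ℝ) : ∃ N < 1024, ∀ i j k : Fin 5, i < j → j < k →
    (N.testBit (tripleIndex i j k) = true ↔ 0 < br (x i) (x j) (x k)) := by
  classical
  have hlt : ∀ i j k : Fin 5, i < j → j < k → tripleIndex i j k < 10 := by decide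
  have hinj : ∀ i j k : Fin 5, i < j → j < k → ∀ i' j' k' : Fin 5, i' < j' → j' < k' →
      tripleIndex i j k = tripleIndex i' j' k' → i = i' ∧ j = j' ∧ k = k' := by decide
  refine ⟨Nat.ofBits fun m : Fin 10 => decide (∃ i j k : Fin 5, i < j ∧ j < k ∧
    tripleIndex i j k = m ∧ 0 < br (x i) (x j) (x k)), Nat.ofBits_lt_two_pow _,
    fun i j k hij hjk => ?_⟩
  rw [Nat.testBit_ofBits_lt _ _ (hlt i j k hij hjk), decide_eq_true_iff]
  constructor
  · rintro ⟨i', j', k', h1, h2, h3, h4⟩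
    obtain ⟨rfl, rfl, rfl⟩ := hinj _ _ _ hij hjk _ _ _ h1 h2 h3.symm
    exact h4
  · exact fun h => ⟨i, j, k, hij, hjk, rfl, h⟩

/-- Five vectors can be rescaled so that the brackets `012`, `013`, `023`, `123`, `014`, which are
those of `tripleIndex` less than `5`, are positive. -/
theorem Generic.exists_rescale {x : Fin 5 → Fin 3 → ℝ} (hx : Generic x) :
    ∃ c : Fin 5 → ℝ, (∀ i, c i ≠ 0) ∧ ∀ i j k : Fin 5, i < j → j < k → tripleIndex i j k < 5 →
      0 < br (c i • x i) (c j • x j) (c k • x k) := by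
  have h012 := hx 0 1 2 (by decide) (by decide) (by decide)
  have h013 := hx 0 1 3 (by decide) (by decide) (by decide)
  have h023 := hx 0 2 3 (by decide) (by decide) (by decide)
  have h123 := hx 1 2 3 (by decide) (by decide) (by decide)
  have h014 := hx 0 1 4 (by decide) (by decide) (by decide)
  generalize ha : br (x 0) (x 1) (x 2) = a at h012
  generalize hb : br (x 0) (x 1) (x 3) = b at h013
  generalize hc : br (x 0) (x 2) (x 3) = c at h023
  generalize hd : br (x 1) (x 2) (x 3) = d at h123
  generalize hf : br (x 0) (x 1) (x 4) = f at h014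
  refine ⟨![a * b * c, a * b * d, a * c * d, b * c * d, c * d * f], ?_, ?_⟩
  · intro i
    fin_cases i <;> simp [h012, h013, h023, h123, h014]
  · have hlist : ∀ i j k : Fin 5, i < j → j < k → tripleIndex i j k < 5 →
        (i = 0 ∧ j = 1 ∧ k = 2) ∨ (i = 0 ∧ j = 1 ∧ k = 3) ∨ (i = 0 ∧ j = 2 ∧ k = 3) ∨
          (i = 1 ∧ j = 2 ∧ k = 3) ∨ (i = 0 ∧ j = 1 ∧ k = 4) := by decide
    intro i j k hij hjk hlt
    rcases hlist i j k hij hjk hlt with ⟨rfl, rfl, rfl⟩ | ⟨rfl, rfl, rfl⟩ | ⟨rfl, rfl, rfl⟩ |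
      ⟨rfl, rfl, rfl⟩ | ⟨rfl, rfl, rfl⟩ <;> rw [br_smul]
    · have : 0 < (a * a * b * c * d) ^ 2 := by positivity
      exact this.trans_eq (by rw [ha]; simp; ring)
    · have : 0 < (a * b * b * c * d) ^ 2 := by positivity
      exact this.trans_eq (by rw [hb]; simp; ring)
    · have : 0 < (a * b * c * c * d) ^ 2 := by positivity
      exact this.trans_eq (by rw [hc]; simp; ring)
    · have : 0 < (a * b * c * d * d) ^ 2 := by positivity
      exact this.trans_eq (by rw [hd]; simp; ring)
    · have : 0 < (a * b * c * d * f) ^ 2 := by positivity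
      exact this.trans_eq (by rw [hf]; simp; ring)

/-- Five points of the projective plane, no three of them collinear, are the consecutive vertices
of a convex pentagon in some affine chart. -/
theorem Generic.exists_positive {y : Fin 5 → Fin 3 → ℝ} (hy : Generic y) :
    ∃ (σ : Fin 5 → Fin 5) (c : Fin 5 → ℝ), Function.Injective σ ∧ (∀ i, c i ≠ 0) ∧
      Positive fun i => c i • y (σ i) := by
  obtain ⟨r, hr, hrpos⟩ := hy.exists_rescale
  set x : Fin 5 → Fin 3 → ℝ := fun i => r i • y i with hxdef
  have hx : Generic x := hy.reindex Function.injective_id hr fun _ => rfl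
  obtain ⟨N, hN, hbits⟩ := exists_tripleCode x
  have h31 : N % 32 = 31 := by
    have h0 := (hbits 0 1 2 (by decide) (by decide)).2 (hrpos _ _ _ (by decide) (by decide) (by decide))
    have h1 := (hbits 0 1 3 (by decide) (by decide)).2 (hrpos _ _ _ (by decide) (by decide) (by decide))
    have h2 := (hbits 0 2 3 (by decide) (by decide)).2 (hrpos _ _ _ (by decide) (by decide) (by decide))
    have h3 := (hbits 1 2 3 (by decide) (by decide)).2 (hrpos _ _ _ (by decide) (by decide) (by decide))
    have h4 := (hbits 0 1 4 (by decide) (by decide)).2 (hrpos _ _ _ (by decide) (by decide) (by decide))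
    simp only [tripleIndex, Nat.testBit_eq_decide_div_mod_eq, decide_eq_true_eq] at h0 h1 h2 h3 h4
    norm_num at h0 h1 h2 h3 h4
    omega
  have hs : ∀ i j k : Fin 5, i ≠ j → i ≠ k → j ≠ k →
      (quintSign N i j k = true ↔ 0 < br (x i) (x j) (x k)) :=
    fun i j k h1 h2 h3 => hx.altSign_iff hbits h1 h2 h3
  have hpl : ∀ a b c d e : Fin 5, a ≠ b → a ≠ c → a ≠ d → a ≠ e → b ≠ c → b ≠ d → b ≠ e → c ≠ d →
      c ≠ e → d ≠ e →
      (!((quintSign N a b c == quintSign N a d e) == (quintSign N a b e == quintSign N a c d) &&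
        (quintSign N a b c == quintSign N a d e) != (quintSign N a b d == quintSign N a c e))) =
          true := by
    intro a b c d e hab hac had hae hbc hbd hbe hcd hce hde
    exact plucker_signs (br_plucker (x a) (x b) (x c) (x d) (x e)) (hx _ _ _ hab hac hbc)
      (hx _ _ _ had hae hde) (hx _ _ _ hab had hbd) (hx _ _ _ hac hae hce) (hx _ _ _ hab hae hbe)
      (hx _ _ _ hac had hcd) (hs _ _ _ hab hac hbc)
      (hs _ _ _ had hae hde) (hs _ _ _ hab had hbd) (hs _ _ _ hac hae hce) (hs _ _ _ hab hae hbe)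
      (hs _ _ _ hac had hcd)
  have hfeas : quintFeasible N = true := by
    have h0 := hpl 0 1 2 3 4
    have h1 := hpl 1 0 2 3 4
    have h2 := hpl 2 0 1 3 4
    have h3 := hpl 3 0 1 2 4
    have h4 := hpl 4 0 1 2 3
    rw [quintFeasible, List.all_eq_true]
    intro p hp
    simp only [List.mem_cons, List.not_mem_nil, or_false] at hp
    rcases hp with rfl | rfl | rfl | rfl | rfl
    · exact h0 (by decide) (by decide) (by decide) (by decide) (by decide) (by decide) (by decide)
        (by decide) (by decide) (by decide)
    · exact h1 (by decide) (by decide) (by decide) (by decide) (by decide) (by decide) (by decide)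
        (by decide) (by decide) (by decide)
    · exact h2 (by decide) (by decide) (by decide) (by decide) (by decide) (by decide) (by decide)
        (by decide) (by decide) (by decide)
    · exact h3 (by decide) (by decide) (by decide) (by decide) (by decide) (by decide) (by decide)
        (by decide) (by decide) (by decide)
    · exact h4 (by decide) (by decide) (by decide) (by decide) (by decide) (by decide) (by decide)
        (by decide) (by decide) (by decide)
  obtain ⟨o, ho, hsign⟩ := exists_cyclicOrder hN h31 hfeas
  have hinj := cyclicOrders_injective o ho
  refine ⟨_, fun i => boolSign (orderFlip N o i) * r (Fin.ofNat 5 (o.getD i 0)), hinj,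
    fun i => mul_ne_zero (boolSign_ne_zero _) (hr _), ?_⟩
  simp only [mul_smul]
  intro i j k hij hjk
  rw [br_smul, boolSign_mul, boolSign_mul, hsign _ (mem_triples5 i j k hij hjk)]
  have hval : ∀ i : Fin 5, o.getD i 0 = (Fin.ofNat 5 (o.getD i 0) : Fin 5) := fun i =>
    (Nat.mod_eq_of_lt (cyclicOrders_lt o ho i)).symm
  refine boolSign_mul_pos (hx _ _ _ (hinj.ne hij.ne) (hinj.ne (hij.trans hjk).ne)
    (hinj.ne hjk.ne)) ?_
  have := hs _ _ _ (hinj.ne hij.ne) (hinj.ne (hij.trans hjk).ne) (hinj.ne hjk.ne)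
  rwa [← hval i, ← hval j, ← hval k] at this

/-! ### Positive polygons -/

theorem Positive.generic {n : ℕ} {u : Fin n → Fin 3 → ℝ} (h : Positive u) : Generic u := by
  intro i j k hij hik hjk
  rcases hij.lt_or_gt with h1 | h1 <;> rcases hik.lt_or_gt with h2 | h2 <;>
    rcases hjk.lt_or_gt with h3 | h3
  · exact (h _ _ _ h1 h3).ne'
  · rw [br_swap₂₃, neg_ne_zero]; exact (h _ _ _ h2 h3).ne'
  · exact absurd (h1.trans h3) h2.not_gt
  · rw [br_cycle, br_cycle]; exact (h _ _ _ h2 h1).ne'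
  · rw [br_swap₁₂, neg_ne_zero]; exact (h _ _ _ h1 h2).ne'
  · exact absurd (h3.trans h1) h2.not_gt
  · rw [br_cycle]; exact (h _ _ _ h3 h2).ne'
  · rw [br_swap₁₃, neg_ne_zero]; exact (h _ _ _ h3 h1).ne'

theorem Positive.rotate {n : ℕ} {u : Fin (n + 1) → Fin 3 → ℝ} (h : Positive u) :
    Positive fun i => u (i + 1) := by
  intro i j k hij hjk
  have hval : ∀ {i : Fin (n + 1)}, i < Fin.last n → (i + 1).val = i.val + 1 := fun {i} hi =>
    Fin.val_add_one_of_lt hi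
  have hj := hjk.trans_le (Fin.le_last k)
  have hi := hij.trans hj
  have h1 : i + 1 < j + 1 := by rw [Fin.lt_def, hval hi, hval hj]; simpa using hij
  rcases (Fin.le_last k).lt_or_eq with hk | rfl
  · exact h _ _ _ h1 (by rw [Fin.lt_def, hval hj, hval hk]; simpa using hjk)
  · dsimp only
    rw [Fin.last_add_one, ← br_cycle]
    exact h _ _ _ (by rw [Fin.lt_def, hval hi]; simp) h1

theorem Positive.add {n : ℕ} {u : Fin (n + 1) → Fin 3 → ℝ} (h : Positive u) (k : Fin (n + 1)) :
    Positive fun i => u (i + k) := by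
  induction k using Fin.induction with
  | zero => simpa using h
  | succ k ih =>
    have := ih.rotate
    have hk : ∀ i : Fin (n + 1), i + 1 + k.castSucc = i + k.succ := fun i => by
      rw [add_assoc, add_comm 1, Fin.coeSucc_eq_succ]
    simpa only [hk] using this

theorem positive_pentCons_iff {x : Fin 5 → Fin 3 → ℝ} {v : Fin 3 → ℝ} :
    Positive (pentCons x v) ↔ Positive x ∧ ∀ i j, i < j → 0 < br (x i) (x j) v := by
  constructor
  · refine fun h => ⟨fun i j k hij hjk => ?_, fun i j hij => ?_⟩
    · simpa using h i.castSucc j.castSucc k.castSucc (by simpa using hij) (by simpa using hjk)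
    · simpa using h i.castSucc j.castSucc (Fin.last 5) (by simpa using hij) (Fin.castSucc_lt_last j)
  · rintro ⟨hx, hv⟩ i j k h1 h2
    obtain ⟨j, rfl⟩ := Fin.exists_castSucc_eq.2 (h2.trans_le (Fin.le_last k)).ne
    obtain ⟨i, rfl⟩ := Fin.exists_castSucc_eq.2 ((h1.trans h2).trans_le (Fin.le_last k)).ne
    induction k using Fin.lastCases with
    | last => simpa using hv i j (by simpa using h1)
    | cast k => simpa using hx i j k (by simpa using h1) (by simpa using h2)

/-- The sign of the bracket `[i j v]` for arbitrary `i ≠ j`, where `b` lists those for `i < j`. -/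
def altBit (b : ℕ → Bool) (i j : ℕ) : Bool :=
  if i < j then b (pairIndex i j) else !b (pairIndex j i)

theorem altBit_iff {n : ℕ} {x : Fin n → Fin 3 → ℝ} {v : Fin 3 → ℝ} {b : ℕ → Bool}
    (hb : IsPattern x v b) {i j : Fin n} (hij : i ≠ j) (h : br (x i) (x j) v ≠ 0) :
    altBit b i j = true ↔ 0 < br (x i) (x j) v := by
  unfold altBit
  rcases hij.lt_or_gt with hlt | hlt
  · rw [if_pos (by simpa using hlt)]
    exact hb i j hlt
  · rw [if_neg (by simpa using hlt.le), Bool.not_eq_true', ← Bool.not_eq_true, hb j i hlt, not_lt,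
      br_swap₁₂, neg_nonpos]
    exact ⟨fun h' => lt_of_le_of_ne h' h.symm, le_of_lt⟩

/-- The point `v` (up to its sign) lies beyond one of the sides of the pentagon, and after a rotation
of the pentagon it comes last in the order of the vertices of the hexagon. -/
theorem hexPatterns_rotation : ∀ N ∈ hexPatterns, ∃ (k : Fin 5) (e : Bool), ∀ i j : Fin 5, i < j →
    altBit N.testBit (i + k : Fin 5) (j + k : Fin 5) = e := by
  decide +kernel

theorem Represents.pentCons_reindex {w : Fin 6 → Fin 3 → ℝ} {s : Finset RP2} (h : Represents w s)
    {x : Fin 5 → Fin 3 → ℝ} {v : Fin 3 → ℝ} {σ : Fin 5 → Fin 5} (hσ : Function.Injective σ)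
    {c : Fin 5 → ℝ} (hc : ∀ i, c i ≠ 0) {d : ℝ} (hd : d ≠ 0)
    (hx : ∀ i, x i = c i • w (σ i).castSucc) (hv : v = d • w 5) :
    Represents (pentCons x v) s := by
  refine h.reindex (σ := Fin.lastCases (Fin.last 5) fun i => (σ i).castSucc)
    (c := Fin.lastCases d c) ?_ ?_ ?_
  · intro i
    induction i using Fin.lastCases with
    | last => exact ⟨Fin.last 5, Fin.lastCases_last⟩
    | cast i =>
      obtain ⟨j, rfl⟩ := (Finite.injective_iff_surjective.1 hσ) i
      exact ⟨j.castSucc, Fin.lastCases_castSucc _⟩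
  · intro i
    induction i using Fin.lastCases with
    | last => rwa [Fin.lastCases_last]
    | cast i => rw [Fin.lastCases_castSucc]; exact hc i
  · intro i
    induction i using Fin.lastCases with
    | last => rw [Fin.lastCases_last, Fin.lastCases_last]; exact (pentCons_last x v).trans hv
    | cast i => rw [Fin.lastCases_castSucc, Fin.lastCases_castSucc, pentCons_castSucc, hx]

/-- A simple `6`-configuration with connected adjacency graph is a convex hexagon. -/
theorem exists_positive_of_mem_LC6_one {P : Configuration 6} (hP : P ∈ Configuration.LC6 1) :
    ∃ u : Fin 6 → Fin 3 → ℝ, Represents u P.points ∧ Positive u := by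
  obtain ⟨u, hu⟩ := P.exists_represents
  have hgen := ((hu.mem_LC6_iff 1).1 hP).1
  obtain ⟨σ, c, hσ, hc, hpos⟩ := Generic.exists_positive
    (hgen.reindex (u' := fun i : Fin 5 => u i.castSucc) (Fin.castSucc_injective 5)
      (c := fun _ => 1) (fun _ => one_ne_zero) (by simp))
  set x : Fin 5 → Fin 3 → ℝ := fun i => c i • u (σ i).castSucc with hx
  have hw : Represents (pentCons x (u 5)) P.points :=
    hu.pentCons_reindex hσ hc one_ne_zero (fun _ => rfl) (one_smul _ _).symm
  obtain ⟨hwgen, hcard⟩ := (hw.mem_LC6_iff 1).1 hP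
  obtain ⟨N, hN, hb⟩ := exists_isPattern (m := 10) x (u 5) (by decide) (by decide)
  obtain ⟨k, e, he⟩ := hexPatterns_rotation N
    (mem_hexPatterns_of_card_eq_one hpos hwgen hN hb hcard)
  refine ⟨pentCons (fun i => x (i + k)) (boolSign e • u 5), ?_, ?_⟩
  · exact hw.pentCons_reindex (σ := fun i => i + k) (add_left_injective k) (c := fun _ => 1)
      (fun _ => one_ne_zero) (boolSign_ne_zero e) (fun i => by simp) (by simp)
  · refine positive_pentCons_iff.2 ⟨hpos.add k, fun i j hij => ?_⟩
    have hne : i + k ≠ j + k := fun h => hij.ne (add_right_cancel h)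
    have h0 : br (x (i + k)) (x (j + k)) (u 5) ≠ 0 := by
      simpa using hwgen (i + k).castSucc (j + k).castSucc (Fin.last 5) (by simpa using hne)
        (Fin.castSucc_lt_last _).ne (Fin.castSucc_lt_last _).ne
    rw [br_smul₃]
    refine boolSign_mul_pos h0 ?_
    rw [← he i j hij]
    exact altBit_iff hb hne h0

/-! ### The central triangle in terms of brackets -/

/-- A quantity that vanishes iff the principal diagonals of the positive hexagon `u` are
concurrent. -/
def concurrency (u : Fin 6 → Fin 3 → ℝ) : ℝ :=
  br (u 0) (u 3) (u 4) * br (u 1) (u 2) (u 5) - br (u 0) (u 1) (u 3) * br (u 2) (u 4) (u 5)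

/-- A quantity that vanishes iff the six points `u i`, no three of them collinear, lie on a conic. -/
def conicity (u : Fin 6 → Fin 3 → ℝ) : ℝ :=
  br (u 0) (u 1) (u 2) * br (u 2) (u 3) (u 4) * br (u 4) (u 5) (u 0) * br (u 1) (u 3) (u 5) -
    br (u 1) (u 2) (u 3) * br (u 3) (u 4) (u 5) * br (u 5) (u 0) (u 1) * br (u 0) (u 2) (u 4)

/-- The intersection point of the diagonals `03` and `14`. -/
def crossing₀₁ (u : Fin 6 → Fin 3 → ℝ) : Fin 3 → ℝ :=
  br (u 0) (u 3) (u 4) • u 1 + br (u 0) (u 1) (u 3) • u 4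

/-- The intersection point of the diagonals `14` and `25`. -/
def crossing₁₂ (u : Fin 6 → Fin 3 → ℝ) : Fin 3 → ℝ :=
  br (u 1) (u 4) (u 5) • u 2 + br (u 1) (u 2) (u 4) • u 5

/-- The intersection point of the diagonals `25` and `03`. -/
def crossing₂₀ (u : Fin 6 → Fin 3 → ℝ) : Fin 3 → ℝ :=
  br (u 2) (u 3) (u 5) • u 0 + br (u 0) (u 2) (u 5) • u 3

/-- Every vector as a combination of the intersection points of the principal diagonals. -/
theorem concurrency_smul (u : Fin 6 → Fin 3 → ℝ) (v : Fin 3 → ℝ) :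
    concurrency u • v = br (u 0) (u 3) v • crossing₁₂ u - br (u 1) (u 4) v • crossing₂₀ u +
      br (u 2) (u 5) v • crossing₀₁ u := by
  ext i
  fin_cases i <;>
  · simp only [concurrency, crossing₀₁, crossing₁₂, crossing₂₀, br_eq, Pi.add_apply, Pi.sub_apply,
      Pi.smul_apply, smul_eq_mul, Fin.zero_eta, Fin.mk_one, Fin.reduceFinMk]
    ring

/-- The point `v` lies in the central triangle of the positive hexagon `u`: the signs of the three
principal diagonals at `v` are `+ - +` or `- + -`, according to the sign of `concurrency u`. -/
def Central (u : Fin 6 → Fin 3 → ℝ) (v : Fin 3 → ℝ) : Prop :=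
  (0 < concurrency u ∧ 0 < br (u 0) (u 3) v ∧ br (u 1) (u 4) v < 0 ∧ 0 < br (u 2) (u 5) v) ∨
    (concurrency u < 0 ∧ br (u 0) (u 3) v < 0 ∧ 0 < br (u 1) (u 4) v ∧ br (u 2) (u 5) v < 0)

theorem concurrency_rotate (u : Fin 6 → Fin 3 → ℝ) :
    concurrency (fun i => u (i + 1)) = -concurrency u := by
  simp only [concurrency, Fin.isValue, Fin.reduceAdd, zero_add]
  simp only [br_eq]
  ring

theorem conicity_rotate (u : Fin 6 → Fin 3 → ℝ) :
    conicity (fun i => u (i + 1)) = -conicity u := by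
  simp only [conicity, Fin.isValue, Fin.reduceAdd, zero_add]
  rw [← br_cycle (u 0) (u 2) (u 4)]
  ring

theorem Central.rotate {u : Fin 6 → Fin 3 → ℝ} {v : Fin 3 → ℝ} (h : Central u v) :
    Central (fun i => u (i + 1)) v := by
  unfold Central
  rw [concurrency_rotate]
  simp only [Fin.isValue, Fin.reduceAdd, zero_add]
  rw [br_swap₁₂ (u 0) (u 3)]
  rcases h with ⟨h0, h1, h2, h3⟩ | ⟨h0, h1, h2, h3⟩
  · exact Or.inr ⟨by linarith, h2, h3, by linarith⟩
  · exact Or.inl ⟨by linarith, h2, h3, by linarith⟩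

theorem Central.add {u : Fin 6 → Fin 3 → ℝ} {v : Fin 3 → ℝ} (h : Central u v) (k : Fin 6) :
    Central (fun i => u (i + k)) v := by
  induction k using Fin.induction with
  | zero => simpa using h
  | succ k ih =>
    have := ih.rotate
    have hk : ∀ i : Fin 6, i + 1 + k.castSucc = i + k.succ := fun i => by
      rw [add_assoc, add_comm 1, Fin.coeSucc_eq_succ]
    simpa only [hk] using this

section

variable {u : Fin 6 → Fin 3 → ℝ} {v : Fin 3 → ℝ}

theorem concurrency_mul_br (u : Fin 6 → Fin 3 → ℝ) (a b v : Fin 3 → ℝ) :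
    concurrency u * br a b v = br (u 0) (u 3) v * br a b (crossing₁₂ u) -
      br (u 1) (u 4) v * br a b (crossing₂₀ u) + br (u 2) (u 5) v * br a b (crossing₀₁ u) := by
  rw [← br_smul₃, concurrency_smul, br_add₃, sub_eq_add_neg, br_add₃, br_neg₃, br_smul₃, br_smul₃,
    br_smul₃]
  ring

theorem Central.br_pos (h : Central u v) {a b : Fin 3 → ℝ} (h₁₂ : 0 < br a b (crossing₁₂ u))
    (h₂₀ : 0 < br a b (crossing₂₀ u)) (h₀₁ : 0 < br a b (crossing₀₁ u)) : 0 < br a b v := by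
  have key := concurrency_mul_br u a b v
  rcases h with ⟨h0, h1, h2, h3⟩ | ⟨h0, h1, h2, h3⟩
  · refine pos_of_mul_pos_right (a := concurrency u) ?_ h0.le
    nlinarith [mul_pos h1 h₁₂, mul_pos (neg_pos.2 h2) h₂₀, mul_pos h3 h₀₁]
  · refine pos_of_mul_neg_right (a := concurrency u) ?_ h0.le
    nlinarith [mul_pos (neg_pos.2 h1) h₁₂, mul_pos h2 h₂₀, mul_pos (neg_pos.2 h3) h₀₁]

theorem Positive.side_crossing_pos (hu : Positive u) : 0 < br (u 0) (u 1) (crossing₁₂ u) ∧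
    0 < br (u 0) (u 1) (crossing₂₀ u) ∧ 0 < br (u 0) (u 1) (crossing₀₁ u) := by
  have p : ∀ i j k : Fin 6, i < j → j < k → 0 < br (u i) (u j) (u k) := hu
  refine ⟨?_, ?_, ?_⟩
  · rw [crossing₁₂, br_add₃, br_smul₃, br_smul₃]
    have := p 1 4 5 (by decide) (by decide)
    have := p 0 1 2 (by decide) (by decide)
    have := p 1 2 4 (by decide) (by decide)
    have := p 0 1 5 (by decide) (by decide)
    positivity
  · rw [crossing₂₀, br_add₃, br_smul₃, br_smul₃, br_self₁₃, mul_zero, zero_add]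
    exact mul_pos (p 0 2 5 (by decide) (by decide)) (p 0 1 3 (by decide) (by decide))
  · rw [crossing₀₁, br_add₃, br_smul₃, br_smul₃, br_self₂₃, mul_zero, zero_add]
    exact mul_pos (p 0 1 3 (by decide) (by decide)) (p 0 1 4 (by decide) (by decide))

theorem Central.side_pos (hu : Positive u) (h : Central u v) : 0 < br (u 0) (u 1) v :=
  h.br_pos hu.side_crossing_pos.1 hu.side_crossing_pos.2.1 hu.side_crossing_pos.2.2

theorem Central.shortDiagonal_pos (hu : Positive u) (h : Central u v) :
    0 < br (u 0) (u 2) v := by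
  have p : ∀ i j k : Fin 6, i < j → j < k → 0 < br (u i) (u j) (u k) := hu
  refine h.br_pos ?_ ?_ ?_
  · rw [crossing₁₂, br_add₃, br_smul₃, br_smul₃, br_self₂₃, mul_zero, zero_add]
    exact mul_pos (p 1 2 4 (by decide) (by decide)) (p 0 2 5 (by decide) (by decide))
  · rw [crossing₂₀, br_add₃, br_smul₃, br_smul₃, br_self₁₃, mul_zero, zero_add]
    exact mul_pos (p 0 2 5 (by decide) (by decide)) (p 0 2 3 (by decide) (by decide))
  · rw [crossing₀₁, br_add₃, br_smul₃, br_smul₃, br_swap₂₃ (u 0) (u 1) (u 2)]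
    have h1 := mul_pos (p 0 1 4 (by decide) (by decide)) (p 0 2 3 (by decide) (by decide))
    have h2 := br_plucker (u 0) (u 1) (u 2) (u 3) (u 4)
    linarith

/-- The central triangle lies on the inner side of the sides of the hexagon. -/
theorem Central.br_succ_pos (hu : Positive u) (h : Central u v) (i : Fin 6) :
    0 < br (u i) (u (i + 1)) v := by
  have := (h.add i).side_pos (hu.add i)
  simpa [add_comm] using this

/-- The vertex that the short diagonal from `i` to `i + 2` cuts off is on the other side of this
diagonal than the central triangle. -/
theorem Central.br_add_two_pos (hu : Positive u) (h : Central u v) (i : Fin 6) :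
    0 < br (u i) (u (i + 2)) v := by
  have := (h.add i).shortDiagonal_pos (hu.add i)
  simpa [add_comm] using this

theorem Central.br_add_three_ne_zero (h : Central u v) (i : Fin 6) :
    br (u i) (u (i + 3)) v ≠ 0 := by
  have h1 : br (u (0 + i)) (u (3 + i)) v ≠ 0 := by
    rcases h.add i with ⟨-, h, -⟩ | ⟨-, h, -⟩
    · exact h.ne'
    · exact h.ne
  simpa [add_comm] using h1

theorem Central.br_ne_zero (hu : Positive u) (h : Central u v) {i j : Fin 6} (hij : i ≠ j) :
    br (u i) (u j) v ≠ 0 := by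
  have key : ∀ i j : Fin 6, i ≠ j → j = i + 1 ∨ j = i + 2 ∨ j = i + 3 ∨ i = j + 1 ∨ i = j + 2 := by
    decide
  rcases key i j hij with rfl | rfl | rfl | rfl | rfl
  · exact (h.br_succ_pos hu i).ne'
  · exact (h.br_add_two_pos hu i).ne'
  · exact h.br_add_three_ne_zero i
  · rw [br_swap₁₂, neg_ne_zero]; exact (h.br_succ_pos hu j).ne'
  · rw [br_swap₁₂, neg_ne_zero]; exact (h.br_add_two_pos hu j).ne'

/-- The pentagon of the vertices `k, …, k + 4` of a hexagon. -/
def subPentagon (u : Fin 6 → Fin 3 → ℝ) (k : Fin 6) : Fin 5 → Fin 3 → ℝ :=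
  fun i => u (i.castSucc + k)

theorem Positive.sub_pentagon (hu : Positive u) (k : Fin 6) : Positive (subPentagon u k) :=
  fun _ _ _ h1 h2 => hu.add k _ _ _ (Fin.castSucc_lt_castSucc_iff.2 h1)
    (Fin.castSucc_lt_castSucc_iff.2 h2)

theorem generic_snoc {n : ℕ} {x : Fin n → Fin 3 → ℝ} (hx : Generic x)
    (hv : ∀ i j, i ≠ j → br (x i) (x j) v ≠ 0) :
    Generic (Fin.snoc (α := fun _ => Fin 3 → ℝ) x v) := by
  intro i j k
  induction i using Fin.lastCases with
  | last =>
    induction j using Fin.lastCases with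
    | last => intro h; exact absurd rfl h
    | cast j =>
      induction k using Fin.lastCases with
      | last => intro _ h; exact absurd rfl h
      | cast k =>
        intro _ _ h
        rw [br_cycle]
        simpa using hv j k (by simpa using h)
  | cast i =>
    induction j using Fin.lastCases with
    | last =>
      induction k using Fin.lastCases with
      | last => intro _ _ h; exact absurd rfl h
      | cast k =>
        intro _ h _
        rw [br_swap₂₃, neg_ne_zero]
        simpa using hv i k (by simpa using h)
    | cast j =>
      induction k using Fin.lastCases with
      | last => intro h _ _; simpa using hv i j (by simpa using h)
      | cast k =>
        intro h1 h2 h3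
        simpa using hx i j k (by simpa using h1) (by simpa using h2) (by simpa using h3)

theorem generic_pentCons_subPentagon (hu : Positive u)
    (hv : ∀ i j, i ≠ j → br (u i) (u j) v ≠ 0) (k : Fin 6) :
    Generic (pentCons (subPentagon u k) v) :=
  generic_snoc (hu.sub_pentagon k).generic fun i j hij => hv _ _ (by simpa using hij)

/-- A hexagon with one vertex replaced by a point of the central triangle has an adjacency graph
with three components. -/
theorem Central.card_eq_three (hu : Positive u) (h : Central u v) (k : Fin 6) :
    Nat.card (signGraph (pentCons (subPentagon u k) v)).ConnectedComponent = 3 := by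
  have main : ∀ {u : Fin 6 → Fin 3 → ℝ}, Positive u → Central u v →
      Nat.card (signGraph (pentCons (subPentagon u 0) v)).ConnectedComponent = 3 := by
    intro u hu h
    have hgen := generic_pentCons_subPentagon hu (fun i j hij => h.br_ne_zero hu hij) 0
    have h01 := h.br_succ_pos hu 0
    have h12 := h.br_succ_pos hu 1
    have h23 := h.br_succ_pos hu 2
    have h34 := h.br_succ_pos hu 3
    have h02 := h.br_add_two_pos hu 0
    have h13 := h.br_add_two_pos hu 1
    have h24 := h.br_add_two_pos hu 2
    have h40 := h.br_add_two_pos hu 4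
    rw [show (4 : Fin 6) + 2 = 0 from rfl, br_swap₁₂] at h40
    have h04 : br (u 0) (u 4) v < 0 := by linarith
    have hpairs : ∀ i j : Fin 5, i < j → (i = 0 ∧ j = 1) ∨ (i = 0 ∧ j = 2) ∨ (i = 0 ∧ j = 3) ∨
        (i = 0 ∧ j = 4) ∨ (i = 1 ∧ j = 2) ∨ (i = 1 ∧ j = 3) ∨ (i = 1 ∧ j = 4) ∨
        (i = 2 ∧ j = 3) ∨ (i = 2 ∧ j = 4) ∨ (i = 3 ∧ j = 4) := by decide
    simp only [Fin.isValue, Fin.reduceAdd, zero_add] at h01 h12 h23 h34 h02 h13 h24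
    -- The bits of `831` and `951` are the signs of the brackets `[i j v]` in the two cases.
    rcases h with ⟨-, h03, h14, -⟩ | ⟨-, h03, h14, -⟩
    · refine (card_eq_three_iff (hu.sub_pentagon 0) hgen (N := 831) (by norm_num) ?_).2 (by decide)
      intro i j hij
      simp only [subPentagon, add_zero]
      rcases hpairs i j hij with ⟨rfl, rfl⟩ | ⟨rfl, rfl⟩ | ⟨rfl, rfl⟩ | ⟨rfl, rfl⟩ | ⟨rfl, rfl⟩ |
        ⟨rfl, rfl⟩ | ⟨rfl, rfl⟩ | ⟨rfl, rfl⟩ | ⟨rfl, rfl⟩ | ⟨rfl, rfl⟩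
      · exact iff_of_true (by decide) h01
      · exact iff_of_true (by decide) h02
      · exact iff_of_true (by decide) h03
      · exact iff_of_false (by decide) h04.not_gt
      · exact iff_of_true (by decide) h12
      · exact iff_of_true (by decide) h13
      · exact iff_of_false (by decide) h14.not_gt
      · exact iff_of_true (by decide) h23
      · exact iff_of_true (by decide) h24
      · exact iff_of_true (by decide) h34
    · refine (card_eq_three_iff (hu.sub_pentagon 0) hgen (N := 951) (by norm_num) ?_).2 (by decide)
      intro i j hij
      simp only [subPentagon, add_zero]
      rcases hpairs i j hij with ⟨rfl, rfl⟩ | ⟨rfl, rfl⟩ | ⟨rfl, rfl⟩ | ⟨rfl, rfl⟩ | ⟨rfl, rfl⟩ |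
        ⟨rfl, rfl⟩ | ⟨rfl, rfl⟩ | ⟨rfl, rfl⟩ | ⟨rfl, rfl⟩ | ⟨rfl, rfl⟩
      · exact iff_of_true (by decide) h01
      · exact iff_of_true (by decide) h02
      · exact iff_of_false (by decide) h03.not_gt
      · exact iff_of_false (by decide) h04.not_gt
      · exact iff_of_true (by decide) h12
      · exact iff_of_true (by decide) h13
      · exact iff_of_true (by decide) h14
      · exact iff_of_true (by decide) h23
      · exact iff_of_true (by decide) h24
      · exact iff_of_true (by decide) h34
  have := main (hu.add k) (h.add k)
  rwa [show subPentagon (fun i => u (i + k)) 0 = subPentagon u k from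
    funext fun i => by simp [subPentagon]] at this

/-- The pairs `i < j` of elements of `{0, …, 4}`, in the order of `pairIndex`. -/
def pairs5 : List (ℕ × ℕ) :=
  [(0, 1), (0, 2), (1, 2), (0, 3), (1, 3), (2, 3), (0, 4), (1, 4), (2, 4), (3, 4)]

/-- The sign pattern of a point with respect to the pentagon `k, …, k + 4`, where `b` lists its
signs with respect to the hexagon `0, …, 5`. -/
def subPattern (b : ℕ → Bool) (k : ℕ) : ℕ :=
  Nat.ofBits fun m : Fin 10 =>
    altBit b (((pairs5.getD m (0, 0)).1 + k) % 6) (((pairs5.getD m (0, 0)).2 + k) % 6)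

theorem subPattern_lt (b : ℕ → Bool) (k : ℕ) : subPattern b k < 1024 := Nat.ofBits_lt_two_pow _

theorem testBit_subPattern (b : ℕ → Bool) (k : ℕ) (i j : Fin 5) (hij : i < j) :
    (subPattern b k).testBit (pairIndex i j) =
      altBit b (((i : ℕ) + k) % 6) (((j : ℕ) + k) % 6) := by
  have h : ∀ i j : Fin 5, i < j → pairIndex i j < 10 ∧
      pairs5.getD (pairIndex i j) (0, 0) = ((i : ℕ), (j : ℕ)) := by decide
  rw [subPattern, Nat.testBit_ofBits_lt _ _ (h i j hij).1]
  simp only [(h i j hij).2]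

theorem subPattern_zero (M : ℕ) : subPattern M.testBit 0 = M % 1024 := by
  refine Nat.eq_of_testBit_eq fun m => ?_
  rw [show 1024 = 2 ^ 10 from rfl, Nat.testBit_mod_two_pow]
  by_cases hm : m < 10
  · have h : ∀ m < 10, altBit M.testBit (((pairs5.getD m (0, 0)).1 + 0) % 6)
        (((pairs5.getD m (0, 0)).2 + 0) % 6) = M.testBit m := by
      intro m hm
      interval_cases m <;> rfl
    rw [subPattern, Nat.testBit_ofBits_lt _ _ hm]
    exact (h m hm).trans (by simp [hm])
  · rw [Nat.testBit_eq_false_of_lt ((subPattern_lt _ _).trans_le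
      (Nat.pow_le_pow_right (n := 2) two_pos (not_lt.1 hm)))]
    simp [hm]

/-- If six sign patterns of a point with respect to the pentagons in a hexagon are those of
tricomponent configurations, then the signs of the principal diagonals alternate; the bits `3`, `7`,
`12` belong to the pairs `03`, `14`, `25`. -/
theorem diagonal_signs_of_subPattern {M : ℕ} (hM : M < 32768)
    (h : ∀ k < 6, subPattern M.testBit k ∈ triPatterns) :
    M.testBit 3 ≠ M.testBit 7 ∧ M.testBit 7 ≠ M.testBit 12 := by
  have key : ∀ t ∈ triPatterns, ∀ m < 32,
      (∀ k < 6, subPattern (t + 1024 * m).testBit k ∈ triPatterns) →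
      (t + 1024 * m).testBit 3 ≠ (t + 1024 * m).testBit 7 ∧
        (t + 1024 * m).testBit 7 ≠ (t + 1024 * m).testBit 12 := by
    decide +kernel
  have h0 := h 0 (by norm_num)
  rw [subPattern_zero] at h0
  have h1 := key _ h0 (M / 1024) (by omega)
  rw [Nat.mod_add_div] at h1
  exact h1 h

/-- If replacing any vertex of a hexagon by `v` yields an adjacency graph with three components,
then `v` or `-v` lies in the central triangle. -/
theorem central_of_card_eq_three (hu : Positive u) (hv : ∀ i j, i ≠ j → br (u i) (u j) v ≠ 0)
    (h : ∀ k, Nat.card (signGraph (pentCons (subPentagon u k) v)).ConnectedComponent = 3) :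
    concurrency u ≠ 0 ∧ (Central u v ∨ Central u (-v)) := by
  obtain ⟨M, hM, hb⟩ := exists_isPattern (m := 15) u v (by decide) (by decide)
  have hsub : ∀ k : Fin 6, IsPattern (subPentagon u k) v (subPattern M.testBit k).testBit := by
    intro k i j hij
    rw [testBit_subPattern _ _ _ _ hij]
    have hne : i.castSucc + k ≠ j.castSucc + k := by simpa using hij.ne
    exact altBit_iff hb hne (hv _ _ hne)
  have hsigns := diagonal_signs_of_subPattern hM fun k hk =>
    (card_eq_three_iff (hu.sub_pentagon ⟨k, hk⟩) (generic_pentCons_subPentagon hu hv _)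
      (subPattern_lt _ _) (hsub ⟨k, hk⟩)).1 (h _)
  have h03 := hb 0 3 (by decide)
  have h14 := hb 1 4 (by decide)
  have h25 := hb 2 5 (by decide)
  rw [show pairIndex (0 : Fin 6) (3 : Fin 6) = 3 from rfl] at h03
  rw [show pairIndex (1 : Fin 6) (4 : Fin 6) = 7 from rfl] at h14
  rw [show pairIndex (2 : Fin 6) (5 : Fin 6) = 12 from rfl] at h25
  have n03 := hv 0 3 (by decide)
  have n14 := hv 1 4 (by decide)
  have n25 := hv 2 5 (by decide)
  -- The bracket with a side of the hexagon is positive at the crossings of the diagonals; hence the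
  -- signs of the diagonals at `v` can only alternate if `concurrency u ≠ 0`.
  have key := concurrency_mul_br u (u 0) (u 1) v
  obtain ⟨h₁₂, h₂₀, h₀₁⟩ := hu.side_crossing_pos
  unfold Central
  simp only [br_neg₃, neg_pos, neg_lt_zero]
  rcases n03.lt_or_gt with s03 | s03 <;> rcases n14.lt_or_gt with s14 | s14 <;>
    rcases n25.lt_or_gt with s25 | s25
  · exact absurd (Bool.eq_iff_iff.2 (h03.trans ((iff_of_false s03.not_gt s14.not_gt).trans h14.symm)))
      hsigns.1
  · exact absurd (Bool.eq_iff_iff.2 (h03.trans ((iff_of_false s03.not_gt s14.not_gt).trans h14.symm)))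
      hsigns.1
  · have h0 : concurrency u ≠ 0 := by
      intro h0
      rw [h0, zero_mul] at key
      linarith [mul_neg_of_neg_of_pos s03 h₁₂, mul_pos s14 h₂₀, mul_neg_of_neg_of_pos s25 h₀₁]
    refine ⟨h0, ?_⟩
    rcases h0.lt_or_gt with h0 | h0
    · exact Or.inl (Or.inr ⟨h0, s03, s14, s25⟩)
    · exact Or.inr (Or.inl ⟨h0, s03, s14, s25⟩)
  · exact absurd (Bool.eq_iff_iff.2 (h14.trans ((iff_of_true s14 s25).trans h25.symm))) hsigns.2
  · exact absurd (Bool.eq_iff_iff.2 (h14.trans ((iff_of_false s14.not_gt s25.not_gt).trans h25.symm)))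
      hsigns.2
  · have h0 : concurrency u ≠ 0 := by
      intro h0
      rw [h0, zero_mul] at key
      linarith [mul_pos s03 h₁₂, mul_neg_of_neg_of_pos s14 h₂₀, mul_pos s25 h₀₁]
    refine ⟨h0, ?_⟩
    rcases h0.lt_or_gt with h0 | h0
    · exact Or.inr (Or.inr ⟨h0, s03, s14, s25⟩)
    · exact Or.inl (Or.inl ⟨h0, s03, s14, s25⟩)
  · exact absurd (Bool.eq_iff_iff.2 (h03.trans ((iff_of_true s03 s14).trans h14.symm))) hsigns.1
  · exact absurd (Bool.eq_iff_iff.2 (h03.trans ((iff_of_true s03 s14).trans h14.symm))) hsigns.1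

end

/-! ### Conics through six points -/

theorem quadraticForm_comb (Q : QuadraticForm ℝ (Fin 3 → ℝ)) (x y z : ℝ) (a b c : Fin 3 → ℝ) :
    Q (x • a + y • b + z • c) = x * x * Q a + y * y * Q b + z * z * Q c +
      x * y * QuadraticMap.polar Q a b + x * z * QuadraticMap.polar Q a c +
      y * z * QuadraticMap.polar Q b c := by
  rw [QuadraticMap.map_add Q, QuadraticMap.map_add Q, QuadraticMap.map_smul, QuadraticMap.map_smul,
    QuadraticMap.map_smul, QuadraticMap.polar_add_left, QuadraticMap.polar_smul_left,
    QuadraticMap.polar_smul_left, QuadraticMap.polar_smul_left, QuadraticMap.polar_smul_right,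
    QuadraticMap.polar_smul_right, QuadraticMap.polar_smul_right]
  simp only [smul_eq_mul]
  ring

theorem br_comb (a b c : Fin 3 → ℝ) (x₁ y₁ z₁ x₂ y₂ z₂ x₃ y₃ z₃ : ℝ) :
    br (x₁ • a + y₁ • b + z₁ • c) (x₂ • a + y₂ • b + z₂ • c) (x₃ • a + y₃ • b + z₃ • c) =
      (x₁ * y₂ * z₃ - x₁ * z₂ * y₃ - y₁ * x₂ * z₃ + y₁ * z₂ * x₃ + z₁ * x₂ * y₃ - z₁ * y₂ * x₃) *
        br a b c := by
  simp only [br_eq, Pi.add_apply, Pi.smul_apply, smul_eq_mul]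
  ring

theorem apply_rep_eq_zero_iff (Q : QuadraticForm ℝ (Fin 3 → ℝ)) {v : Fin 3 → ℝ} (hv : v ≠ 0) :
    Q (Projectivization.mk ℝ v hv).rep = 0 ↔ Q v = 0 := by
  obtain ⟨a, ha⟩ := Projectivization.exists_smul_eq_mk_rep ℝ v hv
  rw [← ha, Units.smul_def, QuadraticMap.map_smul, smul_eq_mul, mul_eq_zero, mul_self_eq_zero]
  simp

theorem Represents.coconic_iff {ι : Type*} {u : ι → Fin 3 → ℝ} {s : Finset RP2}
    (h : Represents u s) :
    Coconic s ↔ ∃ Q : QuadraticForm ℝ (Fin 3 → ℝ), Q ≠ 0 ∧ ∀ i, Q (u i) = 0 := by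
  refine exists_congr fun Q => and_congr_right fun _ => ?_
  constructor
  · intro hQ i
    exact (apply_rep_eq_zero_iff Q (h.1 i)).1 (hQ _ ((h.2 _).2 ⟨i, h.1 i, rfl⟩))
  · intro hQ p hp
    obtain ⟨i, hi, rfl⟩ := (h.2 p).1 hp
    exact (apply_rep_eq_zero_iff Q hi).2 (hQ i)

/-- The linear form `[a b ·]`. -/
noncomputable def brForm (a b : Fin 3 → ℝ) : (Fin 3 → ℝ) →ₗ[ℝ] ℝ where
  toFun v := br a b v
  map_add' := br_add₃ a b
  map_smul' x v := br_smul₃ x a b v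

@[simp] theorem brForm_apply (a b v : Fin 3 → ℝ) : brForm a b v = br a b v := rfl

theorem Represents.coconic_of_conicity_eq_zero {u : Fin 6 → Fin 3 → ℝ} {s : Finset RP2}
    (h : Represents u s) (hu : Generic u) (h0 : conicity u = 0) : Coconic s := by
  have g : ∀ i j k : Fin 6, i ≠ j → i ≠ k → j ≠ k → br (u i) (u j) (u k) ≠ 0 := hu
  -- As a function of the last point, `conicity` is a quadratic form that vanishes at the others.
  let Q : QuadraticForm ℝ (Fin 3 → ℝ) :=
    (br (u 0) (u 1) (u 2) * br (u 2) (u 3) (u 4)) •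
        QuadraticMap.linMulLin (brForm (u 0) (u 4)) (brForm (u 1) (u 3)) -
      (br (u 1) (u 2) (u 3) * br (u 0) (u 2) (u 4)) •
        QuadraticMap.linMulLin (brForm (u 3) (u 4)) (brForm (u 0) (u 1))
  have hQ : ∀ x, Q x = br (u 0) (u 1) (u 2) * br (u 2) (u 3) (u 4) *
      (br (u 0) (u 4) x * br (u 1) (u 3) x) - br (u 1) (u 2) (u 3) * br (u 0) (u 2) (u 4) *
      (br (u 3) (u 4) x * br (u 0) (u 1) x) := fun x => rfl
  refine h.coconic_iff.2 ⟨Q, fun hz => ?_, fun i => ?_⟩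
  · have h1 : Q (u 0 + u 1) = 0 := by rw [hz]; rfl
    rw [hQ, br_add₃, br_add₃, br_add₃, br_add₃, br_self₁₃, br_self₁₃, br_self₁₃, br_self₂₃] at h1
    refine mul_ne_zero (mul_ne_zero (g 0 1 2 (by decide) (by decide) (by decide))
      (g 2 3 4 (by decide) (by decide) (by decide))) (mul_ne_zero
      (g 0 4 1 (by decide) (by decide) (by decide))
      (g 1 3 0 (by decide) (by decide) (by decide))) ?_
    simpa using h1
  · rw [hQ]
    have hi : ∀ i : Fin 6, i = 0 ∨ i = 1 ∨ i = 2 ∨ i = 3 ∨ i = 4 ∨ i = 5 := by decide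
    rcases hi i with rfl | rfl | rfl | rfl | rfl | rfl
    · simp [br_self₁₃]
    · simp [br_self₁₃, br_self₂₃]
    · rw [br_swap₂₃ (u 0) (u 2) (u 4), br_swap₂₃ (u 1) (u 2) (u 3), ← br_cycle (u 2) (u 3) (u 4)]
      ring
    · simp [br_self₁₃, br_self₂₃]
    · simp [br_self₂₃]
    · rw [← h0, conicity, ← br_cycle (u 0) (u 4) (u 5), br_cycle (u 5) (u 0) (u 1)]
      ring

theorem Represents.not_coconic_of_conicity_ne_zero {u : Fin 6 → Fin 3 → ℝ} {s : Finset RP2}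
    (h : Represents u s) (hu : Generic u) (h0 : conicity u ≠ 0) : ¬ Coconic s := by
  rw [h.coconic_iff]
  rintro ⟨Q, hQ, hz⟩
  -- In the basis `u 0, u 2, u 4` the form `Q` has only mixed terms. Its vanishing at the other three
  -- points is a linear system for their coefficients, with determinant `m`, a multiple of `conicity`.
  have hδ : br (u 0) (u 2) (u 4) ≠ 0 := hu 0 2 4 (by decide) (by decide) (by decide)
  set δ := br (u 0) (u 2) (u 4) with hδdef
  have hcramer := br_cramer (u 0) (u 2) (u 4)
  rw [← hδdef] at hcramer
  have hQx : ∀ x, δ * δ * Q x = br x (u 2) (u 4) * br (u 0) x (u 4) * QuadraticMap.polar Q (u 0) (u 2) +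
      br x (u 2) (u 4) * br (u 0) (u 2) x * QuadraticMap.polar Q (u 0) (u 4) +
      br (u 0) x (u 4) * br (u 0) (u 2) x * QuadraticMap.polar Q (u 2) (u 4) := by
    intro x
    have := quadraticForm_comb Q (br x (u 2) (u 4)) (br (u 0) x (u 4)) (br (u 0) (u 2) x)
      (u 0) (u 2) (u 4)
    rw [← hcramer, QuadraticMap.map_smul, hz, hz, hz, smul_eq_mul] at this
    linarith
  have e1 := hQx (u 1)
  have e3 := hQx (u 3)
  have e5 := hQx (u 5)
  rw [hz, mul_zero] at e1 e3 e5
  have c1 := hcramer (u 1)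
  have c3 := hcramer (u 3)
  have c5 := hcramer (u 5)
  have k012 : br (u 0) (u 1) (u 2) = - br (u 0) (u 2) (u 1) := br_swap₂₃ _ _ _
  have k234 : br (u 2) (u 3) (u 4) = - br (u 3) (u 2) (u 4) := br_swap₁₂ _ _ _
  have k450 : br (u 4) (u 5) (u 0) = - br (u 0) (u 5) (u 4) := br_swap₁₃ _ _ _
  generalize br (u 1) (u 2) (u 4) = x1 at *
  generalize br (u 3) (u 2) (u 4) = x3 at *
  generalize br (u 5) (u 2) (u 4) = x5 at *
  generalize br (u 0) (u 1) (u 4) = y1 at *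
  generalize br (u 0) (u 3) (u 4) = y3 at *
  generalize br (u 0) (u 5) (u 4) = y5 at *
  generalize br (u 0) (u 2) (u 1) = z1 at *
  generalize br (u 0) (u 2) (u 3) = z3 at *
  generalize br (u 0) (u 2) (u 5) = z5 at *
  have k135 : δ * δ * br (u 1) (u 3) (u 5) = x1 * y3 * z5 - x1 * z3 * y5 - y1 * x3 * z5 +
      y1 * z3 * x5 + z1 * x3 * y5 - z1 * y3 * x5 := by
    have h1 := br_comb (u 0) (u 2) (u 4) x1 y1 z1 x3 y3 z3 x5 y5 z5
    rw [← c1, ← c3, ← c5, br_smul, ← hδdef] at h1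
    exact mul_right_cancel₀ hδ (by linarith)
  have k123 : δ * br (u 1) (u 2) (u 3) = x1 * z3 - z1 * x3 := by
    have h1 := br_comb (u 0) (u 2) (u 4) x1 y1 z1 0 1 0 x3 y3 z3
    rw [← c1, ← c3, zero_smul, zero_smul, one_smul, zero_add, add_zero, br_smul₁, br_smul₃,
      ← hδdef] at h1
    exact mul_right_cancel₀ hδ (by linarith)
  have k345 : δ * br (u 3) (u 4) (u 5) = y3 * x5 - x3 * y5 := by
    have h1 := br_comb (u 0) (u 2) (u 4) x3 y3 z3 0 0 1 x5 y5 z5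
    rw [← c3, ← c5, zero_smul, zero_smul, one_smul, zero_add, zero_add, br_smul₁, br_smul₃,
      ← hδdef] at h1
    exact mul_right_cancel₀ hδ (by linarith)
  have k501 : δ * br (u 5) (u 0) (u 1) = z5 * y1 - y5 * z1 := by
    have h1 := br_comb (u 0) (u 2) (u 4) x5 y5 z5 1 0 0 x1 y1 z1
    rw [← c5, ← c1, zero_smul, zero_smul, one_smul, add_zero, add_zero, br_smul₁, br_smul₃,
      ← hδdef] at h1
    exact mul_right_cancel₀ hδ (by linarith)
  set m := x1 * y1 * (x3 * z3 * (y5 * z5) - y3 * z3 * (x5 * z5)) -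
    x1 * z1 * (x3 * y3 * (y5 * z5) - y3 * z3 * (x5 * y5)) +
    y1 * z1 * (x3 * y3 * (x5 * z5) - x3 * z3 * (x5 * y5)) with hm
  have hdet : δ * δ * conicity u = m := by
    have : δ * δ * conicity u = -(z1 * x3 * y5) * (δ * δ * br (u 1) (u 3) (u 5)) -
        (δ * br (u 1) (u 2) (u 3)) * (δ * br (u 3) (u 4) (u 5)) * (δ * br (u 5) (u 0) (u 1)) := by
      rw [conicity, k012, k234, k450, ← hδdef]
      ring
    rw [this, k135, k123, k345, k501, hm]
    ring
  have hm0 : m ≠ 0 := hdet ▸ mul_ne_zero (mul_ne_zero hδ hδ) h0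
  generalize QuadraticMap.polar Q (u 0) (u 2) = α at *
  generalize QuadraticMap.polar Q (u 0) (u 4) = β at *
  generalize QuadraticMap.polar Q (u 2) (u 4) = γ at *
  have hα : α = 0 := by
    refine (mul_eq_zero.1 ?_).resolve_left hm0
    rw [hm]
    linear_combination (-(x3 * z3 * (y5 * z5) - y3 * z3 * (x5 * z5))) * e1 +
      (x1 * z1 * (y5 * z5) - y1 * z1 * (x5 * z5)) * e3 -
      (x1 * z1 * (y3 * z3) - y1 * z1 * (x3 * z3)) * e5
  have hβ : β = 0 := by
    refine (mul_eq_zero.1 ?_).resolve_left hm0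
    rw [hm]
    linear_combination (x3 * y3 * (y5 * z5) - y3 * z3 * (x5 * y5)) * e1 -
      (x1 * y1 * (y5 * z5) - y1 * z1 * (x5 * y5)) * e3 +
      (x1 * y1 * (y3 * z3) - y1 * z1 * (x3 * y3)) * e5
  have hγ : γ = 0 := by
    refine (mul_eq_zero.1 ?_).resolve_left hm0
    rw [hm]
    linear_combination (-(x3 * y3 * (x5 * z5) - x3 * z3 * (x5 * y5))) * e1 +
      (x1 * y1 * (x5 * z5) - x1 * z1 * (x5 * y5)) * e3 -
      (x1 * y1 * (x3 * z3) - x1 * z1 * (x3 * y3)) * e5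
  apply hQ
  ext x
  have := hQx x
  rw [hα, hβ, hγ] at this
  simpa [hδ] using this

/-! ### Cyclic configurations -/

section

variable {u : Fin 6 → Fin 3 → ℝ}

theorem pentCons_subPentagon_zero (u : Fin 6 → Fin 3 → ℝ) :
    pentCons (subPentagon u 0) (u 5) = u := by
  funext i
  induction i using Fin.lastCases with
  | last => exact pentCons_last _ _
  | cast i => rw [pentCons_castSucc, subPentagon, add_zero]

/-- The adjacency graph of a convex hexagon is the cycle of its sides. -/
theorem Positive.signGraph_adj_iff (hu : Positive u) (i j : Fin 6) :
    (signGraph u).Adj i j ↔ j = i + 1 ∨ i = j + 1 := by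
  have hb : IsPattern (subPentagon u 0) (u 5) (Nat.testBit 1023) := by
    intro i j hij
    have hbit : ∀ i j : Fin 5, i < j → Nat.testBit 1023 (pairIndex i j) = true := by decide
    refine iff_of_true (hbit i j hij) ?_
    simp only [subPentagon, add_zero]
    exact hu i.castSucc j.castSucc (Fin.last 5) (by simpa using hij) (Fin.castSucc_lt_last j)
  have hgen : Generic (pentCons (subPentagon u 0) (u 5)) := by
    rw [pentCons_subPentagon_zero]; exact hu.generic
  have hlt : ∀ {i j : Fin 6}, i < j →
      ((signGraph u).Adj i j ↔ ((i : ℕ), (j : ℕ)) ∈ pentEdges (Nat.testBit 1023)) := by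
    intro i j hij
    rw [← _root_.signGraph_adj_iff (hu.sub_pentagon 0) hgen hb hij, pentCons_subPentagon_zero]
  have hlist : ∀ i j : Fin 6, i < j →
      (((i : ℕ), (j : ℕ)) ∈ pentEdges (Nat.testBit 1023) ↔ j = i + 1 ∨ i = j + 1) := by
    decide +kernel
  rcases lt_trichotomy i j with h | rfl | h
  · rw [hlt h, hlist i j h]
  · exact iff_of_false (SimpleGraph.irrefl _) (by simp)
  · rw [SimpleGraph.adj_comm, hlt h, hlist j i h, or_comm]

theorem Positive.card_eq_one (hu : Positive u) :
    Nat.card (signGraph u).ConnectedComponent = 1 := by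
  refine le_antisymm ((signGraph u).card_connectedComponent_le (fun _ : Fin 1 => 0)
    fun i => ⟨0, ?_⟩) Nat.card_pos
  induction i using Fin.induction with
  | zero => exact SimpleGraph.Reachable.refl _
  | succ i ih =>
    refine ih.trans (SimpleGraph.Adj.reachable ((hu.signGraph_adj_iff _ _).2 (Or.inl ?_)))
    exact (Fin.coeSucc_eq_succ).symm

theorem Represents.mem_LC6_one {P : Configuration 6} (h : Represents u P.points)
    (hu : Positive u) : P ∈ Configuration.LC6 1 :=
  (h.mem_LC6_iff 1).2 ⟨hu.generic, hu.card_eq_one⟩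

/-- The principal diagonals have a common point. -/
def ConcurrentDiagonals (u : Fin 6 → Fin 3 → ℝ) : Prop :=
  ∃ x : Fin 3 → ℝ, x ≠ 0 ∧ ∀ i, br (u i) (u (i + 3)) x = 0

theorem forall_diagonal_iff (x : Fin 3 → ℝ) : (∀ i, br (u i) (u (i + 3)) x = 0) ↔
    br (u 0) (u 3) x = 0 ∧ br (u 1) (u 4) x = 0 ∧ br (u 2) (u 5) x = 0 := by
  constructor
  · exact fun h => ⟨h 0, h 1, h 2⟩
  · rintro ⟨h0, h1, h2⟩ i
    have hi : ∀ i : Fin 6, i = 0 ∨ i = 1 ∨ i = 2 ∨ i = 3 ∨ i = 4 ∨ i = 5 := by decide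
    rcases hi i with rfl | rfl | rfl | rfl | rfl | rfl
    · exact h0
    · exact h1
    · exact h2
    · exact (br_swap₁₂ _ _ _).trans (neg_eq_zero.2 h0)
    · exact (br_swap₁₂ _ _ _).trans (neg_eq_zero.2 h1)
    · exact (br_swap₁₂ _ _ _).trans (neg_eq_zero.2 h2)

theorem Positive.concurrentDiagonals_iff (hu : Positive u) :
    ConcurrentDiagonals u ↔ concurrency u = 0 := by
  constructor
  · rintro ⟨x, hx, h⟩
    obtain ⟨h0, h1, h2⟩ := (forall_diagonal_iff x).1 h
    have := concurrency_smul u x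
    rw [h0, h1, h2] at this
    simpa [hx] using this
  · intro h
    refine ⟨crossing₀₁ u, (ne_zero_of_br_ne_zero hu.side_crossing_pos.2.2.ne').2.2,
      (forall_diagonal_iff _).2 ⟨?_, ?_, ?_⟩⟩
    · rw [crossing₀₁, br_add₃, br_smul₃, br_smul₃, br_swap₂₃ (u 0) (u 1) (u 3)]
      ring
    · rw [crossing₀₁, br_add₃, br_smul₃, br_smul₃, br_self₁₃, br_self₂₃]
      ring
    · rw [← h, crossing₀₁, concurrency, br_add₃, br_smul₃, br_smul₃, br_cycle (u 1) (u 2) (u 5),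
        br_swap₂₃ (u 2) (u 4) (u 5)]
      ring

/-- Whether the principal diagonals are concurrent does not depend on the numeration. -/
theorem Represents.concurrentDiagonals {u' : Fin 6 → Fin 3 → ℝ} {P : Configuration 6}
    (h : Represents u P.points) (hu : Positive u) (h' : Represents u' P.points)
    (hu' : Positive u') (hc : ConcurrentDiagonals u) : ConcurrentDiagonals u' := by
  obtain ⟨x, hx, hux⟩ := hc
  refine ⟨x, hx, fun i => ?_⟩
  let σ : Fin 6 → Fin 6 := fun i => h.equiv.symm (h'.equiv i)
  have hσ : Function.Injective σ := h.equiv.symm.injective.comp h'.equiv.injective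
  have hadj : ∀ i, σ (i + 1) = σ i + 1 ∨ σ i = σ (i + 1) + 1 := by
    intro i
    have h1 := (h'.adj_iff hu'.generic i (i + 1)).2 ((hu'.signGraph_adj_iff _ _).2 (Or.inl rfl))
    have h2 := h.adj_iff hu.generic (σ i) (σ (i + 1))
    simp only [σ, Equiv.apply_symm_apply] at h2
    exact (hu.signGraph_adj_iff _ _).1 (h2.1 h1)
  have hσ3 : σ (i + 3) = σ i + 3 := by
    have key : ∀ a b c d : Fin 6, (b = a + 1 ∨ a = b + 1) → (c = b + 1 ∨ b = c + 1) →
        (d = c + 1 ∨ c = d + 1) → a ≠ c → b ≠ d → d = a + 3 := by decide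
    have e2 : i + 1 + 1 = i + 2 := by rw [add_assoc]; rfl
    have e3 : i + 2 + 1 = i + 3 := by rw [add_assoc]; rfl
    refine key (σ i) (σ (i + 1)) (σ (i + 2)) (σ (i + 3)) (hadj i) (e2 ▸ hadj (i + 1))
      (e3 ▸ hadj (i + 2)) (hσ.ne ?_) (hσ.ne ?_)
    · simp
    · simp
  have hmk : ∀ i, ∃ c : ℝ, c • u (σ i) = u' i := by
    intro i
    have h1 : (h'.equiv i).1 = (h.equiv (σ i)).1 := by simp [σ]
    exact (Projectivization.mk_eq_mk_iff' ℝ _ _ _ _).1 h1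
  obtain ⟨c, hc⟩ := hmk i
  obtain ⟨d, hd⟩ := hmk (i + 3)
  rw [← hc, ← hd, br_smul₁, br_smul₂, hσ3, hux, mul_zero, mul_zero]

/-- An affine chart that contains the whole hexagon. -/
theorem Positive.exists_chart (hu : Positive u) :
    ∃ φ : (Fin 3 → ℝ) →ₗ[ℝ] ℝ, ∀ i, 0 < φ (u i) := by
  have p : ∀ i j k : Fin 6, i < j → j < k → 0 < br (u i) (u j) (u k) := hu
  refine ⟨brForm (u 0) (u 1) + brForm (u 2) (u 3), fun i => ?_⟩
  rw [LinearMap.add_apply, brForm_apply, brForm_apply]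
  have hi : ∀ i : Fin 6, i = 0 ∨ i = 1 ∨ i = 2 ∨ i = 3 ∨ i = 4 ∨ i = 5 := by decide
  rcases hi i with rfl | rfl | rfl | rfl | rfl | rfl
  · rw [br_self₁₃, zero_add, ← br_cycle]
    exact p 0 2 3 (by decide) (by decide)
  · rw [br_self₂₃, zero_add, ← br_cycle]
    exact p 1 2 3 (by decide) (by decide)
  · rw [br_self₁₃, add_zero]
    exact p 0 1 2 (by decide) (by decide)
  · rw [br_self₂₃, add_zero]
    exact p 0 1 3 (by decide) (by decide)
  · exact add_pos (p 0 1 4 (by decide) (by decide)) (p 2 3 4 (by decide) (by decide))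
  · exact add_pos (p 0 1 5 (by decide) (by decide)) (p 2 3 5 (by decide) (by decide))

/-- Positive rescaling of the vectors of a hexagon. -/
theorem Positive.smul {n : ℕ} {u : Fin n → Fin 3 → ℝ} (hu : Positive u) {c : Fin n → ℝ}
    (hc : ∀ i, 0 < c i) : Positive fun i => c i • u i := fun i j k hij hjk => by
  rw [br_smul]
  exact mul_pos (mul_pos (mul_pos (hc i) (hc j)) (hc k)) (hu i j k hij hjk)

theorem concurrency_smul_vectors (c : Fin 6 → ℝ) (u : Fin 6 → Fin 3 → ℝ) :
    concurrency (fun i => c i • u i) =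
      c 0 * c 1 * c 2 * c 3 * c 4 * c 5 * concurrency u := by
  simp only [concurrency, br_smul]; ring

theorem conicity_smul_vectors (c : Fin 6 → ℝ) (u : Fin 6 → Fin 3 → ℝ) :
    conicity (fun i => c i • u i) =
      (c 0 * c 1 * c 2 * c 3 * c 4 * c 5) ^ 2 * conicity u := by
  simp only [conicity, br_smul]; ring

theorem Represents.smul {ι : Type*} {u : ι → Fin 3 → ℝ} {s : Finset RP2} (h : Represents u s)
    {c : ι → ℝ} (hc : ∀ i, c i ≠ 0) : Represents (fun i => c i • u i) s :=
  h.reindex Function.surjective_id hc fun _ => rfl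

/-- Every positive hexagon can be rescaled to a convex hexagon in an affine chart. -/
theorem Positive.exists_isConvexHexagon (hu : Positive u) :
    ∃ (φ : (Fin 3 → ℝ) →ₗ[ℝ] ℝ) (c : Fin 6 → ℝ), (∀ i, 0 < c i) ∧
      IsConvexHexagon φ fun i => c i • u i := by
  obtain ⟨φ, hφ⟩ := hu.exists_chart
  refine ⟨φ, fun i => (φ (u i))⁻¹, fun i => inv_pos.2 (hφ i), ⟨fun i => ?_, ?_⟩⟩
  · rw [map_smul, smul_eq_mul, inv_mul_cancel₀ (hφ i).ne']
  · exact hu.smul fun i => inv_pos.2 (hφ i)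

theorem IsConvexHexagon.positive {φ : (Fin 3 → ℝ) →ₗ[ℝ] ℝ} (h : IsConvexHexagon φ u) :
    Positive u := h.convex

theorem Configuration.FormsHexagon.represents {P : Configuration 6} {φ : (Fin 3 → ℝ) →ₗ[ℝ] ℝ}
    (h : P.FormsHexagon φ u) : Represents u P.points := by
  refine ⟨fun i h0 => ?_, h.2⟩
  have := h.1.chart i
  rw [h0, map_zero] at this
  exact zero_ne_one this

theorem Represents.formsHexagon {P : Configuration 6} {φ : (Fin 3 → ℝ) →ₗ[ℝ] ℝ}
    (h : Represents u P.points) (hφ : IsConvexHexagon φ u) : P.FormsHexagon φ u := ⟨hφ, h.2⟩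

theorem Represents.exists_mem_projLines_iff {s : Finset RP2} (h : Represents u s)
    (hu : Positive u) : (∃ x, x ∈ projLine (Projectivization.mk ℝ (u 0) (h.1 0))
        (Projectivization.mk ℝ (u 3) (h.1 3)) ∧
      x ∈ projLine (Projectivization.mk ℝ (u 1) (h.1 1)) (Projectivization.mk ℝ (u 4) (h.1 4)) ∧
      x ∈ projLine (Projectivization.mk ℝ (u 2) (h.1 2)) (Projectivization.mk ℝ (u 5) (h.1 5))) ↔
      concurrency u = 0 := by
  rw [← hu.concurrentDiagonals_iff]
  have g : ∀ i j k : Fin 6, i ≠ j → i ≠ k → j ≠ k → br (u i) (u j) (u k) ≠ 0 := hu.generic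
  have hmem : ∀ (v : Fin 3 → ℝ) (hv : v ≠ 0), (∀ i, br (u i) (u (i + 3)) v = 0) ↔
      (Projectivization.mk ℝ v hv ∈ projLine (Projectivization.mk ℝ (u 0) (h.1 0))
        (Projectivization.mk ℝ (u 3) (h.1 3)) ∧
      Projectivization.mk ℝ v hv ∈ projLine (Projectivization.mk ℝ (u 1) (h.1 1))
        (Projectivization.mk ℝ (u 4) (h.1 4)) ∧
      Projectivization.mk ℝ v hv ∈ projLine (Projectivization.mk ℝ (u 2) (h.1 2))
        (Projectivization.mk ℝ (u 5) (h.1 5))) := by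
    intro v hv
    rw [forall_diagonal_iff,
      mk_mem_projLine_iff _ _ hv (g 0 3 1 (by decide) (by decide) (by decide)),
      mk_mem_projLine_iff _ _ hv (g 1 4 0 (by decide) (by decide) (by decide)),
      mk_mem_projLine_iff _ _ hv (g 2 5 0 (by decide) (by decide) (by decide))]
  constructor
  · rintro ⟨x, hx⟩
    induction x using Projectivization.ind with
    | h v hv => exact ⟨v, hv, (hmem v hv).2 hx⟩
  · rintro ⟨v, hv, hx⟩
    exact ⟨_, (hmem v hv).1 hx⟩

theorem Configuration.isTypical_iff {P : Configuration 6} :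
    P.IsTypical ↔ P.IsSimple ∧ ¬ Coconic P.points := by
  refine and_congr_right fun _ => ⟨fun h => h _ subset_rfl P.2, fun h t ht hcard => ?_⟩
  rwa [Finset.eq_of_subset_of_card_le ht (by rw [hcard]; exact P.2.le)]

theorem Represents.isTypical_iff {P : Configuration 6} (h : Represents u P.points)
    (hu : Positive u) : P.IsTypical ↔ conicity u ≠ 0 := by
  rw [Configuration.isTypical_iff, h.isSimple_iff]
  constructor
  · exact fun ⟨_, h2⟩ h0 => h2 (h.coconic_of_conicity_eq_zero hu.generic h0)
  · exact fun h0 => ⟨hu.generic, h.not_coconic_of_conicity_ne_zero hu.generic h0⟩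

/-- The configurations of the first part in terms of homogeneous coordinates. -/
theorem mem_nonconcurrentLC61_iff {P : Configuration 6} :
    P ∈ Configuration.nonconcurrentLC61 ↔ ∃ u, Represents u P.points ∧ Positive u ∧
      concurrency u ≠ 0 ∧ conicity u ≠ 0 := by
  constructor
  · rintro ⟨-, htyp, p, ⟨φ, u, hform, hp⟩, hnc⟩
    have h := hform.represents
    have hu := hform.1.positive
    refine ⟨u, h, hu, fun h0 => hnc ?_, (h.isTypical_iff hu).1 htyp⟩
    obtain ⟨x, hx⟩ := (h.exists_mem_projLines_iff hu).2 h0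
    have hpi : ∀ i, p i = Projectivization.mk ℝ (u i) (h.1 i) := fun i => (hp i).2
    simp only [hpi]
    exact ⟨x, hx⟩
  · rintro ⟨u, h, hu, hD, hC⟩
    refine ⟨h.mem_LC6_one hu, (h.isTypical_iff hu).2 hC, ?_⟩
    obtain ⟨φ, c, hc, hφ⟩ := hu.exists_isConvexHexagon
    have h' := h.smul fun i => (hc i).ne'
    have hu' := hu.smul hc
    refine ⟨fun i => Projectivization.mk ℝ _ (h'.1 i), ⟨φ, _, h'.formsHexagon hφ,
      fun i => ⟨h'.1 i, rfl⟩⟩, fun hx => ?_⟩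
    have := (h'.exists_mem_projLines_iff hu').1 hx
    rw [concurrency_smul_vectors] at this
    have h0 := hc 0
    have h1 := hc 1
    have h2 := hc 2
    have h3 := hc 3
    have h4 := hc 4
    have h5 := hc 5
    exact hD ((mul_eq_zero.1 this).resolve_left (by positivity))

end

/-! ### The central triangle -/

section

variable {u : Fin 6 → Fin 3 → ℝ} {v : Fin 3 → ℝ}

theorem Central.concurrency_ne_zero (h : Central u v) : concurrency u ≠ 0 :=
  h.elim (fun h => h.1.ne') fun h => h.1.ne

theorem Central.ne_zero (h : Central u v) : v ≠ 0 :=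
  (ne_zero_of_br_ne_zero (h.br_add_three_ne_zero 0)).2.2

theorem Central.smul (h : Central u v) {c : Fin 6 → ℝ} (hc : ∀ i, 0 < c i) :
    Central (fun i => c i • u i) v := by
  have hp : 0 < c 0 * c 1 * c 2 * c 3 * c 4 * c 5 := by
    have h0 := hc 0
    have h1 := hc 1
    have h2 := hc 2
    have h3 := hc 3
    have h4 := hc 4
    have h5 := hc 5
    positivity
  have h03 := mul_pos (hc 3) (hc 0)
  have h14 := mul_pos (hc 4) (hc 1)
  have h25 := mul_pos (hc 5) (hc 2)
  unfold Central
  simp only [concurrency_smul_vectors, br_smul₁, br_smul₂, ← mul_assoc]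
  rcases h with ⟨h0, h1, h2, h3⟩ | ⟨h0, h1, h2, h3⟩
  · exact Or.inl ⟨mul_pos hp h0, mul_pos h03 h1, mul_neg_of_pos_of_neg h14 h2, mul_pos h25 h3⟩
  · exact Or.inr ⟨mul_neg_of_pos_of_neg hp h0, mul_neg_of_pos_of_neg h03 h1, mul_pos h14 h2,
      mul_neg_of_pos_of_neg h25 h3⟩

variable {φ : (Fin 3 → ℝ) →ₗ[ℝ] ℝ}

theorem IsConvexHexagon.crossing_pos (h : IsConvexHexagon φ u) :
    0 < φ (crossing₀₁ u) ∧ 0 < φ (crossing₁₂ u) ∧ 0 < φ (crossing₂₀ u) := by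
  have p : ∀ i j k : Fin 6, i < j → j < k → 0 < br (u i) (u j) (u k) := h.convex
  simp only [crossing₀₁, crossing₁₂, crossing₂₀, map_add, map_smul, h.chart, smul_eq_mul, mul_one]
  exact ⟨add_pos (p 0 3 4 (by decide) (by decide)) (p 0 1 3 (by decide) (by decide)),
    add_pos (p 1 4 5 (by decide) (by decide)) (p 1 2 4 (by decide) (by decide)),
    add_pos (p 2 3 5 (by decide) (by decide)) (p 0 2 5 (by decide) (by decide))⟩

theorem Positive.mem_span_diagonals (hu : Positive u) (x : Fin 3 → ℝ) :
    (x ∈ Submodule.span ℝ {u 0, u 3} ↔ br (u 0) (u 3) x = 0) ∧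
    (x ∈ Submodule.span ℝ {u 1, u 4} ↔ br (u 1) (u 4) x = 0) ∧
    (x ∈ Submodule.span ℝ {u 2, u 5} ↔ br (u 2) (u 5) x = 0) := by
  have g : ∀ i j k : Fin 6, i ≠ j → i ≠ k → j ≠ k → br (u i) (u j) (u k) ≠ 0 := hu.generic
  exact ⟨mem_span_pair_iff_br (g 0 3 1 (by decide) (by decide) (by decide)),
    mem_span_pair_iff_br (g 1 4 0 (by decide) (by decide) (by decide)),
    mem_span_pair_iff_br (g 2 5 0 (by decide) (by decide) (by decide))⟩

theorem exists_central_of_mem_diagonalTriangle (h : IsConvexHexagon φ u)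
    (hD : concurrency u ≠ 0) {x : RP2} (hx : x ∈ diagonalTriangle φ u) :
    ∃ (v : Fin 3 → ℝ) (hv : v ≠ 0), x = Projectivization.mk ℝ v hv ∧ Central u v := by
  obtain ⟨X, Y, Z, hX, hY, hZ, ⟨hX0, hX1⟩, ⟨hY1, hY2⟩, ⟨hZ2, hZ0⟩, a, b, c, ha, hb, hc, hne, rfl⟩ := hx
  have hu := h.positive
  have h0 := (hu.mem_span_diagonals X).1.1 hX0
  have h1 := (hu.mem_span_diagonals X).2.1.1 hX1
  have h2 := (hu.mem_span_diagonals Y).2.1.1 hY1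
  have h3 := (hu.mem_span_diagonals Y).2.2.1 hY2
  have h4 := (hu.mem_span_diagonals Z).2.2.1 hZ2
  have h5 := (hu.mem_span_diagonals Z).1.1 hZ0
  have eX := congrArg φ (concurrency_smul u X)
  have eY := congrArg φ (concurrency_smul u Y)
  have eZ := congrArg φ (concurrency_smul u Z)
  rw [h0, h1] at eX
  rw [h2, h3] at eY
  rw [h4, h5] at eZ
  simp only [map_add, map_sub, map_smul, hX, hY, hZ, smul_eq_mul, zero_mul, sub_zero, zero_add,
    add_zero, mul_one, zero_sub] at eX eY eZ
  obtain ⟨p01, p12, p20⟩ := h.crossing_pos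
  refine ⟨_, hne, rfl, ?_⟩
  unfold Central
  simp only [br_add₃, br_smul₃, h0, h1, h2, h3, h4, h5, mul_zero, zero_add, add_zero]
  rcases hD.lt_or_gt with hD | hD
  · right
    refine ⟨hD, mul_neg_of_pos_of_neg hb ?_, mul_pos hc ?_, mul_neg_of_pos_of_neg ha ?_⟩
    · exact neg_of_mul_neg_left (by linarith) p12.le
    · exact pos_of_mul_pos_left (a := br (u 1) (u 4) Z) (by linarith) p20.le
    · exact neg_of_mul_neg_left (by linarith) p01.le
  · left
    refine ⟨hD, mul_pos hb ?_, mul_neg_of_pos_of_neg hc ?_, mul_pos ha ?_⟩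
    · exact pos_of_mul_pos_left (by linarith) p12.le
    · exact neg_of_mul_neg_left (a := br (u 1) (u 4) Z) (by linarith) p20.le
    · exact pos_of_mul_pos_left (by linarith) p01.le

theorem Central.mem_diagonalTriangle (hc : Central u v) (h : IsConvexHexagon φ u) :
    Projectivization.mk ℝ v hc.ne_zero ∈ diagonalTriangle φ u := by
  have hu := h.positive
  obtain ⟨p01, p12, p20⟩ := h.crossing_pos
  have hD := hc.concurrency_ne_zero
  have hv : (br (u 2) (u 5) v * φ (crossing₀₁ u) / concurrency u) •
        ((φ (crossing₀₁ u))⁻¹ • crossing₀₁ u) +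
      (br (u 0) (u 3) v * φ (crossing₁₂ u) / concurrency u) •
        ((φ (crossing₁₂ u))⁻¹ • crossing₁₂ u) +
      (-br (u 1) (u 4) v * φ (crossing₂₀ u) / concurrency u) •
        ((φ (crossing₂₀ u))⁻¹ • crossing₂₀ u) = v := by
    have e := concurrency_smul u v
    refine smul_right_injective _ hD ?_
    simp only [smul_add, smul_smul]
    rw [e, sub_eq_add_neg, ← neg_smul]
    have e1 : ∀ x y : ℝ, y ≠ 0 → concurrency u * (x * y / concurrency u * y⁻¹) = x := by
      intro x y hy
      field_simp
    rw [e1 _ _ p01.ne', e1 _ _ p12.ne', e1 _ _ p20.ne']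
    abel
  have k01 : br (u 0) (u 3) (crossing₀₁ u) = 0 ∧ br (u 1) (u 4) (crossing₀₁ u) = 0 := by
    rw [crossing₀₁]
    simp only [br_eq, Pi.add_apply, Pi.smul_apply, smul_eq_mul]
    constructor <;> ring
  have k12 : br (u 1) (u 4) (crossing₁₂ u) = 0 ∧ br (u 2) (u 5) (crossing₁₂ u) = 0 := by
    rw [crossing₁₂]
    simp only [br_eq, Pi.add_apply, Pi.smul_apply, smul_eq_mul]
    constructor <;> ring
  have k20 : br (u 2) (u 5) (crossing₂₀ u) = 0 ∧ br (u 0) (u 3) (crossing₂₀ u) = 0 := by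
    rw [crossing₂₀]
    simp only [br_eq, Pi.add_apply, Pi.smul_apply, smul_eq_mul]
    constructor <;> ring
  have hφ : ∀ w, 0 < φ w → φ ((φ w)⁻¹ • w) = 1 := fun w hw => by
    rw [map_smul, smul_eq_mul, inv_mul_cancel₀ hw.ne']
  refine ⟨_, _, _, hφ _ p01, hφ _ p12, hφ _ p20,
    ⟨Submodule.smul_mem _ _ ((hu.mem_span_diagonals _).1.2 k01.1),
      Submodule.smul_mem _ _ ((hu.mem_span_diagonals _).2.1.2 k01.2)⟩,
    ⟨Submodule.smul_mem _ _ ((hu.mem_span_diagonals _).2.1.2 k12.1),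
      Submodule.smul_mem _ _ ((hu.mem_span_diagonals _).2.2.2 k12.2)⟩,
    ⟨Submodule.smul_mem _ _ ((hu.mem_span_diagonals _).2.2.2 k20.1),
      Submodule.smul_mem _ _ ((hu.mem_span_diagonals _).1.2 k20.2)⟩,
    br (u 2) (u 5) v * φ (crossing₀₁ u) / concurrency u,
    br (u 0) (u 3) v * φ (crossing₁₂ u) / concurrency u,
    -br (u 1) (u 4) v * φ (crossing₂₀ u) / concurrency u, ?_, ?_, ?_, ?_, ?_⟩
  · rcases hc with ⟨h0, h1, h2, h3⟩ | ⟨h0, h1, h2, h3⟩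
    · positivity
    · exact div_pos_of_neg_of_neg (mul_neg_of_neg_of_pos h3 p01) h0
  · rcases hc with ⟨h0, h1, h2, h3⟩ | ⟨h0, h1, h2, h3⟩
    · positivity
    · exact div_pos_of_neg_of_neg (mul_neg_of_neg_of_pos h1 p12) h0
  · rcases hc with ⟨h0, h1, h2, h3⟩ | ⟨h0, h1, h2, h3⟩
    · exact div_pos (mul_pos (neg_pos.2 h2) p20) h0
    · exact div_pos_of_neg_of_neg (mul_neg_of_neg_of_pos (neg_neg_iff_pos.2 h2) p20) h0
  · rw [hv]; exact hc.ne_zero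
  · simp only [hv]

end

/-! ### Configurations of a hexagon and a point of its central triangle -/

namespace Configuration

/-- The configuration `P` consists of the vertices of the positive hexagon `u`, which do not lie on
a conic, and of a point `[v]` of the central triangle. -/
def IsHexagonWithCenter (P : Configuration 7) (u : Fin 6 → Fin 3 → ℝ) (v : Fin 3 → ℝ) : Prop :=
  Represents (Fin.snoc (α := fun _ => Fin 3 → ℝ) u v : Fin 7 → Fin 3 → ℝ) P.points ∧ Positive u ∧
    conicity u ≠ 0 ∧ Central u v

theorem mem_points_erase {n : ℕ} {P : Configuration (n + 1)} {p : {x // x ∈ P.points}} {x : RP2} :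
    x ∈ (P.erase p).points ↔ x ≠ p.1 ∧ x ∈ P.points := by
  classical
  exact Finset.mem_erase

end Configuration

section

variable {n : ℕ} {P : Configuration (n + 1)} {p : {x // x ∈ P.points}}

theorem Represents.snoc {u : Fin n → Fin 3 → ℝ} {v : Fin 3 → ℝ}
    (h : Represents u (P.erase p).points) (hv : v ≠ 0) (hp : p.1 = Projectivization.mk ℝ v hv) :
    Represents (Fin.snoc (α := fun _ => Fin 3 → ℝ) u v : Fin (n + 1) → Fin 3 → ℝ) P.points := by
  have h0 : ∀ i, (Fin.snoc (α := fun _ => Fin 3 → ℝ) u v : Fin (n + 1) → Fin 3 → ℝ) i ≠ 0 := by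
    intro i
    induction i using Fin.lastCases with
    | last => rwa [Fin.snoc_last]
    | cast i => rw [Fin.snoc_castSucc]; exact h.1 i
  refine ⟨h0, fun x => ?_⟩
  constructor
  · intro hx
    by_cases hxp : x = p.1
    · refine ⟨Fin.last n, h0 _, ?_⟩
      rw [hxp, hp]
      simp only [Fin.snoc_last]
    · obtain ⟨i, hi, rfl⟩ := (h.2 x).1 (Configuration.mem_points_erase.2 ⟨hxp, hx⟩)
      refine ⟨i.castSucc, h0 _, ?_⟩
      simp only [Fin.snoc_castSucc]
  · rintro ⟨i, hi, rfl⟩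
    induction i using Fin.lastCases with
    | last => simp only [Fin.snoc_last]; exact hp ▸ p.2
    | cast i =>
      simp only [Fin.snoc_castSucc]
      exact (Configuration.mem_points_erase.1 ((h.2 _).2 ⟨i, h.1 i, rfl⟩)).2

/-- Removing the point with number `i` amounts to removing the vector with number `i`. -/
theorem Represents.erase {w : Fin (n + 1) → Fin 3 → ℝ} (h : Represents w P.points)
    {w' : Fin n → Fin 3 → ℝ} {σ : Fin n → Fin (n + 1)} {i : Fin (n + 1)}
    (hσ : ∀ j, j ≠ i ↔ ∃ k, σ k = j) (hw : ∀ k, w' k = w (σ k)) :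
    Represents w' (P.erase (h.equiv i)).points := by
  have h0 : ∀ k, w' k ≠ 0 := fun k => by rw [hw]; exact h.1 _
  refine ⟨h0, fun x => ?_⟩
  rw [Configuration.mem_points_erase, h.coe_equiv]
  constructor
  · rintro ⟨hne, hx⟩
    obtain ⟨j, hj, rfl⟩ := (h.2 x).1 hx
    obtain ⟨k, rfl⟩ := (hσ j).1 (by rintro rfl; exact hne rfl)
    exact ⟨k, h0 k, by simp only [hw]⟩
  · rintro ⟨k, hk, rfl⟩
    simp only [hw]
    refine ⟨fun he => ?_, h.mk_mem _⟩
    have : h.equiv (σ k) = h.equiv i := Subtype.ext he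
    exact (hσ _).2 ⟨k, rfl⟩ (h.equiv.injective this)

end

section

variable {P : Configuration 7} {u : Fin 6 → Fin 3 → ℝ} {v : Fin 3 → ℝ}

theorem Represents.erase_last
    (h : Represents (Fin.snoc (α := fun _ => Fin 3 → ℝ) u v : Fin 7 → Fin 3 → ℝ) P.points) :
    Represents u (P.erase (h.equiv (Fin.last 6))).points :=
  h.erase (σ := Fin.castSucc) (fun _ => Fin.exists_castSucc_eq.symm) fun k => by
    rw [Fin.snoc_castSucc]

/-- The vertices of `subPentagon u k` are those of `u` except for the one with number `5 + k`. -/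
theorem Represents.erase_castSucc
    (h : Represents (Fin.snoc (α := fun _ => Fin 3 → ℝ) u v : Fin 7 → Fin 3 → ℝ) P.points)
    (k : Fin 6) :
    Represents (pentCons (subPentagon u k) v) (P.erase (h.equiv (5 + k).castSucc)).points := by
  refine h.erase (σ := Fin.lastCases (Fin.last 6) fun i : Fin 5 => (i.castSucc + k).castSucc) ?_ ?_
  · revert k
    decide
  · intro i
    induction i using Fin.lastCases with
    | last =>
      rw [Fin.lastCases_last, Fin.snoc_last]
      exact pentCons_last _ _
    | cast i => rw [Fin.lastCases_castSucc, Fin.snoc_castSucc, pentCons_castSucc, subPentagon]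

theorem exists_add_castSucc_or_last (i : Fin 7) :
    i = Fin.last 6 ∨ ∃ k : Fin 6, i = (5 + k).castSucc := by
  revert i; decide

theorem Configuration.LC6_disjoint {P : Configuration 6} {i j : ℕ}
    (hi : P ∈ Configuration.LC6 i) (hj : P ∈ Configuration.LC6 j) : i = j := hi.2.symm.trans hj.2

/-- A point of the central triangle does not lie on a conic through five vertices. -/
theorem Central.conicity_ne_zero (hu : Positive u) (h : Central u v) (k : Fin 6) :
    conicity (pentCons (subPentagon u k) v) ≠ 0 := by
  have main : ∀ {u : Fin 6 → Fin 3 → ℝ}, Positive u → Central u v →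
      conicity (pentCons (subPentagon u 0) v) < 0 := by
    intro u hu h
    have p : ∀ i j k : Fin 6, i < j → j < k → 0 < br (u i) (u j) (u k) := hu
    have h01 : 0 < br (u 0) (u 1) v := h.br_succ_pos hu 0
    have h34 : 0 < br (u 3) (u 4) v := h.br_succ_pos hu 3
    have h13 : 0 < br (u 1) (u 3) v := h.br_add_two_pos hu 1
    have h40 : 0 < br (u 4) (u 0) v := h.br_add_two_pos hu 4
    have h012 := p 0 1 2 (by decide) (by decide)
    have h234 := p 2 3 4 (by decide) (by decide)
    have h123 := p 1 2 3 (by decide) (by decide)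
    have h024 := p 0 2 4 (by decide) (by decide)
    have hw : ∀ i : Fin 5, pentCons (subPentagon u 0) v i.castSucc = u i.castSucc := fun i => by
      rw [pentCons_castSucc, subPentagon, add_zero]
    have hw0 : pentCons (subPentagon u 0) v 0 = u 0 := hw 0
    have hw1 : pentCons (subPentagon u 0) v 1 = u 1 := hw 1
    have hw2 : pentCons (subPentagon u 0) v 2 = u 2 := hw 2
    have hw3 : pentCons (subPentagon u 0) v 3 = u 3 := hw 3
    have hw4 : pentCons (subPentagon u 0) v 4 = u 4 := hw 4
    rw [conicity, hw0, hw1, hw2, hw3, hw4, pentCons_last, br_swap₂₃ (u 4) (u 0) v,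
      br_cycle v (u 0) (u 1)]
    have e1 : 0 < br (u 0) (u 1) (u 2) * br (u 2) (u 3) (u 4) * br (u 4) (u 0) v *
        br (u 1) (u 3) v := by positivity
    have e2 : 0 < br (u 1) (u 2) (u 3) * br (u 3) (u 4) v * br (u 0) (u 1) v *
        br (u 0) (u 2) (u 4) := by positivity
    linarith
  have := (main (hu.add k) (h.add k)).ne
  rwa [show subPentagon (fun i => u (i + k)) 0 = subPentagon u k from
    funext fun i => by simp [subPentagon]] at this

end

namespace Configuration

section

variable {P : Configuration 7} {u : Fin 6 → Fin 3 → ℝ} {v : Fin 3 → ℝ}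

theorem IsHexagonWithCenter.generic (h : P.IsHexagonWithCenter u v) :
    Generic (Fin.snoc (α := fun _ => Fin 3 → ℝ) u v : Fin 7 → Fin 3 → ℝ) :=
  generic_snoc h.2.1.generic fun _ _ hij => h.2.2.2.br_ne_zero h.2.1 hij

theorem exists_erase_eq {n : ℕ} {P : Configuration (n + 1)} {t : Finset RP2} (ht : t ⊆ P.points)
    (hcard : t.card = n) : ∃ p, (P.erase p).points = t := by
  classical
  have hP : P.points.card = n + 1 := P.2
  obtain ⟨x, hx, hxt⟩ := Finset.exists_mem_notMem_of_card_lt_card (s := t) (t := P.points) (by omega)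
  refine ⟨⟨x, hx⟩, Eq.symm (Finset.eq_of_subset_of_card_le (fun y hy => ?_) ?_)⟩
  · exact mem_points_erase.2 ⟨fun h => hxt (show x ∈ t from (show y = x from h) ▸ hy), ht hy⟩
  · rw [hcard]; exact (P.erase ⟨x, hx⟩).2.le

theorem IsHexagonWithCenter.isTypical (h : P.IsHexagonWithCenter u v) : P.IsTypical := by
  refine ⟨h.1.isSimple_iff.2 h.generic, fun t ht hcard => ?_⟩
  obtain ⟨p, rfl⟩ := exists_erase_eq ht hcard
  obtain ⟨i, rfl⟩ := h.1.equiv.surjective p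
  rcases exists_add_castSucc_or_last i with rfl | ⟨k, rfl⟩
  · exact h.1.erase_last.not_coconic_of_conicity_ne_zero h.2.1.generic h.2.2.1
  · exact (h.1.erase_castSucc k).not_coconic_of_conicity_ne_zero
      (generic_pentCons_subPentagon h.2.1 (fun _ _ hij => h.2.2.2.br_ne_zero h.2.1 hij) k)
      (h.2.2.2.conicity_ne_zero h.2.1 k)

theorem IsHexagonWithCenter.mem_QC7 (h : P.IsHexagonWithCenter u v) : P ∈ QC7 (1, 0, 6, 0) := by
  refine ⟨h.isTypical, ?_⟩
  have h1 : P.erase (h.1.equiv (Fin.last 6)) ∈ LC6 1 := h.1.erase_last.mem_LC6_one h.2.1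
  have h3 : ∀ p, p ≠ h.1.equiv (Fin.last 6) → P.erase p ∈ LC6 3 := by
    intro p hp
    obtain ⟨i, rfl⟩ := h.1.equiv.surjective p
    rcases exists_add_castSucc_or_last i with rfl | ⟨k, rfl⟩
    · exact absurd rfl hp
    · exact ((h.1.erase_castSucc k).mem_LC6_iff 3).2 ⟨generic_pentCons_subPentagon h.2.1
        (fun _ _ hij => h.2.2.2.br_ne_zero h.2.1 hij) k, h.2.2.2.card_eq_three h.2.1 k⟩
  set p₀ := h.1.equiv (Fin.last 6)
  have hall : ∀ p, P.erase p ∈ LC6 1 ∨ P.erase p ∈ LC6 3 := fun p => by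
    by_cases hp : p = p₀
    · exact Or.inl (hp ▸ h1)
    · exact Or.inr (h3 p hp)
  have e1 : P.codeEntry 1 = 1 := by
    rw [codeEntry, Nat.card_eq_one_iff_exists]
    refine ⟨⟨p₀, h1⟩, fun ⟨p, hp⟩ => Subtype.ext ?_⟩
    by_contra hne
    exact absurd (LC6_disjoint hp (h3 p hne)) (by norm_num)
  have e3 : P.codeEntry 3 = 6 := by
    have : {p | P.erase p ∈ LC6 3} = {p₀}ᶜ := by
      ext p
      refine ⟨fun hp he => ?_, fun hp => h3 p hp⟩
      rw [Set.mem_singleton_iff] at he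
      rw [he] at hp
      exact absurd (LC6_disjoint h1 hp) (by norm_num)
    rw [codeEntry]
    change Set.ncard {p | P.erase p ∈ LC6 3} = 6
    rw [this, Set.ncard_compl, Set.ncard_singleton, Nat.card_eq_fintype_card, Fintype.card_coe,
      show P.points.card = 7 from P.2]
  have e0 : ∀ k, k ≠ 1 → k ≠ 3 → P.codeEntry k = 0 := by
    intro k hk1 hk3
    rw [codeEntry, Nat.card_eq_zero]
    refine Or.inl ⟨fun ⟨p, hp⟩ => ?_⟩
    rcases hall p with h' | h'
    · exact hk1 (LC6_disjoint hp h')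
    · exact hk3 (LC6_disjoint hp h')
  rw [derivativeCode, e1, e3, e0 2 (by norm_num) (by norm_num), e0 6 (by norm_num) (by norm_num)]

theorem exists_isHexagonWithCenter (hP : P ∈ QC7 (1, 0, 6, 0)) :
    ∃ u v, P.IsHexagonWithCenter u v := by
  obtain ⟨htyp, hcode⟩ := hP
  simp only [derivativeCode, Prod.mk.injEq] at hcode
  obtain ⟨e1, -, e3, -⟩ := hcode
  obtain ⟨⟨p₀, h1⟩, -⟩ := Nat.card_eq_one_iff_exists.1 e1
  have h3 : ∀ p, p ≠ p₀ → P.erase p ∈ LC6 3 := by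
    have hsub : {p | P.erase p ∈ LC6 3} ⊆ {p₀}ᶜ := by
      intro p hp he
      rw [Set.mem_singleton_iff] at he
      rw [he] at hp
      exact absurd (LC6_disjoint h1 hp) (by norm_num)
    have hcard : Set.ncard {p | P.erase p ∈ LC6 3} = 6 := e3
    have := Set.eq_of_subset_of_ncard_le hsub (by
      rw [hcard, Set.ncard_compl, Set.ncard_singleton, Nat.card_eq_fintype_card, Fintype.card_coe,
        show P.points.card = 7 from P.2])
    exact fun p hp => (this.symm ▸ hp : p ∈ {p | P.erase p ∈ LC6 3})
  obtain ⟨u, hrep, hu⟩ := exists_positive_of_mem_LC6_one h1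
  obtain ⟨v, hv, hpv⟩ : ∃ (v : Fin 3 → ℝ) (hv : v ≠ 0), p₀.1 = Projectivization.mk ℝ v hv :=
    ⟨p₀.1.rep, Projectivization.rep_nonzero _, (Projectivization.mk_rep _).symm⟩
  have h7 := hrep.snoc hv hpv
  have hgen := h7.isSimple_iff.1 htyp.1
  have hbr : ∀ i j, i ≠ j → br (u i) (u j) v ≠ 0 := by
    intro i j hij
    have := hgen i.castSucc j.castSucc (Fin.last 6) (by simpa using hij)
      (Fin.castSucc_lt_last _).ne (Fin.castSucc_lt_last _).ne
    rwa [Fin.snoc_castSucc, Fin.snoc_castSucc, Fin.snoc_last] at this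
  have hlast : h7.equiv (Fin.last 6) = p₀ := by
    refine Subtype.ext ?_
    rw [h7.coe_equiv, hpv]
    simp only [Fin.snoc_last]
  have hcard : ∀ k, Nat.card (signGraph (pentCons (subPentagon u k) v)).ConnectedComponent = 3 := by
    intro k
    refine (((h7.erase_castSucc k).mem_LC6_iff 3).1 (h3 _ fun he => ?_)).2
    exact (Fin.castSucc_lt_last (5 + k)).ne (h7.equiv.injective (he.trans hlast.symm))
  have hcon : conicity u ≠ 0 := fun h0 =>
    htyp.2 _ (fun x hx => (mem_points_erase.1 hx).2) (P.erase p₀).2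
      (hrep.coconic_of_conicity_eq_zero hu.generic h0)
  rcases (central_of_card_eq_three hu hbr hcard).2 with hc | hc
  · exact ⟨u, v, h7, hu, hcon, hc⟩
  · refine ⟨u, -v, hrep.snoc (neg_ne_zero.2 hv) ?_, hu, hcon, hc⟩
    rw [hpv]
    exact (Projectivization.mk_eq_mk_iff' ℝ _ _ _ _).2 ⟨-1, by simp⟩

theorem mem_QC7_iff : P ∈ QC7 (1, 0, 6, 0) ↔ ∃ u v, P.IsHexagonWithCenter u v :=
  ⟨exists_isHexagonWithCenter, fun ⟨_, _, h⟩ => h.mem_QC7⟩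

theorem exists_center_iff : (∃ p : {x // x ∈ P.points},
      P.erase p ∈ nonconcurrentLC61 ∧ p.1 ∈ (P.erase p).centralTriangle) ↔
    ∃ u v, P.IsHexagonWithCenter u v := by
  constructor
  · rintro ⟨p, hp, φ, u, hform, hx⟩
    obtain ⟨u₀, h₀, hu₀, hD₀, -⟩ := mem_nonconcurrentLC61_iff.1 hp
    have h := hform.represents
    have hu := hform.1.positive
    -- The numeration used for the central triangle need not be the one with known `concurrency`.
    have hD : concurrency u ≠ 0 := fun h0 => hD₀ (hu₀.concurrentDiagonals_iff.1
      (h.concurrentDiagonals hu h₀ hu₀ (hu.concurrentDiagonals_iff.2 h0)))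
    obtain ⟨v, hv, hpv, hc⟩ := exists_central_of_mem_diagonalTriangle hform.1 hD hx
    exact ⟨u, v, h.snoc hv hpv, hu, (h.isTypical_iff hu).1 hp.2.1, hc⟩
  · rintro ⟨u, v, h, hu, hC, hc⟩
    refine ⟨h.equiv (Fin.last 6), mem_nonconcurrentLC61_iff.2
      ⟨u, h.erase_last, hu, hc.concurrency_ne_zero, hC⟩, ?_⟩
    obtain ⟨φ, c, hcpos, hφ⟩ := hu.exists_isConvexHexagon
    refine ⟨φ, _, (h.erase_last.smul fun i => (hcpos i).ne').formsHexagon hφ, ?_⟩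
    rw [h.coe_equiv]
    simp only [Fin.snoc_last]
    exact (hc.smul hcpos).mem_diagonalTriangle hφ

end

end Configuration

/-! ### Reversing and rotating a numeration -/

/-- The hexagon `u` in the opposite order; the change of sign of the vectors preserves positivity. -/
def reversedHexagon (u : Fin 6 → Fin 3 → ℝ) : Fin 6 → Fin 3 → ℝ := fun i => -u i.rev

section

variable {u : Fin 6 → Fin 3 → ℝ} {v : Fin 3 → ℝ}

theorem Positive.reverse (hu : Positive u) : Positive (reversedHexagon u) := by
  intro i j k hij hjk
  rw [reversedHexagon, reversedHexagon, reversedHexagon, br_neg, ← br_swap₁₃]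
  exact hu _ _ _ (Fin.rev_lt_rev.2 hjk) (Fin.rev_lt_rev.2 hij)

theorem concurrency_reverse (u : Fin 6 → Fin 3 → ℝ) : concurrency (reversedHexagon u) = concurrency u := by
  simp only [concurrency, reversedHexagon, show Fin.rev (0 : Fin 6) = 5 from rfl,
    show Fin.rev (1 : Fin 6) = 4 from rfl, show Fin.rev (2 : Fin 6) = 3 from rfl,
    show Fin.rev (3 : Fin 6) = 2 from rfl, show Fin.rev (4 : Fin 6) = 1 from rfl,
    show Fin.rev (5 : Fin 6) = 0 from rfl, br_neg]
  simp only [br_eq]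
  ring

theorem conicity_reverse (u : Fin 6 → Fin 3 → ℝ) : conicity (reversedHexagon u) = -conicity u := by
  simp only [conicity, reversedHexagon, show Fin.rev (0 : Fin 6) = 5 from rfl,
    show Fin.rev (1 : Fin 6) = 4 from rfl, show Fin.rev (2 : Fin 6) = 3 from rfl,
    show Fin.rev (3 : Fin 6) = 2 from rfl, show Fin.rev (4 : Fin 6) = 1 from rfl,
    show Fin.rev (5 : Fin 6) = 0 from rfl, br_neg]
  rw [br_swap₁₃ (u 3) (u 4) (u 5), br_swap₁₃ (u 1) (u 2) (u 3), br_swap₁₃ (u 5) (u 0) (u 1),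
    br_swap₁₃ (u 0) (u 2) (u 4), br_swap₁₃ (u 2) (u 3) (u 4), br_swap₁₃ (u 0) (u 1) (u 2),
    br_swap₁₃ (u 4) (u 5) (u 0), br_swap₁₃ (u 1) (u 3) (u 5)]
  ring

theorem Central.reverse (h : Central u v) : Central (reversedHexagon u) (-v) := by
  unfold Central
  rw [concurrency_reverse]
  simp only [reversedHexagon, show Fin.rev (0 : Fin 6) = 5 from rfl,
    show Fin.rev (1 : Fin 6) = 4 from rfl, show Fin.rev (2 : Fin 6) = 3 from rfl,
    show Fin.rev (3 : Fin 6) = 2 from rfl, show Fin.rev (4 : Fin 6) = 1 from rfl,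
    show Fin.rev (5 : Fin 6) = 0 from rfl, br_neg]
  rw [br_swap₁₂ (u 2) (u 5), br_swap₁₂ (u 1) (u 4), br_swap₁₂ (u 0) (u 3)]
  simp only [neg_neg]
  exact h.imp (fun ⟨h0, h1, h2, h3⟩ => ⟨h0, h3, h2, h1⟩) fun ⟨h0, h1, h2, h3⟩ => ⟨h0, h3, h2, h1⟩

theorem Represents.rotate {s : Finset RP2} (h : Represents u s) :
    Represents (fun i => u (i + 1)) s :=
  h.reindex (σ := fun i => i + 1) (Equiv.addRight (1 : Fin 6)).surjective
    (c := fun _ => 1) (fun _ => one_ne_zero) fun _ => (one_smul _ _).symm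

theorem Represents.reverse {s : Finset RP2} (h : Represents u s) : Represents (reversedHexagon u) s :=
  h.reindex (σ := Fin.rev) Fin.rev_surjective (c := fun _ => -1) (fun _ => by norm_num)
    fun _ => (neg_one_smul _ _).symm

/-- A hexagon with a point can be rotated and reversed so that `concurrency` and `conicity` become
positive: a rotation changes both signs, the reversal only that of `conicity`. -/
theorem exists_concurrency_pos_conicity_pos {p : (Fin 6 → Fin 3 → ℝ) → (Fin 3 → ℝ) → Prop}
    (hrot : ∀ u v, p u v → p (fun i => u (i + 1)) v) (hrev : ∀ u v, p u v → p (reversedHexagon u) (-v))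
    (hD : concurrency u ≠ 0) (hC : conicity u ≠ 0) (h : p u v) :
    ∃ u v, p u v ∧ 0 < concurrency u ∧ 0 < conicity u := by
  have aux : ∀ u v, p u v → concurrency u ≠ 0 → 0 < concurrency u * conicity u →
      ∃ u v, p u v ∧ 0 < concurrency u ∧ 0 < conicity u := by
    intro u v h hD hDC
    rcases hD.lt_or_gt with hD | hD
    · refine ⟨_, _, hrot u v h, ?_⟩
      rw [concurrency_rotate, conicity_rotate]
      exact ⟨neg_pos.2 hD, neg_pos.2 (neg_of_mul_pos_right hDC hD.le)⟩
    · exact ⟨u, v, h, hD, pos_of_mul_pos_right hDC hD.le⟩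
  rcases (mul_ne_zero hD hC).lt_or_gt with hDC | hDC
  · refine aux _ _ (hrev u v h) (by rwa [concurrency_reverse]) ?_
    rw [concurrency_reverse, conicity_reverse]
    linarith
  · exact aux u v h hD hDC

theorem Configuration.IsHexagonWithCenter.exists_pos {P : Configuration 7}
    (h : P.IsHexagonWithCenter u v) :
    ∃ u v, P.IsHexagonWithCenter u v ∧ 0 < concurrency u ∧ 0 < conicity u := by
  refine exists_concurrency_pos_conicity_pos (p := P.IsHexagonWithCenter) ?_ ?_
    h.2.2.2.concurrency_ne_zero h.2.2.1 h
  · rintro u v ⟨h, hu, hC, hv⟩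
    refine ⟨h.erase_last.rotate.snoc hv.ne_zero ?_, hu.rotate, ?_, hv.rotate⟩
    · simp only [h.coe_equiv, Fin.snoc_last]
    · rwa [conicity_rotate, neg_ne_zero]
  · rintro u v ⟨h, hu, hC, hv⟩
    refine ⟨h.erase_last.reverse.snoc (neg_ne_zero.2 hv.ne_zero) ?_, hu.reverse, ?_, hv.reverse⟩
    · simp only [h.coe_equiv, Fin.snoc_last]
      exact (Projectivization.mk_eq_mk_iff' ℝ _ _ _ _).2 ⟨-1, by simp⟩
    · rwa [conicity_reverse, neg_ne_zero]

theorem exists_represents_pos {P : Configuration 6} (hP : P ∈ Configuration.nonconcurrentLC61) :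
    ∃ u, (Represents u P.points ∧ Positive u) ∧ 0 < concurrency u ∧ 0 < conicity u := by
  obtain ⟨u, h, hu, hD, hC⟩ := mem_nonconcurrentLC61_iff.1 hP
  obtain ⟨u, -, h⟩ := exists_concurrency_pos_conicity_pos (v := 0)
    (p := fun u _ => Represents u P.points ∧ Positive u)
    (fun _ _ h => ⟨h.1.rotate, h.2.rotate⟩) (fun _ _ h => ⟨h.1.reverse, h.2.reverse⟩) hD hC ⟨h, hu⟩
  exact ⟨u, h⟩

end

/-! ### A normal form of hexagons -/

/-- The normal form of a positive hexagon, up to positive factors and a linear map: the vectors with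
even numbers are the standard basis, and one entry of each of the others is `-1`. -/
def normalHexagon (θ : Fin 6 → ℝ) : Fin 6 → Fin 3 → ℝ :=
  ![![1, 0, 0], ![θ 0, θ 1, -1], ![0, 1, 0], ![-1, θ 2, θ 3], ![0, 0, 1], ![θ 4, -1, θ 5]]

/-- The parameters of the positive hexagons in normal form for which `concurrency` and `conicity`
are positive; these are the last two conditions. The products in the other conditions are those in
the brackets `[1 2 3]`, `[0 1 5]`, `[3 4 5]`. -/
def normalRegion : Set (Fin 6 → ℝ) :=
  {θ | (∀ i, 0 < θ i) ∧ 1 < θ 0 * θ 3 ∧ 1 < θ 1 * θ 5 ∧ 1 < θ 2 * θ 4 ∧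
    θ 1 * θ 3 * θ 4 < θ 0 * θ 2 * θ 5 ∧
    0 < θ 0 * θ 2 * θ 5 + θ 1 * θ 3 * θ 4 - (θ 0 * θ 3) * (θ 1 * θ 5) * (θ 2 * θ 4) +
      (θ 0 * θ 3) * (θ 1 * θ 5) + (θ 1 * θ 5) * (θ 2 * θ 4) + (θ 2 * θ 4) * (θ 0 * θ 3)}

theorem concurrency_normalHexagon (θ : Fin 6 → ℝ) :
    concurrency (normalHexagon θ) = θ 0 * θ 2 * θ 5 - θ 1 * θ 3 * θ 4 := by
  simp only [concurrency, br_eq, normalHexagon, Matrix.cons_val]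
  ring

theorem conicity_normalHexagon (θ : Fin 6 → ℝ) : conicity (normalHexagon θ) =
    θ 0 * θ 2 * θ 5 + θ 1 * θ 3 * θ 4 - (θ 0 * θ 3) * (θ 1 * θ 5) * (θ 2 * θ 4) +
      (θ 0 * θ 3) * (θ 1 * θ 5) + (θ 1 * θ 5) * (θ 2 * θ 4) + (θ 2 * θ 4) * (θ 0 * θ 3) := by
  simp only [conicity, br_eq, normalHexagon, Matrix.cons_val]
  ring

theorem concurrency_mulVec (A : Matrix (Fin 3) (Fin 3) ℝ) (u : Fin 6 → Fin 3 → ℝ) :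
    concurrency (fun i => A.mulVec (u i)) = A.det ^ 2 * concurrency u := by
  simp only [concurrency, br_mulVec]
  ring

theorem conicity_mulVec (A : Matrix (Fin 3) (Fin 3) ℝ) (u : Fin 6 → Fin 3 → ℝ) :
    conicity (fun i => A.mulVec (u i)) = A.det ^ 4 * conicity u := by
  simp only [conicity, br_mulVec]
  ring

theorem Positive.mulVec {n : ℕ} {A : Matrix (Fin 3) (Fin 3) ℝ} (hA : 0 < A.det)
    {u : Fin n → Fin 3 → ℝ} (hu : Positive u) : Positive fun i => A.mulVec (u i) :=
  fun i j k hij hjk => by rw [br_mulVec]; exact mul_pos hA (hu i j k hij hjk)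

theorem Positive.of_mulVec {n : ℕ} {A : Matrix (Fin 3) (Fin 3) ℝ} (hA : 0 < A.det)
    {u : Fin n → Fin 3 → ℝ} (hu : Positive fun i => A.mulVec (u i)) : Positive u :=
  fun i j k hij hjk => by
    have := hu i j k hij hjk
    rw [br_mulVec] at this
    exact pos_of_mul_pos_right this hA.le

theorem forall_lt_lt_fin_six {p : Fin 6 → Fin 6 → Fin 6 → Prop}
    (h : ∀ x ∈ [(0, 1, 2), (0, 1, 3), (0, 1, 4), (0, 1, 5), (0, 2, 3), (0, 2, 4), (0, 2, 5),
      (0, 3, 4), (0, 3, 5), (0, 4, 5), (1, 2, 3), (1, 2, 4), (1, 2, 5), (1, 3, 4), (1, 3, 5),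
      (1, 4, 5), (2, 3, 4), (2, 3, 5), (2, 4, 5), ((3, 4, 5) : Fin 6 × Fin 6 × Fin 6)],
      p x.1 x.2.1 x.2.2) (i j k : Fin 6) (hij : i < j) (hjk : j < k) : p i j k := by
  refine h (i, j, k) ?_
  revert i j k
  decide

theorem positive_normalHexagon {θ : Fin 6 → ℝ} (h : θ ∈ normalRegion) :
    Positive (normalHexagon θ) := by
  obtain ⟨hθ, h03, h15, h24, -, -⟩ := h
  have h2' : ∀ i j, 0 < θ i * θ j := fun i j => mul_pos (hθ i) (hθ j)
  have h3' : ∀ i j k, 0 < θ i * θ j * θ k := fun i j k => mul_pos (h2' i j) (hθ k)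
  refine forall_lt_lt_fin_six ?_
  simp only [br_eq, normalHexagon, List.forall_mem_cons, Matrix.cons_val]
  refine ⟨?_, ?_, ?_, ?_, ?_, ?_, ?_, ?_, ?_, ?_, ?_, ?_, ?_, ?_, ?_, ?_, ?_, ?_, ?_, ?_, by simp⟩
  all_goals
    linarith [hθ 0, hθ 1, hθ 2, hθ 3, hθ 4, hθ 5, h2' 0 5, h2' 0 2, h2' 2 5, h2' 3 4, h2' 1 4,
      h2' 1 3, h3' 0 2 5, h3' 1 3 4]

theorem Positive.exists_normalHexagon {u : Fin 6 → Fin 3 → ℝ} (hu : Positive u) :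
    ∃ (A : Matrix (Fin 3) (Fin 3) ℝ) (θ : Fin 6 → ℝ) (c : Fin 6 → ℝ), 0 < A.det ∧
      (∀ i, 0 < c i) ∧ (∀ i, 0 < θ i) ∧ ∀ i, c i • u i = A.mulVec (normalHexagon θ i) := by
  have p : ∀ i j k : Fin 6, i < j → j < k → 0 < br (u i) (u j) (u k) := hu
  have p012 := p 0 1 2 (by decide) (by decide)
  have p234 := p 2 3 4 (by decide) (by decide)
  have p045 := p 0 4 5 (by decide) (by decide)
  have p024 := p 0 2 4 (by decide) (by decide)
  refine ⟨(Matrix.of ![u 0, u 2, u 4]).transpose,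
    ![br (u 1) (u 2) (u 4) / br (u 0) (u 1) (u 2), br (u 0) (u 1) (u 4) / br (u 0) (u 1) (u 2),
      br (u 0) (u 3) (u 4) / br (u 2) (u 3) (u 4), br (u 0) (u 2) (u 3) / br (u 2) (u 3) (u 4),
      br (u 2) (u 4) (u 5) / br (u 0) (u 4) (u 5), br (u 0) (u 2) (u 5) / br (u 0) (u 4) (u 5)],
    ![1, br (u 0) (u 2) (u 4) / br (u 0) (u 1) (u 2), 1,
      br (u 0) (u 2) (u 4) / br (u 2) (u 3) (u 4), 1,
      br (u 0) (u 2) (u 4) / br (u 0) (u 4) (u 5)], ?_, ?_, ?_, ?_⟩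
  · rw [Matrix.det_transpose]; exact p024
  · intro i
    fin_cases i
    · exact one_pos
    · exact div_pos p024 p012
    · exact one_pos
    · exact div_pos p024 p234
    · exact one_pos
    · exact div_pos p024 p045
  · intro i
    fin_cases i
    · exact div_pos (p 1 2 4 (by decide) (by decide)) p012
    · exact div_pos (p 0 1 4 (by decide) (by decide)) p012
    · exact div_pos (p 0 3 4 (by decide) (by decide)) p234
    · exact div_pos (p 0 2 3 (by decide) (by decide)) p234
    · exact div_pos (p 2 4 5 (by decide) (by decide)) p045
    · exact div_pos (p 0 2 5 (by decide) (by decide)) p045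
  · have hA : ∀ x y z : ℝ, (Matrix.of ![u 0, u 2, u 4]).transpose.mulVec ![x, y, z] =
        x • u 0 + y • u 2 + z • u 4 := by
      intro x y z
      ext i
      simp [Matrix.mulVec, dotProduct, Fin.sum_univ_three, mul_comm]
    have hc : ∀ i, br (u 0) (u 2) (u 4) • u i = br (u i) (u 2) (u 4) • u 0 +
        br (u 0) (u i) (u 4) • u 2 + br (u 0) (u 2) (u i) • u 4 :=
      fun i => br_cramer (u 0) (u 2) (u 4) (u i)
    have hc' : ∀ i (d : ℝ), (br (u 0) (u 2) (u 4) / d) • u i = (br (u i) (u 2) (u 4) / d) • u 0 +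
        (br (u 0) (u i) (u 4) / d) • u 2 + (br (u 0) (u 2) (u i) / d) • u 4 := by
      intro i d
      simp only [div_eq_inv_mul, mul_smul, hc, smul_add]
    intro i
    fin_cases i
    · exact (by simp : (1 : ℝ) • u 0 = (1 : ℝ) • u 0 + (0 : ℝ) • u 2 + (0 : ℝ) • u 4).trans
        (hA _ _ _).symm
    · refine ((hc' 1 _).trans ?_).trans (hA _ _ _).symm
      rw [br_swap₂₃ (u 0) (u 1) (u 2), neg_div, div_self p012.ne']
      rfl
    · exact (by simp : (1 : ℝ) • u 2 = (0 : ℝ) • u 0 + (1 : ℝ) • u 2 + (0 : ℝ) • u 4).trans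
        (hA _ _ _).symm
    · refine ((hc' 3 _).trans ?_).trans (hA _ _ _).symm
      rw [br_swap₁₂ (u 2) (u 3) (u 4), neg_div, div_self p234.ne']
      rfl
    · exact (by simp : (1 : ℝ) • u 4 = (0 : ℝ) • u 0 + (0 : ℝ) • u 2 + (1 : ℝ) • u 4).trans
        (hA _ _ _).symm
    · refine ((hc' 5 _).trans ?_).trans (hA _ _ _).symm
      rw [br_swap₂₃ (u 0) (u 4) (u 5), neg_div, div_self p045.ne', ← br_cycle (u 5) (u 2) (u 4)]
      rfl

theorem Positive.exists_mem_normalRegion {u : Fin 6 → Fin 3 → ℝ} (hu : Positive u)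
    (hD : 0 < concurrency u) (hC : 0 < conicity u) :
    ∃ (A : Matrix (Fin 3) (Fin 3) ℝ) (θ : Fin 6 → ℝ) (c : Fin 6 → ℝ), 0 < A.det ∧
      (∀ i, 0 < c i) ∧ θ ∈ normalRegion ∧ ∀ i, c i • u i = A.mulVec (normalHexagon θ i) := by
  obtain ⟨A, θ, c, hA, hc, hθ, h⟩ := hu.exists_normalHexagon
  have hfun : (fun i => c i • u i) = fun i => A.mulVec (normalHexagon θ i) := funext h
  have hu' := hu.smul hc
  have hD' := concurrency_smul_vectors c u
  have hC' := conicity_smul_vectors c u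
  rw [hfun] at hu' hD' hC'
  have hN := hu'.of_mulVec hA
  rw [concurrency_mulVec, concurrency_normalHexagon] at hD'
  rw [conicity_mulVec, conicity_normalHexagon] at hC'
  have hp : 0 < c 0 * c 1 * c 2 * c 3 * c 4 * c 5 := by
    have h0 := hc 0
    have h1 := hc 1
    have h2 := hc 2
    have h3 := hc 3
    have h4 := hc 4
    have h5 := hc 5
    positivity
  have k1 := hN 1 2 3 (by decide) (by decide)
  have k2 := hN 0 1 5 (by decide) (by decide)
  have k3 := hN 3 4 5 (by decide) (by decide)
  simp only [br_eq, normalHexagon, Matrix.cons_val] at k1 k2 k3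
  refine ⟨A, θ, c, hA, hc, ⟨hθ, by linarith, by linarith, by linarith, ?_, ?_⟩, h⟩
  · have := pos_of_mul_pos_right (hD' ▸ mul_pos hp hD) (by positivity)
    linarith
  · exact pos_of_mul_pos_right (hC' ▸ mul_pos (pow_pos hp 2) hC) (by positivity)

/-! ### The region of parameters is path-connected -/

/-- In logarithmic coordinates, this part of `normalRegion` is convex. -/
def normalCore : Set (Fin 6 → ℝ) :=
  {θ | (∀ i, 0 < θ i) ∧ 1 < θ 0 * θ 3 ∧ 1 < θ 1 * θ 5 ∧ 1 < θ 2 * θ 4 ∧ θ 1 * θ 3 * θ 4 < 1}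

theorem normalCore_subset : normalCore ⊆ normalRegion := by
  -- With `h = θ 0 * θ 2 * θ 5` and `k = θ 1 * θ 3 * θ 4`, the product `h * k` is that of
  -- `x = θ 0 * θ 3`, `y = θ 1 * θ 5`, `z = θ 2 * θ 4`, and the last condition on `normalRegion` is
  -- `0 < h * (1 - k) + k + x * y + y * z + z * x`.
  rintro θ ⟨hθ, h03, h15, h24, hk⟩
  have hk0 := mul_pos (mul_pos (hθ 1) (hθ 3)) (hθ 4)
  have hh0 := mul_pos (mul_pos (hθ 0) (hθ 2)) (hθ 5)
  have hhk : (θ 0 * θ 2 * θ 5) * (θ 1 * θ 3 * θ 4) = θ 0 * θ 3 * (θ 1 * θ 5) * (θ 2 * θ 4) := by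
    ring
  have hxyz : 1 < θ 0 * θ 3 * (θ 1 * θ 5) * (θ 2 * θ 4) :=
    one_lt_mul_of_lt_of_le (one_lt_mul_of_lt_of_le h03 h15.le) h24.le
  have hh : 1 < θ 0 * θ 2 * θ 5 := by
    by_contra hle
    have := mul_le_one₀ (not_lt.1 hle) hk0.le hk.le
    linarith
  refine ⟨hθ, h03, h15, h24, hk.trans hh, ?_⟩
  have h1 := mul_pos hh0 (sub_pos.2 hk)
  have h2 := mul_pos (one_pos.trans h03) (one_pos.trans h15)
  have h3 := mul_pos (one_pos.trans h15) (one_pos.trans h24)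
  have h4 := mul_pos (one_pos.trans h24) (one_pos.trans h03)
  rw [← hhk]
  linarith

theorem isPathConnected_normalCore : IsPathConnected normalCore := by
  have hconv : Convex ℝ {x : Fin 6 → ℝ | 0 < x 0 + x 3 ∧ 0 < x 1 + x 5 ∧ 0 < x 2 + x 4 ∧
      x 1 + x 3 + x 4 < 0} := by
    rintro x ⟨hx0, hx1, hx2, hx3⟩ y ⟨hy0, hy1, hy2, hy3⟩ a b ha hb hab
    have key : ∀ X Y : ℝ, 0 < X → 0 < Y → 0 < a * X + b * Y := fun X Y hX hY =>
      (convex_Ioi (0 : ℝ)) hX hY ha hb hab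
    simp only [Set.mem_ofPred_eq, Pi.add_apply, Pi.smul_apply, smul_eq_mul]
    have k0 := key _ _ hx0 hy0
    have k1 := key _ _ hx1 hy1
    have k2 := key _ _ hx2 hy2
    have k3 := key _ _ (neg_pos.2 hx3) (neg_pos.2 hy3)
    exact ⟨by linarith, by linarith, by linarith, by linarith⟩
  have hne : ({x : Fin 6 → ℝ | 0 < x 0 + x 3 ∧ 0 < x 1 + x 5 ∧ 0 < x 2 + x 4 ∧
      x 1 + x 3 + x 4 < 0}).Nonempty := by
    refine ⟨![2, -1, 2, -1, -1, 2], ?_⟩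
    simp only [Set.mem_ofPred_eq, Matrix.cons_val]
    norm_num
  have himage := (hconv.isPathConnected hne).image
    (f := fun (x : Fin 6 → ℝ) i => Real.exp (x i)) (by fun_prop)
  convert himage using 1
  ext θ
  constructor
  · rintro ⟨hθ, h03, h15, h24, hk⟩
    have hne := fun i => (hθ i).ne'
    refine ⟨fun i => Real.log (θ i), ?_, funext fun i => Real.exp_log (hθ i)⟩
    simp only [Set.mem_ofPred_eq]
    rw [← Real.log_mul (hne 0) (hne 3), ← Real.log_mul (hne 1) (hne 5),
      ← Real.log_mul (hne 2) (hne 4), ← Real.log_mul (hne 1) (hne 3),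
      ← Real.log_mul (mul_ne_zero (hne 1) (hne 3)) (hne 4)]
    exact ⟨Real.log_pos h03, Real.log_pos h15, Real.log_pos h24,
      Real.log_neg (mul_pos (mul_pos (hθ 1) (hθ 3)) (hθ 4)) hk⟩
  · rintro ⟨x, ⟨h03, h15, h24, hk⟩, rfl⟩
    refine ⟨fun i => Real.exp_pos _, ?_, ?_, ?_, ?_⟩ <;> simp only [← Real.exp_add]
    · exact Real.one_lt_exp_iff.2 h03
    · exact Real.one_lt_exp_iff.2 h15
    · exact Real.one_lt_exp_iff.2 h24
    · simpa using Real.exp_lt_exp.2 hk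

/-- Multiplying `θ 0` by a factor and dividing `θ 3` by it leads from any point of `normalRegion`
to a point of `normalCore`: this leaves `θ 0 * θ 3` unchanged and decreases
`k = θ 1 * θ 3 * θ 4`, and the factor `1 + k` suffices for `k < 1`. -/
theorem exists_joinedIn_normalCore {θ : Fin 6 → ℝ} (h : θ ∈ normalRegion) :
    ∃ θ' ∈ normalCore, JoinedIn normalRegion θ θ' := by
  obtain ⟨hθ, h03, h15, h24, hD, hC⟩ := h
  set k := θ 1 * θ 3 * θ 4 with hk
  have hk0 : 0 < k := mul_pos (mul_pos (hθ 1) (hθ 3)) (hθ 4)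
  have hh0 := mul_pos (mul_pos (hθ 0) (hθ 2)) (hθ 5)
  let f : ℝ → Fin 6 → ℝ := fun x => ![θ 0 * (1 + x * k), θ 1, θ 2, θ 3 / (1 + x * k), θ 4, θ 5]
  have hτ : ∀ x, 0 ≤ x → 1 ≤ 1 + x * k := fun x hx => by
    have := mul_nonneg hx hk0.le
    linarith
  have hpos : ∀ x, 0 ≤ x → ∀ i, 0 < f x i := by
    intro x hx i
    have := one_pos.trans_le (hτ x hx)
    fin_cases i
    · exact mul_pos (hθ 0) this
    · exact hθ 1
    · exact hθ 2
    · exact div_pos (hθ 3) this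
    · exact hθ 4
    · exact hθ 5
  have e03 : ∀ x, 0 ≤ x → f x 0 * f x 3 = θ 0 * θ 3 := fun x hx => by
    have := (one_pos.trans_le (hτ x hx)).ne'
    simp only [f, Matrix.cons_val]
    field_simp
  have ek : ∀ x, f x 1 * f x 3 * f x 4 = k / (1 + x * k) := fun x => by
    simp only [f, Matrix.cons_val, hk]
    ring
  have eh : ∀ x, f x 0 * f x 2 * f x 5 = θ 0 * θ 2 * θ 5 * (1 + x * k) := fun x => by
    simp only [f, Matrix.cons_val]
    ring
  have e15 : ∀ x, f x 1 * f x 5 = θ 1 * θ 5 := fun x => rfl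
  have e24 : ∀ x, f x 2 * f x 4 = θ 2 * θ 4 := fun x => rfl
  refine ⟨f 1, ⟨hpos 1 zero_le_one, ?_, h15, h24, ?_⟩, JoinedIn.ofLine (f := f) ?_ ?_ rfl ?_⟩
  · rwa [e03 1 zero_le_one]
  · rw [ek, div_lt_one (one_pos.trans_le (hτ 1 zero_le_one))]
    linarith
  · refine continuousOn_pi.2 fun i => ?_
    fin_cases i
    · exact Continuous.continuousOn (f := fun x => θ 0 * (1 + x * k)) (by fun_prop)
    · exact continuousOn_const
    · exact continuousOn_const
    · exact continuousOn_const.div (Continuous.continuousOn (by fun_prop))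
        fun x hx => (one_pos.trans_le (hτ x hx.1)).ne'
    · exact continuousOn_const
    · exact continuousOn_const
  · ext i
    fin_cases i <;> simp [f]
  · rintro _ ⟨x, hx, rfl⟩
    have hτx := hτ x hx.1
    have hτ0 := one_pos.trans_le hτx
    have hkx : k / (1 + x * k) ≤ k := div_le_self hk0.le hτx
    refine ⟨hpos x hx.1, ?_, h15, h24, ?_, ?_⟩
    · rwa [e03 x hx.1]
    · rw [ek, eh]
      have := le_mul_of_one_le_right hh0.le hτx
      linarith
    · rw [ek, eh, e03 x hx.1, e15, e24]
      have e : θ 0 * θ 2 * θ 5 * (1 + x * k) + k / (1 + x * k) - (θ 0 * θ 2 * θ 5 + k) =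
          x * k * (θ 0 * θ 2 * θ 5 - k / (1 + x * k)) := by
        field_simp
        ring
      have := mul_nonneg (mul_nonneg hx.1 hk0.le)
        (sub_nonneg.2 (hkx.trans hD.le))
      linarith

theorem isPathConnected_normalRegion : IsPathConnected normalRegion := by
  obtain ⟨θ₀, h₀, hjoin⟩ := isPathConnected_normalCore
  refine ⟨θ₀, normalCore_subset h₀, fun {θ} hθ => ?_⟩
  obtain ⟨θ', h', hj⟩ := exists_joinedIn_normalCore hθ
  exact ((hjoin h').mono normalCore_subset).trans hj.symm

/-! ### The matrices of positive determinant form a path-connected set -/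

section

open Matrix

/-- The diagonal matrices whose entries have given signs form a convex set. -/
theorem joinedIn_diagonal {d e : Fin 3 → ℝ} (hde : ∀ i, 0 < d i * e i)
    (he : 0 < e 0 * e 1 * e 2) :
    JoinedIn {A : Matrix (Fin 3) (Fin 3) ℝ | 0 < A.det} (diagonal d) (diagonal e) := by
  refine JoinedIn.ofLine (f := fun t => diagonal fun i => (1 - t) * d i + t * e i) ?_
    (by simp) (by simp) ?_
  · exact Continuous.continuousOn (by fun_prop)
  · rintro _ ⟨t, ht, rfl⟩
    have key : ∀ i, 0 < ((1 - t) * d i + t * e i) * e i := by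
      intro i
      have h1 := hde i
      have h2 : 0 < e i * e i := mul_self_pos.2 (right_ne_zero_of_mul h1.ne')
      have h3 := (convex_Ioi (0 : ℝ)) h1 h2 (sub_nonneg.2 ht.2) ht.1 (sub_add_cancel _ _)
      simp only [smul_eq_mul, Set.mem_Ioi] at h3
      linarith
    have := mul_pos (mul_pos (key 0) (key 1)) (key 2)
    rw [Set.mem_ofPred_eq, det_diagonal, Fin.prod_univ_three]
    refine pos_of_mul_pos_left (b := e 0 * e 1 * e 2) ?_ he.le
    linarith

theorem joinedIn_one_diagonal {d : Fin 3 → ℝ} (hd : 0 < d 0 * d 1 * d 2) :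
    JoinedIn {A : Matrix (Fin 3) (Fin 3) ℝ | 0 < A.det} 1 (diagonal d) := by
  -- A half-turn joins the identity to a diagonal matrix with two entries `-1`.
  have turn : ∀ f : ℝ → Matrix (Fin 3) (Fin 3) ℝ, Continuous f → f 0 = 1 →
      (∀ t, (f t).det = (1 - 2 * t) ^ 2 + (t * (1 - t)) ^ 2) →
      JoinedIn {A : Matrix (Fin 3) (Fin 3) ℝ | 0 < A.det} 1 (f 1) := by
    intro f hf h0 hdet
    refine JoinedIn.ofLine hf.continuousOn h0 rfl ?_
    rintro _ ⟨t, -, rfl⟩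
    rw [Set.mem_ofPred_eq, hdet]
    nlinarith [sq_nonneg (1 - 2 * t), sq_nonneg (t * (1 - t)), sq_nonneg (t * (1 - t) - 1 / 4)]
  have hne : ∀ i, d i ≠ 0 := by
    intro i h
    fin_cases i <;> simp_all
  have half : ∀ e : Fin 3 → ℝ, (∀ i, 0 < e i * d i) →
      JoinedIn {A : Matrix (Fin 3) (Fin 3) ℝ | 0 < A.det} 1 (diagonal e) →
      JoinedIn {A : Matrix (Fin 3) (Fin 3) ℝ | 0 < A.det} 1 (diagonal d) :=
    fun e hed h => h.trans (joinedIn_diagonal hed hd)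
  rcases (hne 0).lt_or_gt with h0 | h0 <;> rcases (hne 1).lt_or_gt with h1 | h1 <;>
    rcases (hne 2).lt_or_gt with h2 | h2
  · exact absurd hd (mul_neg_of_pos_of_neg (mul_pos_of_neg_of_neg h0 h1) h2).not_gt
  · refine half ![-1, -1, 1] (by simp [Fin.forall_fin_succ, h0, h1, h2]) ?_
    convert turn (fun t => !![1 - 2 * t, -(t * (1 - t)), 0; t * (1 - t), 1 - 2 * t, 0; 0, 0, 1])
      ?_ ?_ ?_ using 1
    · ext i j
      fin_cases i <;> fin_cases j <;> norm_num
    · refine continuous_matrix fun i j => ?_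
      fin_cases i <;> fin_cases j <;> simp <;> fun_prop
    · ext i j
      fin_cases i <;> fin_cases j <;> norm_num
    · intro t
      simp [det_fin_three]
      ring
  · refine half ![-1, 1, -1] (by simp [Fin.forall_fin_succ, h0, h1, h2]) ?_
    convert turn (fun t => !![1 - 2 * t, 0, -(t * (1 - t)); 0, 1, 0; t * (1 - t), 0, 1 - 2 * t])
      ?_ ?_ ?_ using 1
    · ext i j
      fin_cases i <;> fin_cases j <;> norm_num
    · refine continuous_matrix fun i j => ?_
      fin_cases i <;> fin_cases j <;> simp <;> fun_prop
    · ext i j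
      fin_cases i <;> fin_cases j <;> norm_num
    · intro t
      simp [det_fin_three]
      ring
  · exact absurd hd (mul_neg_of_neg_of_pos (mul_neg_of_neg_of_pos h0 h1) h2).not_gt
  · refine half ![1, -1, -1] (by simp [Fin.forall_fin_succ, h0, h1, h2]) ?_
    convert turn (fun t => !![1, 0, 0; 0, 1 - 2 * t, -(t * (1 - t)); 0, t * (1 - t), 1 - 2 * t])
      ?_ ?_ ?_ using 1
    · ext i j
      fin_cases i <;> fin_cases j <;> norm_num
    · refine continuous_matrix fun i j => ?_
      fin_cases i <;> fin_cases j <;> simp <;> fun_prop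
    · ext i j
      fin_cases i <;> fin_cases j <;> norm_num
    · intro t
      simp [det_fin_three]
      ring
  · exact absurd hd (mul_neg_of_neg_of_pos (mul_neg_of_pos_of_neg h0 h1) h2).not_gt
  · exact absurd hd (mul_neg_of_pos_of_neg (mul_pos h0 h1) h2).not_gt
  · have := half (fun _ => 1) (by simp [Fin.forall_fin_succ, h0, h1, h2])
    rw [diagonal_one] at this
    exact this (JoinedIn.refl (by simp))

theorem isPathConnected_det_pos :
    IsPathConnected {A : Matrix (Fin 3) (Fin 3) ℝ | 0 < A.det} := by
  -- In odd dimension every invertible matrix has positive determinant up to a factor `±1`, so the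
  -- generators of negative determinant can be treated as well.
  let G := {A : Matrix (Fin 3) (Fin 3) ℝ | 0 < A.det}
  have hmul : ∀ A B : Matrix (Fin 3) (Fin 3) ℝ, JoinedIn G 1 A → JoinedIn G 1 B →
      JoinedIn G 1 (A * B) := fun A B hA hB => by
    have := hA.mul hB
    rw [one_mul] at this
    refine this.mono ?_
    rintro _ ⟨X, hX, Y, hY, rfl⟩
    exact (mul_pos hX hY).trans_eq (det_mul X Y).symm
  refine ⟨1, by simp, fun {A} hA => ?_⟩
  refine (diagonal_transvection_induction_of_det_ne_zero
    (fun M => (0 < M.det → JoinedIn G 1 M) ∧ (M.det < 0 → JoinedIn G 1 (-M))) A hA.ne'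
    ?_ ?_ ?_).1 hA
  · intro d _
    rw [det_diagonal, Fin.prod_univ_three]
    refine ⟨joinedIn_one_diagonal, fun h => ?_⟩
    rw [diagonal_neg]
    refine joinedIn_one_diagonal ?_
    linarith
  · intro t
    refine ⟨fun _ => ?_, fun h => ?_⟩
    · refine JoinedIn.ofLine (f := fun x => transvection t.i t.j (x * t.c)) ?_ (by simp)
        (by simp [TransvectionStruct.toMatrix]) ?_
      · unfold transvection
        refine Continuous.continuousOn (continuous_const.add (continuous_matrix fun i j => ?_))
        simp only [single_apply]
        split_ifs <;> fun_prop
      · rintro _ ⟨x, -, rfl⟩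
        simp [G, det_transvection_of_ne _ _ t.hij]
    · rw [TransvectionStruct.det] at h
      exact absurd h (by norm_num)
  · intro A B hA hB ⟨hA1, hA2⟩ ⟨hB1, hB2⟩
    rw [det_mul]
    refine ⟨fun h => ?_, fun h => ?_⟩
    · rcases hA.lt_or_gt with h0 | h0
      · rw [← neg_mul_neg]
        exact hmul _ _ (hA2 h0) (hB2 (neg_of_mul_pos_right h h0.le))
      · exact hmul _ _ (hA1 h0) (hB1 (pos_of_mul_pos_right h h0.le))
    · rcases hA.lt_or_gt with h0 | h0
      · rw [← neg_mul]
        exact hmul _ _ (hA2 h0) (hB1 (pos_of_mul_neg_right h h0.le))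
      · rw [← mul_neg]
        exact hmul _ _ (hA1 h0) (hB2 (neg_of_mul_neg_right h h0.le))

end

/-! ### Continuous families of configurations -/

theorem Continuous.projectivization_mk {X : Type*} [TopologicalSpace X] {f : X → Fin 3 → ℝ}
    (hf : Continuous f) (h0 : ∀ x, f x ≠ 0) :
    Continuous fun x => (Projectivization.mk ℝ (f x) (h0 x) : RP2) :=
  (continuous_quotient_mk' (s := projectivizationSetoid ℝ (Fin 3 → ℝ))).comp (hf.subtype_mk h0)

section

variable {n : ℕ} {u : Fin n → Fin 3 → ℝ}

theorem Generic.exists_br_ne_zero (h : Generic u) (hn : 3 ≤ n) {i j : Fin n} (hij : i ≠ j) :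
    ∃ k, br (u i) (u j) (u k) ≠ 0 := by
  obtain ⟨k, -, hk⟩ := Finset.exists_mem_notMem_of_card_lt_card (s := {i, j})
    (t := (Finset.univ : Finset (Fin n))) (Finset.card_le_two.trans_lt (by rwa [Finset.card_fin]))
  simp only [Finset.mem_insert, Finset.mem_singleton, not_or] at hk
  exact ⟨k, h i j k hij (Ne.symm hk.1) (Ne.symm hk.2)⟩

theorem Generic.ne_zero (h : Generic u) (hn : 3 ≤ n) (i : Fin n) : u i ≠ 0 := by
  have : Nontrivial (Fin n) := Fin.nontrivial_iff_two_le.2 (by omega)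
  obtain ⟨j, hj⟩ := exists_ne i
  obtain ⟨k, hk⟩ := h.exists_br_ne_zero hn hj.symm
  exact (ne_zero_of_br_ne_zero hk).1

theorem Generic.injective_mk (h : Generic u) (hn : 3 ≤ n) :
    Function.Injective fun i => (Projectivization.mk ℝ (u i) (h.ne_zero hn i) : RP2) := by
  intro i j hij
  by_contra hne
  obtain ⟨k, hk⟩ := h.exists_br_ne_zero hn hne
  exact mk_ne_mk_of_br_ne_zero _ _ hk hij

/-- The configuration of the points with homogeneous coordinates `u i`. -/
noncomputable def Generic.configuration (h : Generic u) (hn : 3 ≤ n) : Configuration n :=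
  Configuration.ofTuple ⟨_, h.injective_mk hn⟩

theorem Generic.represents (h : Generic u) (hn : 3 ≤ n) :
    Represents u (h.configuration hn).points := by
  refine ⟨h.ne_zero hn, fun x => ?_⟩
  simp only [Generic.configuration, Configuration.points, Configuration.ofTuple, Finset.mem_map,
    Finset.mem_univ, true_and, Function.Embedding.coeFn_mk]
  exact ⟨fun ⟨i, hi⟩ => ⟨i, h.ne_zero hn i, hi.symm⟩, fun ⟨i, _, hi⟩ => ⟨i, hi.symm⟩⟩

theorem Represents.configuration_eq {P Q : Configuration n} (hP : Represents u P.points)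
    (hQ : Represents u Q.points) : P = Q :=
  Subtype.ext (Finset.ext fun x => (hP.2 x).trans (hQ.2 x).symm)

/-- The configurations whose homogeneous coordinates are given by a continuous map on a
path-connected set form a path-connected set. -/
theorem IsPathConnected.of_represents {X : Type*} [TopologicalSpace X] {K : Set X}
    (hK : IsPathConnected K) (hn : 3 ≤ n) {f : X → Fin n → Fin 3 → ℝ} (hf : Continuous f)
    (hg : ∀ x ∈ K, Generic (f x)) {S : Set (Configuration n)}
    (hS : ∀ P, P ∈ S ↔ ∃ x ∈ K, Represents (f x) P.points) : IsPathConnected S := by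
  have := isPathConnected_iff_pathConnectedSpace.1 hK
  have hcont : Continuous fun x : K => (hg x.1 x.2).configuration hn :=
    continuous_coinduced_rng.comp <| Continuous.subtype_mk
      (continuous_pi fun i => ((continuous_apply i).comp
        (hf.comp continuous_subtype_val)).projectivization_mk
          fun x => (hg x.1 x.2).ne_zero hn i) _
  have : S = Set.range fun x : K => (hg x.1 x.2).configuration hn := by
    ext P
    rw [hS]
    exact ⟨fun ⟨x, hx, h⟩ => ⟨⟨x, hx⟩, ((hg x hx).represents hn).configuration_eq h⟩,
      fun ⟨x, h⟩ => ⟨x.1, x.2, h ▸ (hg x.1 x.2).represents hn⟩⟩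
  rw [this]
  exact isPathConnected_range hcont

end

/-! ### The two spaces as images of path-connected spaces -/

section

variable {X : Type*} [TopologicalSpace X]

theorem Continuous.br {f g h : X → Fin 3 → ℝ} (hf : Continuous f) (hg : Continuous g)
    (hh : Continuous h) : Continuous fun x => br (f x) (g x) (h x) := by
  simp only [br_eq]
  fun_prop

theorem continuous_mulVec_normalHexagon :
    Continuous fun x : Matrix (Fin 3) (Fin 3) ℝ × (Fin 6 → ℝ) =>
      fun i => x.1.mulVec (normalHexagon x.2 i) := by
  have h : Continuous normalHexagon := by
    refine continuous_pi fun i => continuous_pi fun j => ?_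
    fin_cases i <;> fin_cases j <;> simp only [normalHexagon] <;> simp <;> fun_prop
  exact continuous_pi fun i =>
    continuous_fst.matrix_mulVec ((continuous_apply i).comp (h.comp continuous_snd))

/-- The point with barycentric coordinates `β` in the central triangle. -/
def centralPoint (u : Fin 6 → Fin 3 → ℝ) (β : Fin 3 → ℝ) : Fin 3 → ℝ :=
  β 0 • crossing₁₂ u + β 1 • crossing₂₀ u + β 2 • crossing₀₁ u

theorem continuous_centralPoint :
    Continuous fun x : (Fin 6 → Fin 3 → ℝ) × (Fin 3 → ℝ) => centralPoint x.1 x.2 := by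
  have h : ∀ i : Fin 6, Continuous fun x : (Fin 6 → Fin 3 → ℝ) × (Fin 3 → ℝ) => x.1 i :=
    fun i => by fun_prop
  have hb : ∀ i j k : Fin 6, Continuous fun x : (Fin 6 → Fin 3 → ℝ) × (Fin 3 → ℝ) =>
    br (x.1 i) (x.1 j) (x.1 k) := fun i j k => (h i).br (h j) (h k)
  have hβ : ∀ i : Fin 3, Continuous fun x : (Fin 6 → Fin 3 → ℝ) × (Fin 3 → ℝ) => x.2 i :=
    fun i => by fun_prop
  unfold centralPoint crossing₀₁ crossing₁₂ crossing₂₀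
  exact (((hβ 0).smul (((hb _ _ _).smul (h _)).add ((hb _ _ _).smul (h _)))).add
    ((hβ 1).smul (((hb _ _ _).smul (h _)).add ((hb _ _ _).smul (h _))))).add
    ((hβ 2).smul (((hb _ _ _).smul (h _)).add ((hb _ _ _).smul (h _))))

variable {u : Fin 6 → Fin 3 → ℝ}

theorem central_centralPoint (hD : 0 < concurrency u) {β : Fin 3 → ℝ} (hβ : ∀ i, 0 < β i) :
    Central u (centralPoint u β) := by
  have h03 : br (u 0) (u 3) (centralPoint u β) = β 0 * concurrency u := by
    simp only [centralPoint, crossing₀₁, crossing₁₂, crossing₂₀, concurrency, br_add₃, br_smul₃]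
    simp only [br_eq]
    ring
  have h14 : br (u 1) (u 4) (centralPoint u β) = -(β 1 * concurrency u) := by
    simp only [centralPoint, crossing₀₁, crossing₁₂, crossing₂₀, concurrency, br_add₃, br_smul₃]
    simp only [br_eq]
    ring
  have h25 : br (u 2) (u 5) (centralPoint u β) = β 2 * concurrency u := by
    simp only [centralPoint, crossing₀₁, crossing₁₂, crossing₂₀, concurrency, br_add₃, br_smul₃]
    simp only [br_eq]
    ring
  refine Or.inl ⟨hD, ?_, ?_, ?_⟩
  · rw [h03]; exact mul_pos (hβ 0) hD
  · rw [h14]; exact neg_neg_of_pos (mul_pos (hβ 1) hD)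
  · rw [h25]; exact mul_pos (hβ 2) hD

theorem Central.exists_eq_centralPoint {v : Fin 3 → ℝ} (h : Central u v) (hD : 0 < concurrency u) :
    ∃ β : Fin 3 → ℝ, (∀ i, 0 < β i) ∧ centralPoint u β = v := by
  obtain ⟨-, h03, h14, h25⟩ := h.resolve_right fun h => h.1.not_gt hD
  refine ⟨![br (u 0) (u 3) v / concurrency u, -br (u 1) (u 4) v / concurrency u,
    br (u 2) (u 5) v / concurrency u], fun i => ?_, ?_⟩
  · fin_cases i
    · exact div_pos h03 hD
    · exact div_pos (neg_pos.2 h14) hD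
    · exact div_pos h25 hD
  · simp only [centralPoint, Matrix.cons_val, div_eq_inv_mul, mul_smul, ← smul_add]
    rw [inv_smul_eq_iff₀ hD.ne', concurrency_smul, neg_smul, ← sub_eq_add_neg]

end

section

variable {A : Matrix (Fin 3) (Fin 3) ℝ} {θ : Fin 6 → ℝ}

/-- The image of a hexagon in normal form under a linear map that preserves the orientation. -/
theorem positive_mulVec_normalHexagon (hA : 0 < A.det) (hθ : θ ∈ normalRegion) :
    Positive (fun i => A.mulVec (normalHexagon θ i)) ∧
      0 < concurrency (fun i => A.mulVec (normalHexagon θ i)) ∧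
      0 < conicity (fun i => A.mulVec (normalHexagon θ i)) := by
  refine ⟨(positive_normalHexagon hθ).mulVec hA, ?_, ?_⟩
  · rw [concurrency_mulVec, concurrency_normalHexagon]
    exact mul_pos (pow_pos hA 2) (sub_pos.2 hθ.2.2.2.2.1)
  · rw [conicity_mulVec, conicity_normalHexagon]
    exact mul_pos (pow_pos hA 4) hθ.2.2.2.2.2

theorem isPathConnected_nonconcurrentLC61 : IsPathConnected Configuration.nonconcurrentLC61 := by
  refine (isPathConnected_det_pos.prod isPathConnected_normalRegion).of_represents (by norm_num)
    continuous_mulVec_normalHexagon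
    (fun x hx => (positive_mulVec_normalHexagon hx.1 hx.2).1.generic) fun P => ?_
  constructor
  · intro hP
    obtain ⟨u, ⟨h, hu⟩, hD, hC⟩ := exists_represents_pos hP
    obtain ⟨A, θ, c, hA, hc, hθ, he⟩ := hu.exists_mem_normalRegion hD hC
    refine ⟨(A, θ), ⟨hA, hθ⟩, ?_⟩
    have := h.smul fun i => (hc i).ne'
    rwa [funext he] at this
  · rintro ⟨⟨A, θ⟩, ⟨hA, hθ⟩, h⟩
    obtain ⟨hpos, hD, hC⟩ := positive_mulVec_normalHexagon hA hθ
    exact mem_nonconcurrentLC61_iff.2 ⟨_, h, hpos, hD.ne', hC.ne'⟩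

theorem isPathConnected_QC7 : IsPathConnected (Configuration.QC7 (1, 0, 6, 0)) := by
  have hβ : IsPathConnected {β : Fin 3 → ℝ | ∀ i, 0 < β i} := by
    refine Convex.isPathConnected ?_ ⟨fun _ => 1, fun _ => one_pos⟩
    exact fun x hx y hy a b ha hb hab i => convex_Ioi (0 : ℝ) (hx i) (hy i) ha hb hab
  let f : (Matrix (Fin 3) (Fin 3) ℝ × (Fin 6 → ℝ)) × (Fin 3 → ℝ) → Fin 7 → Fin 3 → ℝ := fun x =>
    Fin.snoc (α := fun _ => Fin 3 → ℝ) (fun i => x.1.1.mulVec (normalHexagon x.1.2 i))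
      (centralPoint (fun i => x.1.1.mulVec (normalHexagon x.1.2 i)) x.2)
  have hf : Continuous f := by
    have h1 := continuous_mulVec_normalHexagon.comp
      (continuous_fst (X := Matrix (Fin 3) (Fin 3) ℝ × (Fin 6 → ℝ)) (Y := Fin 3 → ℝ))
    refine continuous_pi fun i => ?_
    induction i using Fin.lastCases with
    | last =>
      simp only [f, Fin.snoc_last]
      exact continuous_centralPoint.comp (h1.prodMk continuous_snd)
    | cast i =>
      simp only [f, Fin.snoc_castSucc]
      exact (continuous_apply i).comp h1
  refine ((isPathConnected_det_pos.prod isPathConnected_normalRegion).prod hβ).of_represents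
    (by norm_num) hf (fun x hx => ?_) fun P => ?_
  · obtain ⟨hpos, hD, -⟩ := positive_mulVec_normalHexagon hx.1.1 hx.1.2
    exact generic_snoc hpos.generic fun i j hij =>
      (central_centralPoint hD hx.2).br_ne_zero hpos hij
  · rw [Configuration.mem_QC7_iff]
    constructor
    · rintro ⟨u, v, h⟩
      obtain ⟨u, v, ⟨h, hu, -, hv⟩, hD, hC⟩ := h.exists_pos
      obtain ⟨A, θ, c, hA, hc, hθ, he⟩ := hu.exists_mem_normalRegion hD hC
      have hu' := h.erase_last.smul fun i => (hc i).ne'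
      have hv' := hv.smul hc
      rw [funext he] at hu' hv'
      obtain ⟨β, hβ, rfl⟩ := hv'.exists_eq_centralPoint (positive_mulVec_normalHexagon hA hθ).2.1
      refine ⟨((A, θ), β), ⟨⟨hA, hθ⟩, hβ⟩, hu'.snoc hv'.ne_zero ?_⟩
      simp only [h.coe_equiv, Fin.snoc_last]
    · rintro ⟨⟨⟨A, θ⟩, β⟩, ⟨⟨hA, hθ⟩, hβ⟩, h⟩
      obtain ⟨hpos, hD, hC⟩ := positive_mulVec_normalHexagon hA hθ
      exact ⟨_, _, h, hpos, hC.ne', central_centralPoint hD hβ⟩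

end

theorem proposition4p1 :
    IsPathConnected Configuration.nonconcurrentLC61 ∧
    Configuration.QC7 (1, 0, 6, 0) =
      {P : Configuration 7 | ∃ p : {x // x ∈ P.points},
        P.erase p ∈ Configuration.nonconcurrentLC61 ∧
          p.1 ∈ (P.erase p).centralTriangle} ∧
    IsPathConnected (Configuration.QC7 (1, 0, 6, 0)) :=
  ⟨isPathConnected_nonconcurrentLC61,
    Set.ext fun _ => Configuration.mem_QC7_iff.trans Configuration.exists_center_iff.symm,
    isPathConnected_QC7⟩
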